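/- **Setting.** An episodic MDP has a measurable state space $\mathcal S$, a discrete (finite or countable) action space $\mathcal A$, horizon $H$, transition kernels $\mathbb P_h$ and deterministic rewards $r_h:\mathcal S\times\mathcal A\to[0,1]$, $h\in[H]$. A policy $\pi=\{\pi_h\}$ assigns to each step and state a distribution on $\mathcal A$; $V^\pi_h(x)=\mathbb E_\pi[\sum_{h'=h}^H r_{h'}(x_{h'},a_{h'})\mid x_h=x]$, $V^*_h=\sup_\pi V^\pi_h$, $V^*_{H+1}=0$, and $\pi^*$ is an optimal policy, i.e. $V^{\pi^*}_h=V^*_h$ for all $h$. For $V:\mathcal S\to\mathbb R$ let $[\mathbb V_hV](x,a)=\max\{1,\mathrm{Var}_{x'\sim\mathbb P_h(\cdot|x,a)}V(x')\}$. The MDP is linear with known measurable feature map $\phi:\mathcal S\times\mathcal A\to\mathbb R^d$: for each $h$ there are signed measures $\mu_h=(\mu_h^{(1)},\dots,\mu_h^{(d)})$ on $\mathcal S$ and $\theta_h\in\mathbb R^d$ with $\mathbb P_h(\cdot|x,a)=\langle\phi(x,a),\mu_h(\cdot)\rangle$, $r_h(x,a)=\langle\phi(x,a),\theta_h\rangle$,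 $\|\phi(x,a)\|_2\le1$, and $\|\mu_h(\mathcal S)\|_2,\|\theta_h\|_2\le\sqrt d$. We write $\|u\|_\Lambda=\sqrt{u^\top\Lambda u}$ and $y_{[0,m]}=\max\{0,\min\{m,y\}\}$. **Data.** There are four datasets $\mathcal D_{\rm ref},\mathcal D_0,\mathcal D_0',\mathcal D_1$ of $K$ trajectories each; all $4K$ trajectories $(x_h^\tau,a_h^\tau,r_h^\tau)_{h\in[H]}$ are independent and generated by one behavior policy from one initial distribution. Let $\mathbf G_h=\mathbb E[\phi(x_h,a_h)\phi(x_h,a_h)^\top]$ under the behavior policy and assume $\kappa=\min_{h\in[H]}\lambda_{\min}(\mathbf G_h)>0$. **Algorithm.** Put $\phi_h^\tau=\phi(x_h^\tau,a_h^\tau)$, let $\iota=\log\frac{4Hd}{\delta\kappa^2}$, and let $\lambda>0$. Divide $\mathcal D_{\rm ref}$ and $\mathcal D_1$ into $H$ parts $\mathcal D_{{\rm ref},h},\mathcal D_{1,h}$ of equal size (up to one trajectory). All value estimates vanish at step $H+1$. *SPEVI on $\mathcal D_{\rm ref}$*, for $h=H,\dots,1$: $\Lambda_h=\sum_{\tau\in\mathcal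 D_{{\rm ref},h}}\phi_h^\tau(\phi_h^\tau)^\top+\lambda I_d$, $\widehat w_h=\Lambda_h^{-1}\sum_{\tau\in\mathcal D_{{\rm ref},h}}\phi_h^\tau(r_h^\tau+\widehat V^{\rm ref}_{h+1}(x_{h+1}^\tau))$, and $\widehat V^{\rm ref}_h(x)=\max_a\{\phi(x,a)^\top\widehat w_h-\beta_{\rm ref}\|\phi(x,a)\|_{\Lambda_h^{-1}}\}_{[0,H-h+1]}$. *SPEVI+*, for $h=H,\dots,1$: let $\widetilde\beta_{h,2},\widetilde\beta_{h,1}$ be the ridge regressions (regularization $\lambda\|\cdot\|_2^2$) of $\widehat V^{\rm ref}_{h+1}(x^\tau_{h+1})^2$ and of $\widehat V^{\rm ref}_{h+1}(x^\tau_{h+1})$ on $\phi_h^\tau$ over $\mathcal D_0'$, and $\bar\sigma_h^2(x,a)=\max\{1,\ (\phi(x,a)^\top\widetilde\beta_{h,2})_{[0,H^2]}-((\phi(x,a)^\top\widetilde\beta_{h,1})_{[0,H]})^2\}$. Let $\widehat{\mathbf Z}_h=\sum_{\tau\in\mathcal D_0}\phi_h^\tau(\phi_h^\tau)^\top/\bar\sigma_h^2(x_h^\tau,a_h^\tau)+\lambda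 I_d$, $\ \widehat w_{0,h}=\widehat{\mathbf Z}_h^{-1}\sum_{\tau\in\mathcal D_0}\phi_h^\tau\,(r_h^\tau+\widehat V^{\rm ref}_{h+1}(x_{h+1}^\tau))/\bar\sigma_h^2(x_h^\tau,a_h^\tau)$, $\mathbf W_h=\sum_{\tau\in\mathcal D_{1,h}}\phi_h^\tau(\phi_h^\tau)^\top+\lambda I_d$, $\ \widehat w_{1,h}=\mathbf W_h^{-1}\sum_{\tau\in\mathcal D_{1,h}}\phi_h^\tau\,(\widehat V_{h+1}-\widehat V^{\rm ref}_{h+1})(x_{h+1}^\tau)$, $b_{0,h}(x,a)=\beta_0\|\phi(x,a)\|_{\widehat{\mathbf Z}_h^{-1}}+\frac{4\lambda H^3\sqrt d}{K\kappa}$, and $\widehat Q_h=\{\phi^\top\widehat w_{0,h}-b_{0,h}+\phi^\top\widehat w_{1,h}-b_1\}_{[0,H-h+1]}$, $\ \widehat V_h(x)=\max_a\widehat Q_h(x,a)$. The output $\widehat\pi$ is any policy such that $\widehat\pi_h(\cdot|x)$ maximizes $\langle\widehat Q_h(x,\cdot),\cdot\rangle$ over distributions on $\mathcal A$, for all $h$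 and $x$. **Theorem (SPEVI+).** There are universal constants $c_{\rm ref},c_0,c_1,c_K,C>0$ and exponents $p_{\rm ref},p_0,p_1,p_K,p\in\mathbb N$ such that the following holds for every linear MDP and data as above, every $\delta\in(0,1)$, every $0<\lambda<\kappa$ and every $$K>\max\Big\{512\,H\log\frac{4Hd}{\delta\kappa^2},\ c_K\,\iota^{p_K}\,\frac{dH^{13}}{\kappa^4}\Big\}.$$ If SPEVI+ is run with $\beta_{\rm ref}=c_{\rm ref}\iota^{p_{\rm ref}}\sqrt d\,H$, $\beta_0=c_0\iota^{p_0}\sqrt d$ and $b_1=c_1\iota^{p_1}\frac{dH^3}{K\kappa}$, then with probability at least $1-\delta$, simultaneously for all $x\in\mathcal S$, $$V_1^*(x)-V_1^{\widehat\pi}(x)\le C\iota^{p}\sqrt d\,\sum_{h=1}^H\mathbb E_{\pi^*}\Big[\big(\phi(x_h,a_h)^\top\mathbf Z_h^{*-1}\phi(x_h,a_h)\big)^{1/2}\,\Big|\,x_1=x\Big]+C\iota^{p}\,\frac{dH^4}{K\kappa},$$ where $\mathbf Z^*_h=\sum_{\tau\in\mathcal D_0}\phi_h^\tau(\phi_h^\tau)^\top/[\mathbb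 V_hV^*_{h+1}](x_h^\tau,a_h^\tau)+\lambda I_d$ (the expectation is over a fresh trajectory of $\pi^*$, with $\mathcal D_0$ fixed). -/

import Mathlib

open MeasureTheory ProbabilityTheory Matrix

universe u v w

noncomputable section

namespace OfflineRL

/-! ### Episodic Markov decision processes

Steps are numbered `0, 1, …, H - 1`; kernels, rewards and policies are sequences indexed by `ℕ`
of which only the entries with index `< H` are ever used. -/

/-- Transition kernels and deterministic rewards in `[0, 1]`. -/
structure MDP (S : Type u) (A : Type v) [MeasurableSpace S] [MeasurableSpace A] where
  P : ℕ → Kernel (S × A) S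
  markov_P : ∀ h, IsMarkovKernel (P h)
  r : ℕ → S × A → ℝ
  measurable_r : ∀ h, Measurable (r h)
  r_mem : ∀ h z, r h z ∈ Set.Icc (0 : ℝ) 1

attribute [instance] MDP.markov_P

/-- A (randomized, Markov, time-dependent) policy. -/
structure Policy (S : Type u) (A : Type v) [MeasurableSpace S] [MeasurableSpace A] where
  ker : ℕ → Kernel S A
  markov_ker : ∀ h, IsMarkovKernel (ker h)

attribute [instance] Policy.markov_ker

section Trajectories

variable {S : Type u} {A : Type v} [MeasurableSpace S] [MeasurableSpace A]

theorem measurable_consStep (n : ℕ) :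
    Measurable (fun q : S × ((A × S) × (Fin n → S × A)) =>
      (Fin.cons (q.1, q.2.1.1) q.2.2 : Fin (n + 1) → S × A)) := by
  refine measurable_pi_lambda _ fun i => ?_
  refine Fin.cases ?_ (fun j => ?_) i
  · simp only [Fin.cons_zero]; fun_prop
  · simp only [Fin.cons_succ]; fun_prop

/-- `rollout M π n h x` is the law of the `n` state-action pairs
`(x_h, a_h), …, (x_{h+n-1}, a_{h+n-1})` when `x_h = x`, `a_k ∼ π_k(· | x_k)` and
`x_{k+1} ∼ P_k(· | x_k, a_k)`. -/
def rollout (M : MDP S A) (π : Policy S A) : (n : ℕ) → ℕ → Kernel S (Fin n → S × A)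
  | 0, _ => Kernel.const S (Measure.dirac (fun i => i.elim0))
  | n + 1, h =>
      (Kernel.id ×ₖ ((π.ker h ⊗ₖ M.P h) ⊗ₖ
        (rollout M π n (h + 1)).comap (fun p : S × (A × S) => p.2.2) (by fun_prop))).map
          (fun q => Fin.cons (q.1, q.2.1.1) q.2.2)

instance rollout_isMarkovKernel (M : MDP S A) (π : Policy S A) :
    ∀ n h, IsMarkovKernel (rollout M π n h)
  | 0, h => by unfold rollout; infer_instance
  | n + 1, h => by
      have := rollout_isMarkovKernel M π n (h + 1)
      unfold rollout
      exact Kernel.IsMarkovKernel.map _ (measurable_consStep n)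

/-- Law of a trajectory `(x_h, a_h)_{h < H}` under `π`, with initial state distribution `ρ`. -/
def trajLaw (M : MDP S A) (H : ℕ) (π : Policy S A) (ρ : Measure S) : Measure (Fin H → S × A) :=
  ρ.bind (rollout M π H 0)

/-- `V^π_h(x)`, the expected total reward of `π` from step `h` on when `x_h = x`. -/
def value (M : MDP S A) (H : ℕ) (π : Policy S A) (h : ℕ) (x : S) : ℝ :=
  ∫ t, ∑ i : Fin (H - h), M.r (h + i) (t i) ∂(rollout M π (H - h) h x)

/-- `V^*_h(x)`. -/
def optValue (M : MDP S A) (H : ℕ) (h : ℕ) (x : S) : ℝ :=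
  ⨆ π : Policy S A, value M H π h x

def IsOptimal (M : MDP S A) (H : ℕ) (π : Policy S A) : Prop :=
  ∀ h x, value M H π h x = optValue M H h x

/-- `[Var_h V](x, a)`. -/
def stepVar (M : MDP S A) (h : ℕ) (V : S → ℝ) (z : S × A) : ℝ :=
  (∫ y, V y ^ 2 ∂(M.P h z)) - (∫ y, V y ∂(M.P h z)) ^ 2

/-- `[𝕍_h V](x, a) = max {1, [Var_h V](x, a)}`. -/
def truncVar (M : MDP S A) (h : ℕ) (V : S → ℝ) (z : S × A) : ℝ :=
  max 1 (stepVar M h V z)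

/-- Linear MDP with feature map `φ`, with the usual normalization in the Euclidean norm. -/
structure IsLinear (M : MDP S A) (H : ℕ) {d : ℕ} (φ : S × A → Fin d → ℝ) : Prop where
  measurable_feature : Measurable φ
  norm_feature_le : ∀ z, ‖WithLp.toLp 2 (φ z)‖ ≤ 1
  linear : ∀ h < H, ∃ (μ : Fin d → SignedMeasure S) (θ : Fin d → ℝ),
    (∀ z, ∀ B, MeasurableSet B → (M.P h z).real B = ∑ i, φ z i * μ i B) ∧
    (∀ z, M.r h z = φ z ⬝ᵥ θ) ∧
    ‖WithLp.toLp 2 (fun i => μ i Set.univ)‖ ≤ √(d : ℝ) ∧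
    ‖WithLp.toLp 2 θ‖ ≤ √(d : ℝ)

/-- `G_h = E[φ(x_h, a_h) φ(x_h, a_h)ᵀ]` for trajectories of the behavior policy `b`. -/
def featureCov (M : MDP S A) {H d : ℕ} (φ : S × A → Fin d → ℝ) (b : Policy S A) (ρ : Measure S)
    (h : Fin H) : Matrix (Fin d) (Fin d) ℝ :=
  Matrix.of fun i j => ∫ t, φ (t h) i * φ (t h) j ∂(trajLaw M H b ρ)

/-- Smallest eigenvalue of a symmetric matrix. -/
def lambdaMin {d : ℕ} (G : Matrix (Fin d) (Fin d) ℝ) : ℝ := sInf (spectrum ℝ G)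

/-- `κ = min_h λ_min(G_h)`. It is `0` for `H = 0` or `d = 0`. -/
def coverage (M : MDP S A) (H : ℕ) {d : ℕ} (φ : S × A → Fin d → ℝ) (b : Policy S A)
    (ρ : Measure S) : ℝ :=
  ⨅ h : Fin H, lambdaMin (featureCov M φ b ρ h)

end Trajectories

/-! ### Datasets and ridge regression -/

/-- `K` trajectories of length `H` with the observed rewards. -/
structure Dataset (S : Type u) (A : Type v) (H K : ℕ) where
  pair : Fin K → Fin H → S × A
  rew : Fin K → Fin H → ℝ

section Algorithm

variable {S : Type u} {A : Type v} {H K d : ℕ}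

/-- The observed dataset: `r_h^τ = r_h(x_h^τ, a_h^τ)`. -/
def observe [MeasurableSpace S] [MeasurableSpace A] (M : MDP S A)
    (t : Fin K → Fin H → S × A) : Dataset S A H K :=
  ⟨t, fun τ h => M.r h (t τ h)⟩

/-- `V(x_{h+1}^τ)`; value functions vanish after the last step, so this is `0` at the last step. -/
def Dataset.next (D : Dataset S A H K) (V : S → ℝ) (h : Fin H) (τ : Fin K) : ℝ :=
  if hh : (h : ℕ) + 1 < H then V (D.pair τ ⟨h + 1, hh⟩).1 else 0

/-- A division of `K` trajectories into `H` parts of equal size (up to one trajectory). -/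
def IsUniformSplit (s : Fin K → Fin H) : Prop :=
  ∀ h h' : Fin H, (Finset.univ.filter fun τ => s τ = h).card ≤
    (Finset.univ.filter fun τ => s τ = h').card + 1

/-- `‖u‖_Λ = √(uᵀ Λ u)`. -/
def wnorm (Λ : Matrix (Fin d) (Fin d) ℝ) (u : Fin d → ℝ) : ℝ := √(u ⬝ᵥ (Λ *ᵥ u))

/-- `max {0, min {m, y}}`. -/
def clip (m y : ℝ) : ℝ := max 0 (min m y)

/-- `∑_{τ ∈ T} φ_h^τ (φ_h^τ)ᵀ / σ(x_h^τ, a_h^τ) + lam I`. -/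
def ridgeMatrix (φ : S × A → Fin d → ℝ) (lam : ℝ) (D : Dataset S A H K) (T : Finset (Fin K))
    (σ : S × A → ℝ) (h : Fin H) : Matrix (Fin d) (Fin d) ℝ :=
  (∑ τ ∈ T, (σ (D.pair τ h))⁻¹ • vecMulVec (φ (D.pair τ h)) (φ (D.pair τ h))) + lam • 1

/-- The weighted ridge regression solution
`argmin_w ∑_{τ ∈ T} (φ_h^τ · w - y_τ)² / σ(x_h^τ, a_h^τ) + lam ‖w‖²`. -/
def ridge (φ : S × A → Fin d → ℝ) (lam : ℝ) (D : Dataset S A H K) (T : Finset (Fin K))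
    (σ : S × A → ℝ) (h : Fin H) (y : Fin K → ℝ) : Fin d → ℝ :=
  (ridgeMatrix φ lam D T σ h)⁻¹ *ᵥ ∑ τ ∈ T, (y τ / σ (D.pair τ h)) • φ (D.pair τ h)

/-- Backward value iteration: `V_h(x) = max_a Q_h(x, a)`, where `Q_h = F_h(V_{h+1})`,
with `V_h = 0` for `h ≥ H`. -/
def backward (F : Fin H → (S → ℝ) → S × A → ℝ) (h : ℕ) : S → ℝ :=
  if hh : h < H then fun x => ⨆ a, F ⟨h, hh⟩ (backward F (h + 1)) (x, a) else fun _ => 0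
termination_by H - h

/-! ### SPEVI -/

/-- `Q_h` of SPEVI, computed from the trajectories `τ` with `s τ = h`. -/
def speviQ (φ : S × A → Fin d → ℝ) (lam β : ℝ) (D : Dataset S A H K) (s : Fin K → Fin H)
    (h : Fin H) (V : S → ℝ) (z : S × A) : ℝ :=
  clip ((H : ℝ) - (h : ℕ))
    (φ z ⬝ᵥ ridge φ lam D (Finset.univ.filter fun τ => s τ = h) (fun _ => 1) h
        (fun τ => D.rew τ h + D.next V h τ) -
      β * wnorm (ridgeMatrix φ lam D (Finset.univ.filter fun τ => s τ = h) (fun _ => 1) h)⁻¹ (φ z))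

/-- The value functions constructed by SPEVI. -/
def speviV (φ : S × A → Fin d → ℝ) (lam β : ℝ) (D : Dataset S A H K) (s : Fin K → Fin H) :
    ℕ → S → ℝ :=
  backward (speviQ φ lam β D s)

/-! ### SPEVI+ -/

/-- The variance estimator at step `h` for the target `V = V_{h+1}`, computed from `D`. -/
def varEst (φ : S × A → Fin d → ℝ) (lam : ℝ) (D : Dataset S A H K) (h : Fin H) (V : S → ℝ)
    (z : S × A) : ℝ :=
  max 1
    (clip ((H : ℝ) ^ 2)
        (φ z ⬝ᵥ ridge φ lam D Finset.univ (fun _ => 1) h (fun τ => D.next V h τ ^ 2)) -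
      clip (H : ℝ)
        (φ z ⬝ᵥ ridge φ lam D Finset.univ (fun _ => 1) h (fun τ => D.next V h τ)) ^ 2)

/-- Everything SPEVI+ is run with: the four datasets, the divisions of `Dref` and `D1` into `H`
parts, the regularization `lam`, the coverage `κ`, the multiplier `βref` of the SPEVI bonus, the
multiplier `β0` of the reference bonus, and the constant advantage bonus `b1`. -/
structure Input (S : Type u) (A : Type v) (H K : ℕ) where
  Dref : Dataset S A H K
  D0 : Dataset S A H K
  D0' : Dataset S A H K
  D1 : Dataset S A H K
  sref : Fin K → Fin H
  s1 : Fin K → Fin H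
  lam : ℝ
  κ : ℝ
  βref : ℝ
  β0 : ℝ
  b1 : ℝ

namespace Input

variable (I : Input S A H K) (φ : S × A → Fin d → ℝ)

/-- The reference value functions. -/
def Vref : ℕ → S → ℝ := speviV φ I.lam I.βref I.Dref I.sref

/-- The estimated conditional variance of the next reference value. -/
def var (h : Fin H) : S × A → ℝ := varEst φ I.lam I.D0' h (I.Vref φ (h + 1))

def Zhat (h : Fin H) : Matrix (Fin d) (Fin d) ℝ :=
  ridgeMatrix φ I.lam I.D0 Finset.univ (I.var φ h) h

/-- Variance-weighted regression of `r_h + Vref_{h+1}`. -/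
def w0 (h : Fin H) : Fin d → ℝ :=
  ridge φ I.lam I.D0 Finset.univ (I.var φ h) h
    (fun τ => I.D0.rew τ h + I.D0.next (I.Vref φ (h + 1)) h τ)

/-- The reference bonus. -/
def b0 (h : Fin H) (z : S × A) : ℝ :=
  I.β0 * wnorm (I.Zhat φ h)⁻¹ (φ z) + 4 * I.lam * (H : ℝ) ^ 3 * √(d : ℝ) / (K * I.κ)

/-- Regression of the advantage `V - Vref_{h+1}` of `V = V_{h+1}` on the `h`-th part of `D1`. -/
def w1 (h : Fin H) (V : S → ℝ) : Fin d → ℝ :=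
  ridge φ I.lam I.D1 (Finset.univ.filter fun τ => I.s1 τ = h) (fun _ => 1) h
    (fun τ => I.D1.next (fun x => V x - I.Vref φ (h + 1) x) h τ)

/-- One step of SPEVI+, from `V = V_{h+1}` to `Q_h`. -/
def stepQ (h : Fin H) (V : S → ℝ) (z : S × A) : ℝ :=
  clip ((H : ℝ) - (h : ℕ))
    (φ z ⬝ᵥ I.w0 φ h - I.b0 φ h z + φ z ⬝ᵥ I.w1 φ h V - I.b1)

/-- The value functions of SPEVI+. -/
def Vhat : ℕ → S → ℝ := backward (I.stepQ φ)

/-- The Q-functions of SPEVI+. -/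
def Qhat (h : Fin H) : S × A → ℝ := I.stepQ φ h (I.Vhat φ (h + 1))

end Input

/-- SPEVI+ run on the datasets `D_ref, D_0, D_0', D_1 = t 0, t 1, t 2, t 3`. -/
def mkInput [MeasurableSpace S] [MeasurableSpace A] (M : MDP S A)
    (t : Fin 4 → Fin K → Fin H → S × A) (sref s1 : Fin K → Fin H) (lam κ βref β0 b1 : ℝ) :
    Input S A H K where
  Dref := observe M (t 0)
  D0 := observe M (t 1)
  D0' := observe M (t 2)
  D1 := observe M (t 3)
  sref := sref
  s1 := s1
  lam := lam
  κ := κ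
  βref := βref
  β0 := β0
  b1 := b1

/-- At every step and state `π_h(· | x)` maximizes the average of `Q_h(x, ·)` over all
distributions on the action space. -/
def IsGreedy [MeasurableSpace S] [MeasurableSpace A] (Q : Fin H → S × A → ℝ)
    (π : Policy S A) : Prop :=
  ∀ (h : Fin H) (x : S) (ν : Measure A), IsProbabilityMeasure ν →
    ∫ a, Q h (x, a) ∂ν ≤ ∫ a, Q h (x, a) ∂(π.ker h x)

/-- `Z*_h = ∑_τ φ_h^τ (φ_h^τ)ᵀ / [𝕍_h V^*_{h+1}](x_h^τ, a_h^τ) + lam I`. -/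
def Zstar [MeasurableSpace S] [MeasurableSpace A] (M : MDP S A) (φ : S × A → Fin d → ℝ) (lam : ℝ)
    (D : Dataset S A H K) (h : Fin H) : Matrix (Fin d) (Fin d) ℝ :=
  ridgeMatrix φ lam D Finset.univ (truncVar M h (optValue M H (h + 1))) h

end Algorithm

/-- The logarithm whose powers are hidden in `Õ`. -/
def logFactor (H d : ℕ) (δ κ : ℝ) : ℝ := Real.log (4 * H * d / (δ * κ ^ 2))

end OfflineRL

end

open OfflineRL

namespace OfflineRL

/-! ### Concentration of sums over the coordinates of a product measure -/

section Concentration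

variable {ι : Type*} [Fintype ι] {𝒯 : Type*} [MeasurableSpace 𝒯]

/-! All value estimates stay below `optValue`, so the loss of the greedy policy is at most the sum,
along an optimal policy, of the one-step gaps between a Bellman update and its pessimistic estimate.
The task is to make the leading gap as small as a variance-weighted regression permits, and every
other gap of second order in 1/√K.

Regression. No covering of a function class is needed, because every regression has a target and
weights that are independent of its own sample; the four datasets and the division into H parts
serve this purpose. For a fixed target, choose directions that are orthonormal for the weighted
population covariance. Bernstein's inequality controls the d² entries of the empirical covariance
and the d coordinates of the noise, and Cauchy–Schwarz then bounds the squared noise in every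
direction by 8 d v L times the empirical quadratic form (`pi_real_regression_failure_le`). This is
the origin of the factor √d. Targets that depend on the remaining trajectories are handled by
freezing the latter (`pi_failure_le_of_resampling`, `regression_failure_le`).
`RegressionGood.ridge_error` converts such a bound into a confidence width; the regularization bias
is harmless because lam < κ, and κ |w|² ≤ B² for the coefficient w of a linear function bounded by B
(`coverage_mul_coeff_le`).

Scales. Put s = ι √d H² √(H / (K κ)), which is at most 1 / (1000 H). Plain SPEVI lies within 24 s
below the optimal value (`speviV_close`). Hence the estimated variance is at most twice the
truncated variance of the optimal value (`GoodRun.var_le_two_mul`), and the variance of the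
reference target is at most twice the estimated one (`GoodRun.stepVar_Vref_le`). After weighting,
the noise has bounded variance, so β0 carries no power of H. The advantage, the difference of the
SPEVI+ and SPEVI values, is at most 30 s. Its regression over about K / H trajectories costs a
further factor of order ι √d √(H / (K κ)), and the product is the second-order bonus b1. The bound
on the advantage at step h + 1 comes from pessimism at that step and is what makes the advantage
regression at step h accurate, so both are proved together by backward induction
(`GoodRun.Vhat_bounds`).

Conclusion. Telescoping under the greedy policy gives `GoodRun.Vhat_le_value`, telescoping under the
optimal policy gives `GoodRun.optValue_sub_Vhat_le`, and the two add up to the claim. -/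

theorem integrable_of_measurable_of_abs_le {α : Type*} [MeasurableSpace α] {μ : Measure α}
    [IsFiniteMeasure μ] {f : α → ℝ} (hf : Measurable f) {b : ℝ} (hb : ∀ x, |f x| ≤ b) :
    Integrable f μ :=
  Integrable.of_bound hf.aestronglyMeasurable b (Filter.Eventually.of_forall hb)

/-- A centred random variable bounded by `b` with second moment at most `v` satisfies
`E exp (s f) ≤ exp (s² v)` for `0 ≤ s ≤ 1 / b`. -/
theorem mgf_le_exp_sq_mul (ν : Measure 𝒯) [IsProbabilityMeasure ν] {f : 𝒯 → ℝ}
    (hf : Measurable f) {b v s : ℝ} (hb : ∀ x, |f x| ≤ b) (h0 : ∫ x, f x ∂ν = 0)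
    (hv : ∫ x, f x ^ 2 ∂ν ≤ v) (hs : 0 ≤ s) (hsb : s * b ≤ 1) :
    mgf f ν s ≤ Real.exp (s ^ 2 * v) := by
  have hab : ∀ x, |s * f x| ≤ 1 := fun x => by
    rw [abs_mul, abs_of_nonneg hs]
    exact (mul_le_mul_of_nonneg_left (hb x) hs).trans hsb
  have hinteg : Integrable f ν := integrable_of_measurable_of_abs_le hf hb
  have hinteg2 : Integrable (fun x => f x ^ 2) ν :=
    integrable_of_measurable_of_abs_le (hf.pow_const 2) (b := b ^ 2) fun x => by
      rw [abs_pow]; exact pow_le_pow_left₀ (abs_nonneg _) (hb x) 2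
  have hexp : Integrable (fun x => Real.exp (s * f x)) ν := by
    refine integrable_of_measurable_of_abs_le (by fun_prop) (b := Real.exp 1) fun x => ?_
    rw [abs_of_pos (Real.exp_pos _)]
    exact Real.exp_le_exp.2 ((le_abs_self _).trans (hab x))
  calc mgf f ν s = ∫ x, Real.exp (s * f x) ∂ν := rfl
    _ ≤ ∫ x, (1 + s * f x + s ^ 2 * f x ^ 2) ∂ν := by
        refine integral_mono hexp ?_ fun x => ?_
        · exact ((integrable_const _).add (hinteg.const_mul s)).add (hinteg2.const_mul _)
        -- The quadratic bound |exp y - 1 - y| ≤ y² holds for |y| ≤ 1, which is why s b ≤ 1 is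
        -- required.
        · have := (abs_le.1 (Real.abs_exp_sub_one_sub_id_le (hab x))).2
          simp only
          nlinarith
    _ = 1 + s ^ 2 * ∫ x, f x ^ 2 ∂ν := by
        have h1 : Integrable (fun x => 1 + s * f x) ν := (integrable_const _).add (hinteg.const_mul s)
        rw [integral_add h1 (hinteg2.const_mul _),
          integral_add (integrable_const _) (hinteg.const_mul s), integral_const_mul,
          integral_const_mul, h0]
        simp
    _ ≤ 1 + s ^ 2 * v := by gcongr
    _ ≤ Real.exp (s ^ 2 * v) := by linarith [Real.add_one_le_exp (s ^ 2 * v)]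

/-- Chernoff's method with s = √(L / (n v)): the moment generating function costs exp (n s² v) = exp
L, and the threshold contributes exp (-2 L). The hypothesis `hLb` says that s b ≤ 1. -/
theorem pi_real_sum_ge_le (ν : Measure 𝒯) [IsProbabilityMeasure ν] (J : Finset ι) {f : 𝒯 → ℝ}
    (hf : Measurable f) {b v L : ℝ} (hb : ∀ x, |f x| ≤ b) (h0 : ∫ x, f x ∂ν = 0)
    (hv : ∫ x, f x ^ 2 ∂ν ≤ v) (hv0 : 0 < v) (hL : 0 < L) (hJ : 0 < J.card)
    (hLb : L * b ^ 2 ≤ J.card * v) :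
    (Measure.pi fun _ : ι => ν).real {ω | 2 * √(J.card * v * L) ≤ ∑ j ∈ J, f (ω j)}
      ≤ Real.exp (-L) := by
  set n : ℝ := (J.card : ℝ) with hn
  have hn0 : 0 < n := by positivity
  have hnv : 0 < n * v := by positivity
  set s : ℝ := √(L / (n * v)) with hsdef
  have hs : 0 ≤ s := Real.sqrt_nonneg _
  have hs2 : s ^ 2 = L / (n * v) := Real.sq_sqrt (by positivity)
  have hb0 : 0 ≤ b := by
    obtain ⟨x⟩ : Nonempty 𝒯 := by
      by_contra h
      rw [not_nonempty_iff] at h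
      have := measure_univ (μ := ν)
      simp [Set.univ_eq_empty_iff.2 h] at this
    exact (abs_nonneg _).trans (hb x)
  have hsb : s * b ≤ 1 := by
    refine abs_le_one_iff_mul_self_le_one.2 ?_ |> (le_abs_self _).trans
    have : s * b * (s * b) = L * b ^ 2 / (n * v) := by
      rw [show s * b * (s * b) = s ^ 2 * b ^ 2 by ring, hs2]; ring
    rw [this]
    exact (div_le_one hnv).2 hLb
  have hmeas : ∀ i : ι, Measurable fun ω : ι → 𝒯 => f (ω i) := fun i => by fun_prop
  have hind : iIndepFun (fun (i : ι) (ω : ι → 𝒯) => f (ω i)) (Measure.pi fun _ : ι => ν) :=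
    iIndepFun_pi fun _ => hf.aemeasurable
  have hmgf : ∀ i : ι, mgf (fun ω : ι → 𝒯 => f (ω i)) (Measure.pi fun _ : ι => ν) s
      ≤ Real.exp (s ^ 2 * v) := fun i => by
    refine le_of_eq_of_le ?_ (mgf_le_exp_sq_mul ν hf hb h0 hv hs hsb)
    have hp := measurePreserving_eval (fun _ : ι => ν) i
    have : mgf f ν s = ∫ x, Real.exp (s * f x) ∂(Measure.map (Function.eval i)
        (Measure.pi fun _ : ι => ν)) := by rw [hp.map_eq]; rfl
    rw [this, integral_map hp.measurable.aemeasurable (by fun_prop)]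
    rfl
  have hsum : mgf (∑ i ∈ J, fun ω : ι → 𝒯 => f (ω i)) (Measure.pi fun _ : ι => ν) s
      ≤ Real.exp L := by
    rw [hind.mgf_sum hmeas]
    calc _ ≤ ∏ _i ∈ J, Real.exp (s ^ 2 * v) :=
          Finset.prod_le_prod (fun _ _ => mgf_nonneg) fun i _ => hmgf i
      _ = Real.exp L := by
          rw [Finset.prod_const, ← Real.exp_nat_mul, ← hn, hs2]
          congr 1; field_simp
  have hfun : (∑ i ∈ J, fun ω : ι → 𝒯 => f (ω i)) = fun ω => ∑ j ∈ J, f (ω j) := by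
    ext ω; simp
  rw [hfun] at hsum
  have hexp : Integrable (fun ω : ι → 𝒯 => Real.exp (s * ∑ j ∈ J, f (ω j)))
      (Measure.pi fun _ : ι => ν) := by
    refine integrable_of_measurable_of_abs_le (by fun_prop) (b := Real.exp (s * (n * b)))
      fun ω => ?_
    rw [abs_of_pos (Real.exp_pos _)]
    refine Real.exp_le_exp.2 (mul_le_mul_of_nonneg_left ?_ hs)
    calc _ ≤ ∑ _j ∈ J, b := Finset.sum_le_sum fun j _ => (le_abs_self _).trans (hb _)
      _ = n * b := by simp [hn]
  refine (measure_ge_le_exp_mul_mgf _ hs hexp).trans ?_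
  calc _ ≤ Real.exp (-s * (2 * √(n * v * L))) * Real.exp L := by gcongr
    _ = Real.exp (-L) := by
        rw [← Real.exp_add]
        congr 1
        have : s * √(n * v * L) = L := by
          rw [hsdef, ← Real.sqrt_mul (by positivity), show L / (n * v) * (n * v * L) = L ^ 2 by
            field_simp, Real.sqrt_sq hL.le]
        linarith

/-- Bernstein's inequality, in the regime where the variance term dominates. -/
theorem pi_real_abs_sum_gt_le (ν : Measure 𝒯) [IsProbabilityMeasure ν] (J : Finset ι)
    {f : 𝒯 → ℝ} (hf : Measurable f) {b v L : ℝ} (hb : ∀ x, |f x| ≤ b) (h0 : ∫ x, f x ∂ν = 0)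
    (hv : ∫ x, f x ^ 2 ∂ν ≤ v) (hv0 : 0 < v) (hL : 0 < L) (hJ : 0 < J.card)
    (hLb : L * b ^ 2 ≤ J.card * v) :
    (Measure.pi fun _ : ι => ν).real {ω | 2 * √(J.card * v * L) < |∑ j ∈ J, f (ω j)|}
      ≤ 2 * Real.exp (-L) := by
  have h1 := pi_real_sum_ge_le ν J hf hb h0 hv hv0 hL hJ hLb
  have h2 := pi_real_sum_ge_le ν J (f := fun x => - f x) hf.neg (b := b) (v := v)
    (by simpa using hb) (by rw [integral_neg, h0, neg_zero]) (by simpa using hv) hv0 hL hJ hLb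
  refine le_trans (measureReal_mono (s₂ := {ω | 2 * √(J.card * v * L) ≤ ∑ j ∈ J, f (ω j)} ∪
    {ω | 2 * √(J.card * v * L) ≤ ∑ j ∈ J, - f (ω j)}) ?_) ?_
  · intro ω hω
    rcases lt_abs.1 (Set.mem_ofPred_eq ▸ hω : _ < |_|) with h | h
    · exact Or.inl h.le
    · refine Or.inr ?_
      simp only [Set.mem_ofPred_eq, Finset.sum_neg_distrib]
      exact h.le
  · exact (measureReal_union_le _ _).trans (by linarith)

/-- Factor Γ = Xᵀ X; then X is invertible and B = (X⁻¹)ᵀ works. -/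
theorem exists_whitening {d : ℕ} {Γ : Matrix (Fin d) (Fin d) ℝ} (hΓ : Γ.PosDef) :
    ∃ B : Matrix (Fin d) (Fin d) ℝ, IsUnit B ∧ B * Γ * Bᵀ = 1 := by
  open scoped MatrixOrder in
  obtain ⟨X, hX⟩ := CStarAlgebra.nonneg_iff_eq_star_mul_self.mp hΓ.posSemidef.nonneg
  rw [star_eq_conjTranspose, conjTranspose_eq_transpose_of_trivial] at hX
  have hdet : IsUnit X.det := by
    have h := (Matrix.isUnit_iff_isUnit_det _).1 hΓ.isUnit
    rw [hX, det_mul] at h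
    exact isUnit_of_mul_isUnit_right h
  refine ⟨(X⁻¹)ᵀ, ?_, ?_⟩
  · rw [Matrix.isUnit_iff_isUnit_det, det_transpose]
    exact (isUnit_nonsing_inv_det_iff).2 hdet
  · rw [hX, transpose_transpose, ← Matrix.mul_assoc, ← transpose_mul, mul_nonsing_inv _ hdet,
      transpose_one, Matrix.one_mul, mul_nonsing_inv _ hdet]

theorem dotProduct_sq_le {d : ℕ} (u w : Fin d → ℝ) : (u ⬝ᵥ w) ^ 2 ≤ (u ⬝ᵥ u) * (w ⬝ᵥ w) := by
  have := Finset.sum_mul_sq_le_sq_mul_sq Finset.univ u w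
  simpa [dotProduct, ← sq] using this

theorem dotProduct_self_nonneg' {d : ℕ} (u : Fin d → ℝ) : 0 ≤ u ⬝ᵥ u := by
  simpa using dotProduct_star_self_nonneg u

/-! ### Orthonormal directions for a weighted second-moment form. -/

section Whitening

variable (ν : Measure 𝒯) [IsProbabilityMeasure ν] {d : ℕ} {ψ : 𝒯 → Fin d → ℝ} {s : 𝒯 → ℝ}

theorem abs_dotProduct_le_sqrt {𝒯 : Type*} {ψ : 𝒯 → Fin d → ℝ} (hψ1 : ∀ x, ψ x ⬝ᵥ ψ x ≤ 1) (u : Fin d → ℝ) (x : 𝒯) :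
    |u ⬝ᵥ ψ x| ≤ √(u ⬝ᵥ u) := by
  refine Real.abs_le_sqrt ((dotProduct_sq_le _ _).trans ?_)
  exact mul_le_of_le_one_right (dotProduct_self_nonneg' u) (hψ1 x)

theorem measurable_dotProduct_left (hψ : Measurable ψ) (u : Fin d → ℝ) :
    Measurable fun x => u ⬝ᵥ ψ x := by
  unfold dotProduct; fun_prop

theorem integrable_weighted_mul (hψ : Measurable ψ) (hs : Measurable s)
    (hψ1 : ∀ x, ψ x ⬝ᵥ ψ x ≤ 1) (hs0 : ∀ x, 0 ≤ s x) (hs1 : ∀ x, s x ≤ 1) (u w : Fin d → ℝ) :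
    Integrable (fun x => s x * (u ⬝ᵥ ψ x) * (w ⬝ᵥ ψ x)) ν := by
  refine integrable_of_measurable_of_abs_le (b := 1 * √(u ⬝ᵥ u) * √(w ⬝ᵥ w))
    ((hs.mul (measurable_dotProduct_left hψ u)).mul (measurable_dotProduct_left hψ w)) fun x => ?_
  rw [abs_mul, abs_mul]
  gcongr
  · rw [abs_of_nonneg (hs0 x)]; exact hs1 x
  · exact abs_dotProduct_le_sqrt hψ1 u x
  · exact abs_dotProduct_le_sqrt hψ1 w x

/-- A basis that is orthonormal for the quadratic form `u ↦ ∫ s (u · ψ)²`. -/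
theorem exists_orthonormal_directions (hψ : Measurable ψ) (hs : Measurable s)
    (hψ1 : ∀ x, ψ x ⬝ᵥ ψ x ≤ 1) (hs0 : ∀ x, 0 ≤ s x) (hs1 : ∀ x, s x ≤ 1)
    {κ : ℝ} (hκ : 0 < κ) (hcov : ∀ u : Fin d → ℝ, κ * (u ⬝ᵥ u) ≤ ∫ x, s x * (u ⬝ᵥ ψ x) ^ 2 ∂ν) :
    ∃ g : Fin d → Fin d → ℝ,
      (∀ i j, ∫ x, s x * (g i ⬝ᵥ ψ x) * (g j ⬝ᵥ ψ x) ∂ν = if i = j then 1 else 0) ∧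
      ∀ u : Fin d → ℝ, ∃ a : Fin d → ℝ, u = ∑ i, a i • g i := by
  set Γ : Matrix (Fin d) (Fin d) ℝ :=
    Matrix.of fun i j => ∫ x, s x * ψ x i * ψ x j ∂ν with hΓdef
  have hinteg : ∀ i j, Integrable (fun x => s x * ψ x i * ψ x j) ν := fun i j => by
    simpa using integrable_weighted_mul ν hψ hs hψ1 hs0 hs1 (Pi.single i 1) (Pi.single j 1)
  have hform : ∀ u w : Fin d → ℝ,
      u ⬝ᵥ (Γ *ᵥ w) = ∫ x, s x * (u ⬝ᵥ ψ x) * (w ⬝ᵥ ψ x) ∂ν := fun u w => by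
    have : ∀ x, s x * (u ⬝ᵥ ψ x) * (w ⬝ᵥ ψ x)
        = ∑ i, ∑ j, u i * (w j * (s x * ψ x i * ψ x j)) := fun x => by
      simp only [dotProduct, Finset.mul_sum, Finset.sum_mul]
      rw [Finset.sum_comm]
      refine Finset.sum_congr rfl fun i _ => Finset.sum_congr rfl fun j _ => by ring
    simp_rw [this]
    rw [integral_finsetSum _ fun i _ => integrable_finsetSum _ fun j _ =>
      ((hinteg i j).const_mul _).const_mul _]
    simp only [dotProduct, mulVec, Finset.mul_sum]
    refine Finset.sum_congr rfl fun i _ => ?_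
    rw [integral_finsetSum _ fun j _ => ((hinteg i j).const_mul _).const_mul _]
    refine Finset.sum_congr rfl fun j _ => ?_
    rw [integral_const_mul, integral_const_mul]
    simp only [hΓdef, of_apply]; ring
  have hpos : Γ.PosDef := by
    refine PosDef.of_dotProduct_mulVec_pos ?_ fun u hu => ?_
    · ext i j
      simp only [hΓdef, conjTranspose_apply, of_apply, star_trivial]
      refine integral_congr_ae (Filter.Eventually.of_forall fun x => ?_)
      simp only; ring
    · rw [star_trivial, hform]
      have h1 : 0 < u ⬝ᵥ u := lt_of_le_of_ne (dotProduct_self_nonneg' u)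
        fun h => hu (dotProduct_self_eq_zero.1 h.symm)
      refine (mul_pos hκ h1).trans_le ((hcov u).trans_eq ?_)
      refine integral_congr_ae (Filter.Eventually.of_forall fun x => ?_)
      simp only; ring
  obtain ⟨B, hBu, hB⟩ := exists_whitening hpos
  refine ⟨fun i => B i, fun i j => ?_, fun u => ?_⟩
  · rw [← hform]
    have := congrFun (congrFun hB i) j
    rw [Matrix.one_apply] at this
    rw [← this, Matrix.mul_assoc]
    simp [Matrix.mul_apply, dotProduct, mulVec]
  -- The directions are the rows of the invertible matrix B, so the coordinates of u are the entries
  -- of u B⁻¹.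
  · refine ⟨u ᵥ* B⁻¹, ?_⟩
    have hdet := (Matrix.isUnit_iff_isUnit_det _).1 hBu
    have : u = (u ᵥ* B⁻¹) ᵥ* B := by
      rw [vecMul_vecMul, nonsing_inv_mul _ hdet, vecMul_one]
    conv_lhs => rw [this]
    rw [vecMul_eq_sum]

end Whitening

end Concentration
end OfflineRL

namespace OfflineRL

/-! ### Bounds for linear regression that hold in all directions at once. -/

section Regression

variable {ι : Type*} [Fintype ι] {𝒯 : Type*} [MeasurableSpace 𝒯]

/-- Deterministic part of the regression estimate: if the empirical covariance and the noise are
controlled along an orthonormal basis of the population form, then they are controlled in all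
directions. -/
theorem quadratic_bounds_of_directions {ι 𝒯 : Type*} {d : ℕ} (hd : 0 < d) (J : Finset ι)
    {ψ : 𝒯 → Fin d → ℝ} {s ε : 𝒯 → ℝ} {q V : ℝ} (ω : ι → 𝒯) (g : Fin d → Fin d → ℝ)
    (a : Fin d → ℝ)
    (h1 : ∀ i j, |∑ τ ∈ J, (s (ω τ) * (g i ⬝ᵥ ψ (ω τ)) * (g j ⬝ᵥ ψ (ω τ)) - if i = j then 1 else 0)|
      ≤ J.card / (2 * d))
    (h2 : ∀ i, |∑ τ ∈ J, s (ω τ) * (g i ⬝ᵥ ψ (ω τ)) * ε (ω τ)| ≤ 2 * √(J.card * V))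
    (hV : 0 ≤ V) (hq : q ≤ a ⬝ᵥ a) :
    J.card * q / 2 ≤ ∑ τ ∈ J, s (ω τ) * ((∑ i, a i • g i) ⬝ᵥ ψ (ω τ)) ^ 2 ∧
    (∑ τ ∈ J, s (ω τ) * ((∑ i, a i • g i) ⬝ᵥ ψ (ω τ)) * ε (ω τ)) ^ 2
      ≤ 8 * d * V * ∑ τ ∈ J, s (ω τ) * ((∑ i, a i • g i) ⬝ᵥ ψ (ω τ)) ^ 2 := by
  have hd' : (0 : ℝ) < d := by exact_mod_cast hd
  have hn : (0 : ℝ) ≤ J.card := by positivity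
  have hlin : ∀ x, (∑ i, a i • g i) ⬝ᵥ ψ x = ∑ i, a i * (g i ⬝ᵥ ψ x) := fun x => by
    rw [sum_dotProduct]; simp
  have ha : a ⬝ᵥ a = ∑ i, a i ^ 2 := by simp [dotProduct, sq]
  have ha0 : 0 ≤ a ⬝ᵥ a := dotProduct_self_nonneg' a
  have hquad : ∑ τ ∈ J, s (ω τ) * ((∑ i, a i • g i) ⬝ᵥ ψ (ω τ)) ^ 2
      = J.card * (a ⬝ᵥ a) + ∑ i, ∑ j, a i * a j *
        ∑ τ ∈ J, (s (ω τ) * (g i ⬝ᵥ ψ (ω τ)) * (g j ⬝ᵥ ψ (ω τ)) - if i = j then 1 else 0) := by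
    have e1 : ∀ τ, s (ω τ) * ((∑ i, a i • g i) ⬝ᵥ ψ (ω τ)) ^ 2
        = ∑ i, ∑ j, a i * a j * (s (ω τ) * (g i ⬝ᵥ ψ (ω τ)) * (g j ⬝ᵥ ψ (ω τ))) := fun τ => by
      rw [hlin, sq, Finset.sum_mul_sum, Finset.mul_sum]
      refine Finset.sum_congr rfl fun i _ => ?_
      rw [Finset.mul_sum]
      exact Finset.sum_congr rfl fun j _ => by ring
    have e2 : (J.card : ℝ) * (a ⬝ᵥ a)
        = ∑ i, ∑ j, a i * a j * ∑ _τ ∈ J, (if i = j then 1 else 0 : ℝ) := by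
      simp [ha, Finset.mul_sum, sq, mul_comm]
    rw [e2, ← Finset.sum_add_distrib]
    simp_rw [e1]
    rw [Finset.sum_comm]
    refine Finset.sum_congr rfl fun i _ => ?_
    rw [Finset.sum_comm, ← Finset.sum_add_distrib]
    refine Finset.sum_congr rfl fun j _ => ?_
    rw [← mul_add, ← Finset.sum_add_distrib, Finset.mul_sum]
    simp
  have habs : (∑ i, |a i|) ^ 2 ≤ d * (a ⬝ᵥ a) := by
    have := sq_sum_le_card_mul_sum_sq (s := (Finset.univ : Finset (Fin d))) (f := fun i => |a i|)
    simpa [ha] using this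
  -- An entrywise error of n / (2 d) costs at most n / (2 d) (∑ |a i|)² ≤ n |a|² / 2, half of the
  -- population form.
  have herr : |∑ i, ∑ j, a i * a j *
        ∑ τ ∈ J, (s (ω τ) * (g i ⬝ᵥ ψ (ω τ)) * (g j ⬝ᵥ ψ (ω τ)) - if i = j then 1 else 0)|
      ≤ J.card * (a ⬝ᵥ a) / 2 := by
    calc _ ≤ ∑ i, ∑ j, |a i| * |a j| * (J.card / (2 * d)) := by
          refine (Finset.abs_sum_le_sum_abs _ _).trans (Finset.sum_le_sum fun i _ => ?_)
          refine (Finset.abs_sum_le_sum_abs _ _).trans (Finset.sum_le_sum fun j _ => ?_)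
          rw [abs_mul, abs_mul]
          exact mul_le_mul_of_nonneg_left (h1 i j) (by positivity)
      _ = (∑ i, |a i|) ^ 2 * (J.card / (2 * d)) := by
          rw [sq, Finset.sum_mul_sum, Finset.sum_mul]
          exact Finset.sum_congr rfl fun i _ => by rw [Finset.sum_mul]
      _ ≤ d * (a ⬝ᵥ a) * (J.card / (2 * d)) := by gcongr
      _ = J.card * (a ⬝ᵥ a) / 2 := by field_simp
  have hlow : J.card * (a ⬝ᵥ a) / 2 ≤ ∑ τ ∈ J, s (ω τ) * ((∑ i, a i • g i) ⬝ᵥ ψ (ω τ)) ^ 2 := by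
    rw [hquad]
    linarith [(abs_le.1 herr).1]
  refine ⟨le_trans (by gcongr) hlow, ?_⟩
  have hnoise : ∑ τ ∈ J, s (ω τ) * ((∑ i, a i • g i) ⬝ᵥ ψ (ω τ)) * ε (ω τ)
      = ∑ i, a i * ∑ τ ∈ J, s (ω τ) * (g i ⬝ᵥ ψ (ω τ)) * ε (ω τ) := by
    simp_rw [hlin, Finset.mul_sum, Finset.sum_mul]
    rw [Finset.sum_comm]
    exact Finset.sum_congr rfl fun i _ => Finset.sum_congr rfl fun τ _ => by ring
  -- Cauchy–Schwarz over the d coordinates gives |a|² · 4 d n V, and n |a|² / 2 is in turn at most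
  -- the empirical form.
  rw [hnoise]
  calc _ ≤ (∑ i, a i ^ 2) * ∑ i, (∑ τ ∈ J, s (ω τ) * (g i ⬝ᵥ ψ (ω τ)) * ε (ω τ)) ^ 2 :=
        Finset.sum_mul_sq_le_sq_mul_sq _ _ _
    _ ≤ (a ⬝ᵥ a) * ∑ _i : Fin d, (2 * √(J.card * V)) ^ 2 := by
        rw [ha]
        refine mul_le_mul_of_nonneg_left (Finset.sum_le_sum fun i _ => ?_) (by rw [← ha]; exact ha0)
        exact sq_le_sq' (by linarith [(abs_le.1 (h2 i)).1]) (abs_le.1 (h2 i)).2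
    _ = 8 * d * V * (J.card * (a ⬝ᵥ a) / 2) := by
        rw [mul_pow, Real.sq_sqrt (by positivity)]
        simp; ring
    _ ≤ _ := by gcongr

/-- Bernstein's inequality is applied to finitely many scalar sums, the covariance entries and the
noise coordinates along an orthonormal basis of directions. Linearity does the rest, so the bound is
uniform in u without a net on the sphere. -/
theorem pi_real_regression_failure_le (ν : Measure 𝒯) [IsProbabilityMeasure ν] {d : ℕ}
    (hd : 0 < d) (J : Finset ι) {ψ : 𝒯 → Fin d → ℝ} {s ε : 𝒯 → ℝ} {κ B v L : ℝ}
    (hψ : Measurable ψ) (hs : Measurable s) (hε : Measurable ε)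
    (hψ1 : ∀ x, ψ x ⬝ᵥ ψ x ≤ 1) (hs0 : ∀ x, 0 ≤ s x) (hs1 : ∀ x, s x ≤ 1)
    (hεB : ∀ x, |ε x| ≤ B) (hκ : 0 < κ) (hκ1 : κ ≤ 1)
    (hcov : ∀ u : Fin d → ℝ, κ * (u ⬝ᵥ u) ≤ ∫ x, s x * (u ⬝ᵥ ψ x) ^ 2 ∂ν)
    (hmean : ∀ u : Fin d → ℝ, ∫ x, s x * (u ⬝ᵥ ψ x) * ε x ∂ν = 0)
    (hvar : ∀ u : Fin d → ℝ, ∫ x, (s x * (u ⬝ᵥ ψ x) * ε x) ^ 2 ∂ν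
      ≤ v * ∫ x, s x * (u ⬝ᵥ ψ x) ^ 2 ∂ν)
    (hv : 0 < v) (hL : 0 < L) (hLB : L * B ^ 2 ≤ J.card * v * κ)
    (hLd : 64 * d ^ 2 * L ≤ J.card * κ ^ 2) :
    (Measure.pi fun _ : ι => ν).real {ω | ¬ ∀ u : Fin d → ℝ,
      J.card * (κ * (u ⬝ᵥ u)) / 2 ≤ ∑ τ ∈ J, s (ω τ) * (u ⬝ᵥ ψ (ω τ)) ^ 2 ∧
      (∑ τ ∈ J, s (ω τ) * (u ⬝ᵥ ψ (ω τ)) * ε (ω τ)) ^ 2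
        ≤ 8 * d * (v * L) * ∑ τ ∈ J, s (ω τ) * (u ⬝ᵥ ψ (ω τ)) ^ 2}
      ≤ 4 * d ^ 2 * Real.exp (-L) := by
  obtain ⟨g, hg, hspan⟩ := exists_orthonormal_directions ν hψ hs hψ1 hs0 hs1 hκ hcov
  have hd' : (0 : ℝ) < d := by exact_mod_cast hd
  have hJ : 0 < J.card := by
    rw [Nat.pos_iff_ne_zero]
    intro h
    rw [h] at hLd
    have : 0 < 64 * (d : ℝ) ^ 2 * L := by positivity
    simp at hLd; linarith
  have hn : (0 : ℝ) < J.card := by exact_mod_cast hJ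
  have hgm : ∀ i, Measurable fun x => g i ⬝ᵥ ψ x := fun i => measurable_dotProduct_left hψ _
  have hgsq : ∀ i, ∫ x, s x * (g i ⬝ᵥ ψ x) ^ 2 ∂ν = 1 := fun i => by
    have := hg i i
    rw [if_pos rfl] at this
    rw [← this]
    exact integral_congr_ae (Filter.Eventually.of_forall fun x => by simp only; ring)
  -- A direction of unit second moment satisfies κ |g|² ≤ 1 by coverage.
  have hgb : ∀ i x, |g i ⬝ᵥ ψ x| ≤ √(1 / κ) := fun i x => by
    refine (abs_dotProduct_le_sqrt hψ1 (g i) x).trans (Real.sqrt_le_sqrt ?_)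
    rw [le_div_iff₀ hκ, mul_comm]
    exact (hcov (g i)).trans (hgsq i).le
  have hB0 : 0 ≤ B := by
    obtain ⟨x⟩ : Nonempty 𝒯 := by
      by_contra h
      rw [not_nonempty_iff] at h
      have := measure_univ (μ := ν)
      simp [Set.univ_eq_empty_iff.2 h] at this
    exact (abs_nonneg _).trans (hεB x)
  have hsabs : ∀ x, |s x| ≤ 1 := fun x => by rw [abs_of_nonneg (hs0 x)]; exact hs1 x
  set f1 : Fin d → Fin d → 𝒯 → ℝ := fun i j x =>
    s x * (g i ⬝ᵥ ψ x) * (g j ⬝ᵥ ψ x) - if i = j then 1 else 0 with hf1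
  set f2 : Fin d → 𝒯 → ℝ := fun i x => s x * (g i ⬝ᵥ ψ x) * ε x with hf2
  have hf1m : ∀ i j, Measurable (f1 i j) := fun i j =>
    ((hs.mul (hgm i)).mul (hgm j)).sub measurable_const
  have hf2m : ∀ i, Measurable (f2 i) := fun i => (hs.mul (hgm i)).mul hε
  have hf1b : ∀ i j x, |f1 i j x| ≤ 2 / κ := fun i j x => by
    have hprod : |s x * (g i ⬝ᵥ ψ x) * (g j ⬝ᵥ ψ x)| ≤ 1 / κ := by
      rw [abs_mul, abs_mul]
      calc _ ≤ 1 * √(1 / κ) * √(1 / κ) := by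
            gcongr
            · exact hsabs x
            · exact hgb i x
            · exact hgb j x
        _ = 1 / κ := by rw [one_mul, Real.mul_self_sqrt (by positivity)]
    have hone : |(if i = j then 1 else 0 : ℝ)| ≤ 1 / κ := by
      have : 1 ≤ 1 / κ := (one_le_div hκ).2 hκ1
      split_ifs
      · simpa using this
      · simp; exact hκ.le
    calc _ ≤ 1 / κ + 1 / κ := (abs_sub _ _).trans (add_le_add hprod hone)
      _ = 2 / κ := by ring
  have hf1p : ∀ i j, (Measure.pi fun _ : ι => ν).real
      {ω | 2 * √(J.card * (2 / κ) ^ 2 * L) < |∑ τ ∈ J, f1 i j (ω τ)|} ≤ 2 * Real.exp (-L) := by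
    intro i j
    refine pi_real_abs_sum_gt_le ν J (hf1m i j) (hf1b i j) ?_ ?_ (by positivity) hL hJ ?_
    · simp only [hf1]
      rw [integral_sub (integrable_weighted_mul ν hψ hs hψ1 hs0 hs1 _ _) (integrable_const _), hg]
      simp
    · have : ∀ x, f1 i j x ^ 2 ≤ (2 / κ) ^ 2 := fun x => by
        rw [← sq_abs (f1 i j x)]; gcongr; exact hf1b i j x
      calc _ ≤ ∫ _x, (2 / κ) ^ 2 ∂ν := by
            refine integral_mono ?_ (integrable_const _) this
            refine integrable_of_measurable_of_abs_le (b := (2 / κ) ^ 2) ((hf1m i j).pow_const 2)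
              fun x => ?_
            rw [abs_of_nonneg (sq_nonneg _)]; exact this x
        _ = (2 / κ) ^ 2 := by simp
    · rw [mul_comm]
      rw [mul_comm (J.card : ℝ)]
      gcongr
      have h1 : (1 : ℝ) ≤ d := by exact_mod_cast hd
      have h2 : L ≤ 64 * d ^ 2 * L := le_mul_of_one_le_left hL.le (by nlinarith)
      exact h2.trans (hLd.trans (mul_le_of_le_one_right hn.le (pow_le_one₀ hκ.le hκ1)))
  have hf2p : ∀ i, (Measure.pi fun _ : ι => ν).real
      {ω | 2 * √(J.card * v * L) < |∑ τ ∈ J, f2 i (ω τ)|} ≤ 2 * Real.exp (-L) := by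
    intro i
    refine pi_real_abs_sum_gt_le ν J (hf2m i) (b := √(1 / κ) * B) (fun x => ?_) (hmean _) ?_ hv hL
      hJ ?_
    · simp only [hf2]
      rw [abs_mul, abs_mul]
      calc _ ≤ 1 * √(1 / κ) * B := by
            gcongr
            · exact hsabs x
            · exact hgb i x
            · exact hεB x
        _ = _ := by ring
    · refine (hvar (g i)).trans ?_
      rw [hgsq, mul_one]
    · rw [mul_pow, Real.sq_sqrt (by positivity)]
      calc L * (1 / κ * B ^ 2) = L * B ^ 2 / κ := by ring
        _ ≤ J.card * v := by rw [div_le_iff₀ hκ]; exact hLB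
  refine le_trans (measureReal_mono (s₂ :=
    (⋃ p : Fin d × Fin d, {ω | 2 * √(J.card * (2 / κ) ^ 2 * L) < |∑ τ ∈ J, f1 p.1 p.2 (ω τ)|}) ∪
    ⋃ i : Fin d, {ω | 2 * √(J.card * v * L) < |∑ τ ∈ J, f2 i (ω τ)|}) ?_) ?_
  · intro ω hω
    by_contra hcon
    simp only [Set.mem_union, Set.mem_iUnion, Set.mem_ofPred_eq, not_or, not_exists, not_lt,
      Prod.forall] at hcon
    refine hω fun u => ?_
    obtain ⟨a, rfl⟩ := hspan u
    have hq : κ * ((∑ i, a i • g i) ⬝ᵥ (∑ i, a i • g i)) ≤ a ⬝ᵥ a := by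
      refine (hcov _).trans_eq ?_
      have e : ∀ x, s x * ((∑ i, a i • g i) ⬝ᵥ ψ x) ^ 2
          = ∑ i, ∑ j, a i * a j * (s x * (g i ⬝ᵥ ψ x) * (g j ⬝ᵥ ψ x)) := fun x => by
        rw [sum_dotProduct, sq, Finset.sum_mul_sum, Finset.mul_sum]
        refine Finset.sum_congr rfl fun i _ => ?_
        rw [Finset.mul_sum]
        exact Finset.sum_congr rfl fun j _ => by simp only [smul_dotProduct, smul_eq_mul]; ring
      have hi : ∀ i j, Integrable
          (fun x => a i * a j * (s x * (g i ⬝ᵥ ψ x) * (g j ⬝ᵥ ψ x))) ν := fun i j =>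
        (integrable_weighted_mul ν hψ hs hψ1 hs0 hs1 _ _).const_mul _
      simp_rw [e]
      rw [integral_finsetSum _ fun i _ => integrable_finsetSum _ fun j _ => hi i j]
      simp_rw [integral_finsetSum _ fun j _ => hi _ j, integral_const_mul, hg]
      simp [dotProduct]
    refine quadratic_bounds_of_directions hd J (s := s) (ε := ε) ω g a (fun i j => ?_) (fun i => ?_)
      (by positivity) hq
    · refine (hcon.1 i j).trans ?_
      rw [show (J.card : ℝ) * (2 / κ) ^ 2 * L = (2 / κ) ^ 2 * (J.card * L) by ring,
        Real.sqrt_mul (by positivity), Real.sqrt_sq (by positivity)]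
      -- The condition 64 d² L ≤ n κ² is exactly what brings the entrywise deviation down to n / (2
      -- d).
      have : √((J.card : ℝ) * L) ≤ J.card * κ / (8 * d) := by
        refine Real.sqrt_le_iff.2 ⟨by positivity, ?_⟩
        rw [div_pow, le_div_iff₀ (by positivity)]
        nlinarith [mul_le_mul_of_nonneg_left hLd hn.le]
      calc 2 * (2 / κ * √((J.card : ℝ) * L)) ≤ 2 * (2 / κ * (J.card * κ / (8 * d))) := by gcongr
        _ = J.card / (2 * d) := by field_simp; ring
    · rw [← mul_assoc]; exact hcon.2 i
  · refine (measureReal_union_le _ _).trans ?_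
    have hA := (measureReal_iUnion_fintype_le (μ := Measure.pi fun _ : ι => ν) fun p : Fin d × Fin d =>
      {ω : ι → 𝒯 | 2 * √(J.card * (2 / κ) ^ 2 * L) < |∑ τ ∈ J, f1 p.1 p.2 (ω τ)|}).trans
      (Finset.sum_le_sum fun p _ => hf1p p.1 p.2)
    have hB := (measureReal_iUnion_fintype_le (μ := Measure.pi fun _ : ι => ν) fun i : Fin d =>
      {ω : ι → 𝒯 | 2 * √(J.card * v * L) < |∑ τ ∈ J, f2 i (ω τ)|}).trans
      (Finset.sum_le_sum fun i _ => hf2p i)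
    -- There are d² covariance events and d noise events, each of probability at most 2 exp (-L),
    -- and 2 d² + 2 d ≤ 4 d².
    refine (add_le_add hA hB).trans ?_
    simp only [Finset.sum_const, Finset.card_univ, Fintype.card_prod, Fintype.card_fin,
      nsmul_eq_mul, Nat.cast_mul]
    have h1 : (1 : ℝ) ≤ d := by exact_mod_cast hd
    have he := Real.exp_pos (-L)
    nlinarith [mul_le_mul_of_nonneg_right (mul_le_mul_of_nonneg_left h1 hd'.le) he.le]

end Regression

/-! ### Resampling a block of independent coordinates. -/

section Resampling

variable {ι : Type*} [Fintype ι] [DecidableEq ι] {𝒯 : Type*} [MeasurableSpace 𝒯]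

theorem measurable_piecewise_finset {ι : Type*} [DecidableEq ι] (J : Finset ι) :
    Measurable fun p : (ι → 𝒯) × (ι → 𝒯) => J.piecewise p.2 p.1 := by
  refine measurable_pi_lambda _ fun i => ?_
  by_cases hi : i ∈ J
  · simp only [Finset.piecewise, hi, if_true]; fun_prop
  · simp only [Finset.piecewise, hi, if_false]; fun_prop

/-- Resampling some of the coordinates does not change the law. -/
theorem map_piecewise_pi (ν : Measure 𝒯) [IsProbabilityMeasure ν] (J : Finset ι) :
    ((Measure.pi fun _ : ι => ν).prod (Measure.pi fun _ : ι => ν)).map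
      (fun p : (ι → 𝒯) × (ι → 𝒯) => J.piecewise p.2 p.1) = Measure.pi fun _ : ι => ν := by
  symm
  refine Measure.pi_eq fun t ht => ?_
  rw [Measure.map_apply (measurable_piecewise_finset J) (MeasurableSet.univ_pi ht)]
  have : (fun p : (ι → 𝒯) × (ι → 𝒯) => J.piecewise p.2 p.1) ⁻¹' Set.univ.pi t
      = (Set.univ.pi fun i => if i ∈ J then Set.univ else t i) ×ˢ
        (Set.univ.pi fun i => if i ∈ J then t i else Set.univ) := by
    ext p
    simp only [Set.mem_preimage, Set.mem_pi, Set.mem_univ, true_implies, Set.mem_prod]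
    rw [← forall_and]
    refine forall_congr' fun i => ?_
    by_cases hi : i ∈ J <;> simp [Finset.piecewise, hi]
  rw [this, Measure.prod_prod, Measure.pi_pi, Measure.pi_pi, ← Finset.prod_mul_distrib]
  refine Finset.prod_congr rfl fun i _ => ?_
  by_cases hi : i ∈ J <;> simp [hi]

/-- A failure event that involves fresh coordinates `J` and functions of the other coordinates:
it suffices to bound its probability with the latter fixed. -/
theorem pi_failure_le_of_resampling (ν : Measure 𝒯) [IsProbabilityMeasure ν] (J : Finset ι)
    {c : ENNReal} (bad : Set ((ι → 𝒯) × (ι → 𝒯))) (hbad : MeasurableSet bad) (C : Set (ι → 𝒯))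
    (hfst : ∀ ω ω₁ ω', (J.piecewise ω₁ ω, ω') ∈ bad ↔ (ω, ω') ∈ bad)
    (hsnd : ∀ ω ω₁ ω', (ω, J.piecewise ω' ω₁) ∈ bad ↔ (ω, ω') ∈ bad)
    (hle : ∀ ω ∈ C, (Measure.pi fun _ : ι => ν) {ω' | (ω, ω') ∈ bad} ≤ c) :
    (Measure.pi fun _ : ι => ν) {ω | ω ∈ C ∧ (ω, ω) ∈ bad} ≤ c := by
  set μ := Measure.pi fun _ : ι => ν with hμ
  -- No measurability of C is assumed. It is enlarged to the measurable set of those ω whose section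
  -- of `bad` has measure at most c; like the sections, this set depends only on the coordinates
  -- outside J.
  set C' : Set (ι → 𝒯) := {ω | μ (Prod.mk ω ⁻¹' bad) ≤ c} with hC'
  have hC'm : MeasurableSet C' := (measurable_measure_prodMk_left hbad) measurableSet_Iic
  have h1 : MeasurableSet {p : (ι → 𝒯) × (ι → 𝒯) | p.1 ∈ C' ∧ p ∈ bad} :=
    (measurable_fst hC'm).inter hbad
  have h2 : MeasurableSet {ω : ι → 𝒯 | ω ∈ C' ∧ (ω, ω) ∈ bad} :=
    hC'm.inter ((measurable_id.prodMk measurable_id) hbad)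
  have hinv : ∀ ω ω', J.piecewise ω' ω ∈ C' ↔ ω ∈ C' := fun ω ω' => by
    have : Prod.mk (J.piecewise ω' ω) ⁻¹' bad = Prod.mk ω ⁻¹' bad := by
      ext ω₂; exact hfst ω ω' ω₂
    simp only [hC', Set.mem_ofPred_eq, this]
  calc μ {ω | ω ∈ C ∧ (ω, ω) ∈ bad}
      ≤ μ {ω | ω ∈ C' ∧ (ω, ω) ∈ bad} := measure_mono fun ω hω => ⟨hle ω hω.1, hω.2⟩
    -- The coordinates in J are replaced by those of an independent copy. By `hfst` and `hsnd`, the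
    -- two arguments of `bad` then decouple.
    _ = (μ.prod μ) {p | p.1 ∈ C' ∧ p ∈ bad} := by
        conv_lhs => rw [hμ, ← map_piecewise_pi ν J, Measure.map_apply
          (measurable_piecewise_finset J) h2]
        congr 1
        ext p
        simp only [Set.mem_preimage, Set.mem_ofPred_eq, hinv, hfst, hsnd]
    _ ≤ c := by
        rw [Measure.prod_apply h1]
        calc _ ≤ ∫⁻ _ω, c ∂μ := by
              refine lintegral_mono fun ω => ?_
              by_cases hω : ω ∈ C'
              · exact (measure_mono fun ω' h => h.2).trans hω
              · have : Prod.mk ω ⁻¹' {p : (ι → 𝒯) × (ι → 𝒯) | p.1 ∈ C' ∧ p ∈ bad} = ∅ := by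
                  ext ω'; simp [hω]
                simp [this]
          _ = c := by simp

end Resampling
end OfflineRL

namespace OfflineRL

/-! ### Expectations along trajectories -/

section Rollout

variable {S : Type u} {A : Type v} [MeasurableSpace S] [MeasurableSpace A]
  (M : MDP S A) (π : Policy S A)

theorem abs_integral_le_of_abs_le {α : Type*} [MeasurableSpace α] {μ : Measure α}
    [IsProbabilityMeasure μ] {f : α → ℝ} {b : ℝ} (hb : ∀ x, |f x| ≤ b) : |∫ x, f x ∂μ| ≤ b := by
  have := norm_integral_le_of_norm_le_const (μ := μ) (f := f) (C := b)
    (Filter.Eventually.of_forall hb)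
  simpa using this

theorem measurable_integral_kernel {α β : Type*} [MeasurableSpace α] [MeasurableSpace β]
    (κ : Kernel α β) [IsSFiniteKernel κ] {f : α → β → ℝ} (hf : Measurable (Function.uncurry f)) :
    Measurable fun x => ∫ y, f x y ∂(κ x) :=
  hf.stronglyMeasurable.integral_kernel_prod_right.measurable

/-- A rollout prepends (x, a) to a rollout from the next state. All later facts on trajectories
follow from this identity by induction on the length. -/
theorem integral_rollout_succ {n : ℕ} (h : ℕ) (x : S) {F : (Fin (n + 1) → S × A) → ℝ}
    (hF : Measurable F) {c : ℝ} (hc : ∀ t, |F t| ≤ c) :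
    ∫ t, F t ∂(rollout M π (n + 1) h x) =
      ∫ a, ∫ y, ∫ t, F (Fin.cons (x, a) t) ∂(rollout M π n (h + 1) y) ∂(M.P h (x, a))
        ∂(π.ker h x) := by
  have hcons := measurable_consStep (S := S) (A := A) n
  have hFc : Measurable fun q : S × ((A × S) × (Fin n → S × A)) =>
      F (Fin.cons (q.1, q.2.1.1) q.2.2) := hF.comp hcons
  rw [rollout, Kernel.map_apply _ hcons, integral_map hcons.aemeasurable
    hF.aestronglyMeasurable, Kernel.prod_apply, Kernel.id_apply, Measure.dirac_prod,
    integral_map (by fun_prop) hFc.aestronglyMeasurable, integral_compProd, integral_compProd]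
  · rfl
  · refine Integrable.integral_compProd (κ := π.ker h ⊗ₖ M.P h) (a := x)
      (η := (rollout M π n (h + 1)).comap (fun p : S × (A × S) => p.2.2) (by fun_prop))
      (f := fun q : (A × S) × (Fin n → S × A) => F (Fin.cons (x, q.1.1) q.2)) ?_
    exact integrable_of_measurable_of_abs_le (hFc.comp (measurable_prodMk_left (x := x)))
      fun z => hc _
  · refine integrable_of_measurable_of_abs_le ?_ (b := c) fun z => hc _
    exact hFc.comp (by fun_prop)

/-- A rollout from step h never consults the policy before step h, so a deviation at one step leaves
all later values unchanged. -/
theorem rollout_congr {π π' : Policy S A} (n h : ℕ) (hπ : ∀ k, h ≤ k → π.ker k = π'.ker k) :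
    rollout M π n h = rollout M π' n h := by
  induction n generalizing h with
  | zero => simp only [rollout]
  | succ n ih =>
    simp only [rollout]
    rw [hπ h le_rfl, ih (h + 1) fun k hk => hπ k (by omega)]

/-- Expected sum of `g` over `n` steps from step `h` on. -/
noncomputable def cumulative (g : ℕ → S × A → ℝ) (n h : ℕ) (x : S) : ℝ :=
  ∫ t, ∑ i : Fin n, g (h + i) (t i) ∂(rollout M π n h x)

variable {g : ℕ → S × A → ℝ} {c : ℝ}

theorem measurable_sum_steps (hg : ∀ k, Measurable (g k)) (n h : ℕ) :
    Measurable fun t : Fin n → S × A => ∑ i : Fin n, g (h + i) (t i) :=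
  Finset.measurable_sum _ fun i _ => (hg _).comp (measurable_pi_apply i)

theorem abs_sum_steps_le {S A : Type*} {g : ℕ → S × A → ℝ} (hc : ∀ k z, |g k z| ≤ c) (n h : ℕ)
    (t : Fin n → S × A) : |∑ i : Fin n, g (h + i) (t i)| ≤ n * c := by
  calc _ ≤ ∑ _i : Fin n, c :=
        (Finset.abs_sum_le_sum_abs _ _).trans (Finset.sum_le_sum fun i _ => hc _ _)
    _ = n * c := by simp

theorem measurable_cumulative (hg : ∀ k, Measurable (g k)) (n h : ℕ) :
    Measurable (cumulative M π g n h) := by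
  unfold cumulative
  exact measurable_integral_kernel _ ((measurable_sum_steps hg n h).comp measurable_snd)

theorem abs_cumulative_le (hc : ∀ k z, |g k z| ≤ c) (n h : ℕ) (x : S) :
    |cumulative M π g n h x| ≤ n * c :=
  abs_integral_le_of_abs_le (abs_sum_steps_le hc n h)

theorem cumulative_zero (h : ℕ) (x : S) : cumulative M π g 0 h x = 0 := by
  simp [cumulative]

theorem cumulative_succ (hg : ∀ k, Measurable (g k)) (hc : ∀ k z, |g k z| ≤ c) (n h : ℕ) (x : S) :
    cumulative M π g (n + 1) h x =
      ∫ a, (g h (x, a) + ∫ y, cumulative M π g n (h + 1) y ∂(M.P h (x, a))) ∂(π.ker h x) := by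
  unfold cumulative
  rw [integral_rollout_succ M π h x (measurable_sum_steps hg _ _) (abs_sum_steps_le hc _ _)]
  refine integral_congr_ae (Filter.Eventually.of_forall fun a => ?_)
  have hinteg : ∀ y, Integrable (fun t : Fin n → S × A => ∑ i : Fin n, g (h + 1 + i) (t i))
      (rollout M π n (h + 1) y) := fun y =>
    integrable_of_measurable_of_abs_le (measurable_sum_steps hg _ _) (abs_sum_steps_le hc _ _)
  have e : ∀ t : Fin n → S × A,
      ∑ i : Fin (n + 1), g (h + i) ((Fin.cons (x, a) t : Fin (n + 1) → S × A) i)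
        = g h (x, a) + ∑ i : Fin n, g (h + 1 + i) (t i) := fun t => by
    rw [Fin.sum_univ_succ]
    simp [add_assoc, add_comm 1]
  simp_rw [e]
  have e2 : ∀ y, ∫ t : Fin n → S × A, (g h (x, a) + ∑ i : Fin n, g (h + 1 + i) (t i))
      ∂(rollout M π n (h + 1) y) = g h (x, a) + cumulative M π g n (h + 1) y := fun y => by
    rw [integral_add (integrable_const _) (hinteg y)]; simp [cumulative]
  simp_rw [e2]
  rw [integral_add (integrable_const _) (integrable_of_measurable_of_abs_le
    (measurable_cumulative M π hg n (h + 1)) (abs_cumulative_le M π hc n (h + 1)))]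
  simp [cumulative]

/-- Functions that satisfy a one-step inequality are bounded by the accumulated one-step terms. -/
theorem le_cumulative_of_step_le {H : ℕ} (hg : ∀ k, Measurable (g k)) (hc : ∀ k z, |g k z| ≤ c)
    {D : ℕ → S → ℝ} {e : ℝ} (hD : ∀ k, Measurable (D k)) (hDe : ∀ k x, |D k x| ≤ e)
    (hDH : ∀ x, D H x ≤ 0)
    (hstep : ∀ k < H, ∀ x, D k x ≤
      ∫ a, (g k (x, a) + ∫ y, D (k + 1) y ∂(M.P k (x, a))) ∂(π.ker k x)) :
    ∀ n h, h + n = H → ∀ x, D h x ≤ cumulative M π g n h x := by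
  intro n
  induction n with
  | zero =>
    intro h hh x
    rw [cumulative_zero]
    have : h = H := by omega
    exact this ▸ hDH x
  | succ n ih =>
    intro h hh x
    have hmeas : ∀ {f : S → ℝ}, Measurable f →
        Measurable fun a => g h (x, a) + ∫ y, f y ∂(M.P h (x, a)) := fun {f} hf =>
      ((hg h).comp (by fun_prop)).add
        ((measurable_integral_kernel (M.P h) (f := fun _ y => f y) (hf.comp measurable_snd)).comp
          (measurable_const.prodMk measurable_id))
    have hcum := measurable_cumulative M π hg n (h + 1)
    have hcumb := abs_cumulative_le M π (g := g) hc n (h + 1)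
    refine (hstep h (by omega) x).trans ?_
    rw [cumulative_succ M π hg hc]
    refine integral_mono ?_ ?_ fun a => ?_
    · exact integrable_of_measurable_of_abs_le (hmeas (hD _)) (b := c + e) fun a =>
        (abs_add_le _ _).trans (add_le_add (hc _ _) (abs_integral_le_of_abs_le (hDe _)))
    · exact integrable_of_measurable_of_abs_le (hmeas hcum) (b := c + n * c) fun a =>
        (abs_add_le _ _).trans (add_le_add (hc _ _) (abs_integral_le_of_abs_le hcumb))
    · refine add_le_add le_rfl (integral_mono ?_ ?_ fun y => ih (h + 1) (by omega) y)
      · exact integrable_of_measurable_of_abs_le (hD _) (hDe _)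
      · exact integrable_of_measurable_of_abs_le hcum hcumb

/-! ### The Markov property -/

/-- The Markov property at position i: peel off the first step until i becomes 0, then integrate out
everything beyond the next state. -/
theorem integral_rollout_next {F : (S × A) × S → ℝ} (hF : Measurable F) (hc : ∀ p, |F p| ≤ c)
    (i : ℕ) : ∀ (n : ℕ) (hi : i + 1 < n) (k : ℕ) (x : S),
    ∫ t, F (t ⟨i, by omega⟩, (t ⟨i + 1, hi⟩).1) ∂(rollout M π n k x) =
      ∫ t, ∫ y, F (t ⟨i, by omega⟩, y) ∂(M.P (k + i) (t ⟨i, by omega⟩))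
        ∂(rollout M π n k x) := by
  have hin : ∀ k, Measurable fun z => ∫ y, F (z, y) ∂(M.P k z) := fun k =>
    measurable_integral_kernel (M.P k) (f := fun z y => F (z, y)) hF
  have hinb : ∀ k z, |∫ y, F (z, y) ∂(M.P k z)| ≤ c := fun k z =>
    abs_integral_le_of_abs_le fun y => hc _
  induction i with
  | zero =>
    intro n hi k x
    obtain ⟨m, rfl⟩ : ∃ m, n = m + 1 + 1 := ⟨n - 2, by omega⟩
    rw [integral_rollout_succ M π k x (by fun_prop) (c := c) fun t => hc _,
      integral_rollout_succ M π k x (F := fun t => ∫ y, F (t ⟨0, by omega⟩, y)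
        ∂(M.P (k + 0) (t ⟨0, by omega⟩))) ((hin _).comp (measurable_pi_apply _)) (c := c)
        fun t => hinb _ _]
    refine integral_congr_ae (Filter.Eventually.of_forall fun a => ?_)
    have e0 : ∀ t : Fin (m + 1) → S × A,
        (Fin.cons (x, a) t : Fin (m + 1 + 1) → S × A) ⟨0, by omega⟩ = (x, a) := fun t => rfl
    have e1 : ∀ t : Fin (m + 1) → S × A,
        (Fin.cons (x, a) t : Fin (m + 1 + 1) → S × A) ⟨0 + 1, hi⟩ = t 0 := fun t => rfl
    simp only [e0, e1, add_zero]
    simp only [integral_const, probReal_univ, one_smul]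
    refine integral_congr_ae (Filter.Eventually.of_forall fun y => ?_)
    simp only
    rw [integral_rollout_succ M π (k + 1) y (F := fun t => F ((x, a), (t 0).1)) (by fun_prop)
      (c := c) fun t => hc _]
    simp
  | succ i ih =>
    intro n hi k x
    obtain ⟨m, rfl⟩ : ∃ m, n = m + 1 := ⟨n - 1, by omega⟩
    rw [integral_rollout_succ M π k x (by fun_prop) (c := c) fun t => hc _,
      integral_rollout_succ M π k x (F := fun t => ∫ y, F (t ⟨i + 1, by omega⟩, y)
        ∂(M.P (k + (i + 1)) (t ⟨i + 1, by omega⟩))) ((hin _).comp (measurable_pi_apply _)) (c := c)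
        fun t => hinb _ _]
    refine integral_congr_ae (Filter.Eventually.of_forall fun a => ?_)
    refine integral_congr_ae (Filter.Eventually.of_forall fun y => ?_)
    have := ih m (by omega) (k + 1) y
    rw [show k + 1 + i = k + (i + 1) by omega] at this
    exact this

instance trajLaw_isProbabilityMeasure (H : ℕ) (ρ : Measure S) [IsProbabilityMeasure ρ] :
    IsProbabilityMeasure (trajLaw M H π ρ) := by
  unfold trajLaw; infer_instance

theorem integral_trajLaw {H : ℕ} (ρ : Measure S) [IsProbabilityMeasure ρ]
    {F : (Fin H → S × A) → ℝ} (hF : Measurable F) (hc : ∀ t, |F t| ≤ c) :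
    ∫ t, F t ∂(trajLaw M H π ρ) = ∫ x, ∫ t, F t ∂(rollout M π H 0 x) ∂ρ := by
  have h := Kernel.integral_comp (η := rollout M π H 0) (κ := Kernel.const Unit ρ) (a := ())
    (f := F) (integrable_of_measurable_of_abs_le hF hc)
  rwa [Kernel.comp_apply, Kernel.const_apply] at h

theorem integral_trajLaw_next {H : ℕ} (ρ : Measure S) [IsProbabilityMeasure ρ]
    {F : (S × A) × S → ℝ} (hF : Measurable F) (hc : ∀ p, |F p| ≤ c) (h : Fin H)
    (hh : (h : ℕ) + 1 < H) :
    ∫ t, F (t h, (t ⟨h + 1, hh⟩).1) ∂(trajLaw M H π ρ) =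
      ∫ t, ∫ y, F (t h, y) ∂(M.P h (t h)) ∂(trajLaw M H π ρ) := by
  have hin : Measurable fun z => ∫ y, F (z, y) ∂(M.P h z) :=
    measurable_integral_kernel (M.P h) (f := fun z y => F (z, y)) hF
  rw [integral_trajLaw M π ρ (F := fun t => F (t h, (t ⟨h + 1, hh⟩).1)) (by fun_prop) fun t => hc _,
    integral_trajLaw M π ρ (F := fun t => ∫ y, F (t h, y) ∂(M.P h (t h)))
      (hin.comp (by fun_prop)) (c := c) fun t => abs_integral_le_of_abs_le fun y => hc _]
  refine integral_congr_ae (Filter.Eventually.of_forall fun x => ?_)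
  have := integral_rollout_next M π hF hc h H hh 0 x
  rw [zero_add] at this
  exact this

end Rollout

/-! ### Value functions -/

section Value

variable {S : Type u} {A : Type v} [MeasurableSpace S] [MeasurableSpace A]
  (M : MDP S A) (H : ℕ) (π : Policy S A)

theorem abs_reward_le (k : ℕ) (z : S × A) : |M.r k z| ≤ 1 := by
  rw [abs_of_nonneg (M.r_mem k z).1]; exact (M.r_mem k z).2

theorem value_eq_cumulative (h : ℕ) : value M H π h = cumulative M π M.r (H - h) h := rfl

theorem measurable_value (h : ℕ) : Measurable (value M H π h) := by
  rw [value_eq_cumulative]; exact measurable_cumulative M π M.measurable_r _ _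

theorem value_of_le {h : ℕ} (hh : H ≤ h) (x : S) : value M H π h x = 0 := by
  rw [value_eq_cumulative, Nat.sub_eq_zero_of_le hh, cumulative_zero]

theorem value_step {h : ℕ} (hh : h < H) (x : S) :
    value M H π h x =
      ∫ a, (M.r h (x, a) + ∫ y, value M H π (h + 1) y ∂(M.P h (x, a))) ∂(π.ker h x) := by
  rw [value_eq_cumulative, value_eq_cumulative, show H - h = H - (h + 1) + 1 by omega,
    cumulative_succ M π M.measurable_r (abs_reward_le M)]

theorem value_nonneg (h : ℕ) (x : S) : 0 ≤ value M H π h x :=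
  integral_nonneg fun _ => Finset.sum_nonneg fun _ _ => (M.r_mem _ _).1

theorem value_le (h : ℕ) (x : S) : value M H π h x ≤ (H - h : ℕ) := by
  have := abs_cumulative_le M π (abs_reward_le M) (H - h) h x
  rw [mul_one] at this
  exact (le_abs_self _).trans this

theorem bddAbove_range_value (h : ℕ) (x : S) :
    BddAbove (Set.range fun π : Policy S A => value M H π h x) :=
  ⟨(H - h : ℕ), by rintro _ ⟨π, rfl⟩; exact value_le M H π h x⟩

theorem value_le_optValue (h : ℕ) (x : S) : value M H π h x ≤ optValue M H h x :=
  le_ciSup (bddAbove_range_value M H h x) π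

/-- The policy that plays `a` at step `h` and follows `π` otherwise. -/
noncomputable def Policy.deviate (h : ℕ) (a : A) : Policy S A where
  ker := Function.update π.ker h (Kernel.const S (Measure.dirac a))
  markov_ker k := by
    by_cases hk : k = h
    · subst hk; rw [Function.update_self]; infer_instance
    · rw [Function.update_of_ne hk]; infer_instance

variable {M H π}

/-- Playing a at step h and then following the optimal policy is itself a policy, so its value, the
left side, cannot exceed the optimal one. Optimality of π also supplies the measurability of
`optValue`, a supremum over possibly uncountably many policies. -/
theorem IsOptimal.bellman_le (hopt : IsOptimal M H π) {h : ℕ} (hh : h < H) (z : S × A) :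
    M.r h z + ∫ y, optValue M H (h + 1) y ∂(M.P h z) ≤ optValue M H h z.1 := by
  obtain ⟨x, a⟩ := z
  refine le_of_eq_of_le ?_ (value_le_optValue M H (π.deviate h a) h x)
  have hnext : value M H (π.deviate h a) (h + 1) = optValue M H (h + 1) := by
    ext y
    rw [← hopt (h + 1) y]
    unfold value
    rw [rollout_congr M (π := π.deviate h a) (π' := π) _ _ fun k hk => ?_]
    simp only [Policy.deviate]
    exact Function.update_of_ne (by omega) _ _
  rw [value_step M H _ hh, hnext]
  simp only [Policy.deviate, Function.update_self, Kernel.const_apply]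
  have hm : Measurable (optValue M H (h + 1)) := by
    rw [← hnext]; exact measurable_value M H _ _
  rw [integral_dirac']
  refine Measurable.stronglyMeasurable ?_
  exact ((M.measurable_r h).comp (by fun_prop)).add
    ((measurable_integral_kernel (M.P h) (f := fun _ y => optValue M H (h + 1) y)
      (hm.comp measurable_snd)).comp (measurable_const.prodMk measurable_id))

theorem IsOptimal.optValue_eq (hopt : IsOptimal M H π) (h : ℕ) :
    optValue M H h = value M H π h := funext fun x => (hopt h x).symm

theorem IsOptimal.step (hopt : IsOptimal M H π) {h : ℕ} (hh : h < H) (x : S) :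
    optValue M H h x =
      ∫ a, (M.r h (x, a) + ∫ y, optValue M H (h + 1) y ∂(M.P h (x, a))) ∂(π.ker h x) := by
  rw [hopt.optValue_eq h, hopt.optValue_eq (h + 1)]; exact value_step M H π hh x

end Value
end OfflineRL

namespace OfflineRL

/-! ### Linear MDPs -/

section Linear

variable {S : Type u} {A : Type v} [MeasurableSpace S] [MeasurableSpace A]

theorem signedMeasure_apply_eq_sub (μ : SignedMeasure S) {B : Set S} (hB : MeasurableSet B) :
    μ B = μ.toJordanDecomposition.posPart.real B - μ.toJordanDecomposition.negPart.real B := by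
  conv_lhs => rw [← μ.toSignedMeasure_toJordanDecomposition]
  rw [JordanDecomposition.toSignedMeasure, _root_.sub_apply,
    Measure.toSignedMeasure_apply_measurable hB, Measure.toSignedMeasure_apply_measurable hB]

/-- A probability measure that is a combination of signed measures on events is the same
combination on bounded functions. -/
theorem integral_eq_sum_of_signedMeasure {d : ℕ} (P : Measure S) [IsFiniteMeasure P]
    (μ : Fin d → SignedMeasure S) (c : Fin d → ℝ)
    (hP : ∀ B, MeasurableSet B → P.real B = ∑ i, c i * μ i B)
    {V : S → ℝ} (hV : Measurable V) {b : ℝ} (hb : ∀ x, |V x| ≤ b) :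
    ∫ y, V y ∂P = ∑ i, c i * (∫ y, V y ∂(μ i).toJordanDecomposition.posPart -
      ∫ y, V y ∂(μ i).toJordanDecomposition.negPart) := by
  set p : Fin d → Measure S := fun i => (μ i).toJordanDecomposition.posPart with hp
  set n : Fin d → Measure S := fun i => (μ i).toJordanDecomposition.negPart with hn
  have hinteg : ∀ (m : Measure S) [IsFiniteMeasure m], Integrable V m := fun m _ =>
    integrable_of_measurable_of_abs_le hV hb
  have hpm : ∀ a : ℝ, ((a.toNNReal : NNReal) : ℝ) - ((-a).toNNReal : NNReal) = a := fun a => by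
    rw [Real.coe_toNNReal', Real.coe_toNNReal']
    rcases le_total 0 a with h | h
    · rw [max_eq_left h, max_eq_right (by linarith)]; ring
    · rw [max_eq_right h, max_eq_left (by linarith)]; ring
  have hmul : ∀ a q : ℝ, a * q = ((a.toNNReal : NNReal) : ℝ) * q - ((-a).toNNReal : NNReal) * q :=
    fun a q => by rw [← sub_mul, hpm]
  -- Moving all negative terms to the side of P turns the relation into an equality of two finite
  -- positive measures, which can be checked on events and then integrated.
  have key : P + ∑ i, ((-c i).toNNReal • p i + (c i).toNNReal • n i)
      = ∑ i, ((c i).toNNReal • p i + (-c i).toNNReal • n i) := by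
    refine Measure.ext fun B hB => ?_
    rw [← ENNReal.toReal_eq_toReal_iff' (measure_ne_top _ _) (measure_ne_top _ _)]
    simp only [Measure.add_apply, Measure.finsetSum_apply, Measure.smul_apply]
    rw [ENNReal.toReal_add (measure_ne_top _ _) (by simp [ENNReal.sum_eq_top, ENNReal.smul_def,
        ENNReal.mul_eq_top]),
      ENNReal.toReal_sum (by simp [ENNReal.smul_def, ENNReal.mul_eq_top]),
      ENNReal.toReal_sum (by simp [ENNReal.smul_def, ENNReal.mul_eq_top])]
    have e : ∀ (a a' : NNReal) (m m' : Measure S) [IsFiniteMeasure m] [IsFiniteMeasure m'],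
        (a • m B + a' • m' B).toReal = a * m.real B + a' * m'.real B := fun a a' m m' _ _ => by
      rw [ENNReal.toReal_add (by simp [ENNReal.smul_def, ENNReal.mul_eq_top])
        (by simp [ENNReal.smul_def, ENNReal.mul_eq_top])]
      simp [ENNReal.smul_def, Measure.real]
    simp_rw [e]
    change P.real B + _ = _
    rw [hP B hB, ← Finset.sum_add_distrib]
    refine Finset.sum_congr rfl fun i _ => ?_
    rw [signedMeasure_apply_eq_sub _ hB]
    change c i * ((p i).real B - (n i).real B) + _ = _
    linarith [hmul (c i) ((p i).real B), hmul (c i) ((n i).real B)]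
  have hfin : ∀ (a a' : NNReal) (m m' : Measure S) [IsFiniteMeasure m] [IsFiniteMeasure m'],
      ∫ y, V y ∂(a • m + a' • m') = a * ∫ y, V y ∂m + a' * ∫ y, V y ∂m' := fun a a' m m' _ _ => by
    rw [integral_add_measure (hinteg _) (hinteg _), integral_smul_nnreal_measure,
      integral_smul_nnreal_measure]
    simp [NNReal.smul_def]
  have h := congrArg (fun m => ∫ y, V y ∂m) key
  rw [integral_add_measure (hinteg _) (hinteg _), integral_finsetSum_measure fun i _ => hinteg _,
    integral_finsetSum_measure fun i _ => hinteg _] at h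
  simp_rw [hfin] at h
  rw [← eq_sub_iff_add_eq, ← Finset.sum_sub_distrib] at h
  rw [h]
  refine Finset.sum_congr rfl fun i _ => ?_
  linarith [hmul (c i) (∫ y, V y ∂(p i)), hmul (c i) (∫ y, V y ∂(n i))]

variable {M : MDP S A} {H d : ℕ} {φ : S × A → Fin d → ℝ}

theorem toLp_norm_sq (u : Fin d → ℝ) : ‖WithLp.toLp 2 u‖ ^ 2 = u ⬝ᵥ u := by
  rw [EuclideanSpace.norm_sq_eq]
  simp [dotProduct, sq]

theorem IsLinear.feature_dot_le (hlin : IsLinear M H φ) (z : S × A) : φ z ⬝ᵥ φ z ≤ 1 := by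
  rw [← toLp_norm_sq]
  exact pow_le_one₀ (norm_nonneg _) (hlin.norm_feature_le z)

/-- The regressions are well specified: whatever the next value function, its conditional
expectation is exactly linear in the features, so there is no approximation error. -/
theorem IsLinear.exists_coeff (hlin : IsLinear M H φ) {h : ℕ} (hh : h < H) {V : S → ℝ}
    (hV : Measurable V) {b : ℝ} (hb : ∀ x, |V x| ≤ b) :
    ∃ w : Fin d → ℝ, ∀ z, ∫ y, V y ∂(M.P h z) = φ z ⬝ᵥ w := by
  obtain ⟨μ, θ, hμ, -⟩ := hlin.linear h hh
  exact ⟨_, fun z => integral_eq_sum_of_signedMeasure (M.P h z) μ (φ z) (hμ z) hV hb⟩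

theorem IsLinear.exists_reward_coeff (hlin : IsLinear M H φ) {h : ℕ} (hh : h < H) :
    ∃ θ : Fin d → ℝ, ∀ z, M.r h z = φ z ⬝ᵥ θ := by
  obtain ⟨μ, θ, -, hθ, -⟩ := hlin.linear h hh
  exact ⟨θ, hθ⟩

/-! ### Coverage -/

/-- Subtracting λ_min times the identity shifts the spectrum into [0, ∞), so what remains is
positive semidefinite. -/
theorem lambdaMin_mul_le {G : Matrix (Fin d) (Fin d) ℝ} (hG : G.IsHermitian) (u : Fin d → ℝ) :
    lambdaMin G * (u ⬝ᵥ u) ≤ u ⬝ᵥ (G *ᵥ u) := by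
  have hps : (G - lambdaMin G • (1 : Matrix (Fin d) (Fin d) ℝ)).PosSemidef := by
    rw [posSemidef_iff_isHermitian_and_spectrum_nonneg]
    refine ⟨hG.sub (by simp [IsHermitian]), fun a ha => ?_⟩
    have hmem : a + lambdaMin G ∈ spectrum ℝ G := by
      rw [spectrum.add_mem_iff, neg_add_eq_sub, Algebra.algebraMap_eq_smul_one]
      exact ha
    have h1 : lambdaMin G ≤ a + lambdaMin G := csInf_le G.finite_real_spectrum.bddBelow hmem
    simpa using h1
  have := hps.dotProduct_mulVec_nonneg u
  rw [star_trivial, sub_mulVec, dotProduct_sub, smul_mulVec, one_mulVec, dotProduct_smul,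
    smul_eq_mul] at this
  linarith

variable (M φ) in
theorem dotProduct_featureCov (hlin : IsLinear M H φ) (b : Policy S A) (ρ : Measure S)
    [IsProbabilityMeasure ρ] (h : Fin H) (u : Fin d → ℝ) :
    u ⬝ᵥ (featureCov M φ b ρ h *ᵥ u) = ∫ t, (u ⬝ᵥ φ (t h)) ^ 2 ∂(trajLaw M H b ρ) := by
  have hφ := hlin.measurable_feature
  have hcoord : ∀ z i, |φ z i| ≤ 1 := fun z i => by
    rw [← sq_le_one_iff_abs_le_one]
    refine le_trans ?_ (hlin.feature_dot_le z)
    rw [dotProduct, sq]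
    exact Finset.single_le_sum (f := fun i => φ z i * φ z i)
      (fun i _ => mul_self_nonneg _) (Finset.mem_univ i)
  have hinteg : ∀ i j, Integrable (fun t : Fin H → S × A => φ (t h) i * φ (t h) j)
      (trajLaw M H b ρ) := fun i j => by
    refine integrable_of_measurable_of_abs_le (b := 1) (by fun_prop) fun t => ?_
    rw [abs_mul]
    exact mul_le_one₀ (hcoord _ _) (abs_nonneg _) (hcoord _ _)
  have e : ∀ t : Fin H → S × A, (u ⬝ᵥ φ (t h)) ^ 2
      = ∑ i, ∑ j, u i * (u j * (φ (t h) i * φ (t h) j)) := fun t => by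
    rw [sq, dotProduct, Finset.sum_mul_sum]
    exact Finset.sum_congr rfl fun i _ => Finset.sum_congr rfl fun j _ => by ring
  simp_rw [e]
  rw [integral_finsetSum _ fun i _ => integrable_finsetSum _ fun j _ =>
      ((hinteg i j).const_mul _).const_mul _]
  simp only [dotProduct, mulVec, Finset.mul_sum]
  refine Finset.sum_congr rfl fun i _ => ?_
  rw [integral_finsetSum _ fun j _ => ((hinteg i j).const_mul _).const_mul _]
  refine Finset.sum_congr rfl fun j _ => ?_
  rw [integral_const_mul, integral_const_mul]
  simp only [featureCov, of_apply]; ring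

theorem coverage_mul_le (hlin : IsLinear M H φ) (b : Policy S A) (ρ : Measure S)
    [IsProbabilityMeasure ρ] (h : Fin H) (u : Fin d → ℝ) :
    coverage M H φ b ρ * (u ⬝ᵥ u) ≤ ∫ t, (u ⬝ᵥ φ (t h)) ^ 2 ∂(trajLaw M H b ρ) := by
  rw [← dotProduct_featureCov M φ hlin b ρ h u]
  refine le_trans ?_ (lambdaMin_mul_le ?_ u)
  · refine mul_le_mul_of_nonneg_right ?_ (dotProduct_self_nonneg' u)
    exact ciInf_le (Set.finite_range _).bddBelow h
  · ext i j
    simp only [featureCov, conjTranspose_apply, of_apply, star_trivial]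
    exact integral_congr_ae (Filter.Eventually.of_forall fun t => mul_comm _ _)

theorem horizon_pos_of_coverage_pos {b : Policy S A} {ρ : Measure S}
    (hκ : 0 < coverage M H φ b ρ) : 0 < H := by
  rcases Nat.eq_zero_or_pos H with rfl | h
  · simp [coverage] at hκ
  · exact h

theorem dim_pos_of_coverage_pos {b : Policy S A} {ρ : Measure S}
    (hκ : 0 < coverage M H φ b ρ) : 0 < d := by
  rcases Nat.eq_zero_or_pos d with rfl | h
  · have hH := horizon_pos_of_coverage_pos hκ
    have : Nonempty (Fin H) := ⟨⟨0, hH⟩⟩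
    simp [coverage, lambdaMin, spectrum.of_subsingleton] at hκ
  · exact h

/-- κ d is at most the trace of the feature covariance, which is E |φ|² ≤ 1. This inequality later
trades powers of 1 / κ for powers of d. -/
theorem coverage_mul_dim_le (hlin : IsLinear M H φ) {b : Policy S A} {ρ : Measure S}
    [IsProbabilityMeasure ρ] (hH : 0 < H) : coverage M H φ b ρ * d ≤ 1 := by
  set h : Fin H := ⟨0, hH⟩
  have hφ := hlin.measurable_feature
  have hinteg : ∀ i, Integrable (fun t : Fin H → S × A =>
      ((Pi.single i 1 : Fin d → ℝ) ⬝ᵥ φ (t h)) ^ 2) (trajLaw M H b ρ) := fun i => by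
    refine integrable_of_measurable_of_abs_le (b := 1) (by simp; fun_prop) fun t => ?_
    rw [abs_of_nonneg (sq_nonneg _)]
    refine (dotProduct_sq_le _ _).trans ?_
    simpa using hlin.feature_dot_le (t h)
  calc coverage M H φ b ρ * d
      = ∑ i : Fin d, coverage M H φ b ρ *
          ((Pi.single i 1 : Fin d → ℝ) ⬝ᵥ (Pi.single i 1 : Fin d → ℝ)) := by
        simp [mul_comm]
    _ ≤ ∑ i : Fin d, ∫ t, ((Pi.single i 1 : Fin d → ℝ) ⬝ᵥ φ (t h)) ^ 2 ∂(trajLaw M H b ρ) :=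
        Finset.sum_le_sum fun i _ => coverage_mul_le hlin b ρ h _
    _ = ∫ t, φ (t h) ⬝ᵥ φ (t h) ∂(trajLaw M H b ρ) := by
        rw [← integral_finsetSum _ fun i _ => hinteg i]
        refine integral_congr_ae (Filter.Eventually.of_forall fun t => ?_)
        simp only [single_one_dotProduct, sq]
        rfl
    _ ≤ ∫ _t, 1 ∂(trajLaw M H b ρ) := by
        refine integral_mono ?_ (integrable_const _) fun t => hlin.feature_dot_le _
        refine integrable_of_measurable_of_abs_le (b := 1) (by unfold dotProduct; fun_prop)
          fun t => ?_
        rw [abs_of_nonneg (dotProduct_self_nonneg' _)]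
        exact hlin.feature_dot_le _
    _ = 1 := by simp

/-- Coefficients of bounded linear functions are bounded in terms of the coverage. -/
theorem coverage_mul_coeff_le (hlin : IsLinear M H φ) (b : Policy S A) (ρ : Measure S)
    [IsProbabilityMeasure ρ] (hH : 0 < H) {w : Fin d → ℝ} {B : ℝ} (hB : ∀ z, |φ z ⬝ᵥ w| ≤ B) :
    coverage M H φ b ρ * (w ⬝ᵥ w) ≤ B ^ 2 := by
  have hφ := hlin.measurable_feature
  -- κ |w|² is at most the second moment of w · φ at any step; step 0 is as good as another.
  refine (coverage_mul_le hlin b ρ ⟨0, hH⟩ w).trans ?_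
  have hb : ∀ z, (w ⬝ᵥ φ z) ^ 2 ≤ B ^ 2 := fun z => by
    rw [dotProduct_comm, ← sq_abs]
    exact pow_le_pow_left₀ (abs_nonneg _) (hB z) 2
  calc _ ≤ ∫ _t, B ^ 2 ∂(trajLaw M H b ρ) := by
        refine integral_mono ?_ (integrable_const _) fun t => hb _
        refine integrable_of_measurable_of_abs_le (b := B ^ 2) (by unfold dotProduct; fun_prop)
          fun t => ?_
        rw [abs_of_nonneg (sq_nonneg _)]; exact hb _
    _ = B ^ 2 := by simp

end Linear
end OfflineRL

namespace OfflineRL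

/-! ### Ridge regression on trajectories -/

section RidgeEvent

variable {S : Type u} {A : Type v} {H K d : ℕ}

/-- The value of `V` at the state following step `h`, which is `0` at the last step. -/
noncomputable def nextVal (V : S → ℝ) (h : Fin H) (t : Fin H → S × A) : ℝ :=
  if hh : (h : ℕ) + 1 < H then V (t ⟨h + 1, hh⟩).1 else 0

variable [MeasurableSpace S] [MeasurableSpace A] (M : MDP S A) (φ : S × A → Fin d → ℝ)

theorem observe_next (t : Fin K → Fin H → S × A) (V : S → ℝ) (h : Fin H) (τ : Fin K) :
    (observe M t).next V h τ = nextVal V h (t τ) := rfl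

/-- The empirical covariance dominates `n κ / 2`, and the noise is bounded in the norm that the
empirical covariance defines. -/
def RegressionGood (t : Fin K → Fin H → S × A) (T : Finset (Fin K)) (σ : S × A → ℝ) (V : S → ℝ)
    (h : Fin H) (κ B : ℝ) : Prop :=
  ∀ u : Fin d → ℝ,
    T.card * (κ * (u ⬝ᵥ u)) / 2 ≤ ∑ τ ∈ T, (σ (t τ h))⁻¹ * (u ⬝ᵥ φ (t τ h)) ^ 2 ∧
    (∑ τ ∈ T, (σ (t τ h))⁻¹ * (u ⬝ᵥ φ (t τ h)) *
        (nextVal V h (t τ) - ∫ y, V y ∂(M.P h (t τ h)))) ^ 2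
      ≤ B * ∑ τ ∈ T, (σ (t τ h))⁻¹ * (u ⬝ᵥ φ (t τ h)) ^ 2

/-! ### Deterministic error analysis of ridge regression. -/

section Deterministic

variable {M φ}

theorem dotProduct_ridgeMatrix {S A : Type*} {φ : S × A → Fin d → ℝ} (lam : ℝ)
    (D : Dataset S A H K) (T : Finset (Fin K)) (σ : S × A → ℝ) (h : Fin H) (u v : Fin d → ℝ) :
    u ⬝ᵥ (ridgeMatrix φ lam D T σ h *ᵥ v) =
      ∑ τ ∈ T, (σ (D.pair τ h))⁻¹ * (u ⬝ᵥ φ (D.pair τ h)) * (v ⬝ᵥ φ (D.pair τ h))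
        + lam * (u ⬝ᵥ v) := by
  rw [ridgeMatrix, add_mulVec, dotProduct_add, sum_mulVec, dotProduct_sum, smul_mulVec,
    one_mulVec, dotProduct_smul, smul_eq_mul]
  congr 1
  refine Finset.sum_congr rfl fun τ _ => ?_
  rw [smul_mulVec, dotProduct_smul, smul_eq_mul, vecMulVec_mulVec, dotProduct_smul,
    dotProduct_comm v]
  simp only [MulOpposite.smul_eq_mul_unop, MulOpposite.unop_op]
  ring

theorem ridgeMatrix_isHermitian {S A : Type*} {φ : S × A → Fin d → ℝ} (lam : ℝ)
    (D : Dataset S A H K) (T : Finset (Fin K)) (σ : S × A → ℝ) (h : Fin H) :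
    (ridgeMatrix φ lam D T σ h).IsHermitian := by
  unfold ridgeMatrix IsHermitian
  rw [conjTranspose_add, conjTranspose_sum]
  simp only [conjTranspose_eq_transpose_of_trivial, transpose_smul, transpose_vecMulVec,
    transpose_one]

theorem ridgeMatrix_posDef {S A : Type*} {φ : S × A → Fin d → ℝ} {lam : ℝ} (hlam : 0 < lam)
    (D : Dataset S A H K) (T : Finset (Fin K)) {σ : S × A → ℝ} (hσ : ∀ z, 1 ≤ σ z) (h : Fin H) :
    (ridgeMatrix φ lam D T σ h).PosDef := by
  refine PosDef.of_dotProduct_mulVec_pos (ridgeMatrix_isHermitian _ _ _ _ _) fun u hu => ?_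
  rw [star_trivial, dotProduct_ridgeMatrix]
  have h1 : 0 < u ⬝ᵥ u := lt_of_le_of_ne (dotProduct_self_nonneg' u)
    fun h => hu (dotProduct_self_eq_zero.1 h.symm)
  refine add_pos_of_nonneg_of_pos (Finset.sum_nonneg fun τ _ => ?_) (mul_pos hlam h1)
  rw [mul_assoc, ← sq]
  have := hσ (D.pair τ h)
  positivity

/-- With `a = Λ⁻¹ u`, one has `v · Λ⁻¹ u = v · a`, `Λ a = u` and `a · Λ a = ‖u‖²_{Λ⁻¹}`. -/
theorem inv_mulVec_spec {Λ : Matrix (Fin d) (Fin d) ℝ} (hΛ : Λ.PosDef) (u : Fin d → ℝ) :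
    Λ *ᵥ (Λ⁻¹ *ᵥ u) = u ∧ (Λ⁻¹ *ᵥ u) ⬝ᵥ (Λ *ᵥ (Λ⁻¹ *ᵥ u)) = wnorm Λ⁻¹ u ^ 2 := by
  have hdet := (Matrix.isUnit_iff_isUnit_det _).1 hΛ.isUnit
  have h1 : Λ *ᵥ (Λ⁻¹ *ᵥ u) = u := by
    rw [mulVec_mulVec, mul_nonsing_inv _ hdet, one_mulVec]
  refine ⟨h1, ?_⟩
  rw [h1, dotProduct_comm, wnorm, Real.sq_sqrt]
  simpa using hΛ.inv.posSemidef.dotProduct_mulVec_nonneg u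

theorem wnorm_nonneg (Λ : Matrix (Fin d) (Fin d) ℝ) (u : Fin d → ℝ) : 0 ≤ wnorm Λ u :=
  Real.sqrt_nonneg _

theorem dotProduct_symm_mulVec {Λ : Matrix (Fin d) (Fin d) ℝ} (hΛ : Λ.IsHermitian)
    (u v : Fin d → ℝ) : u ⬝ᵥ (Λ *ᵥ v) = (Λ *ᵥ u) ⬝ᵥ v := by
  rw [dotProduct_mulVec, ← mulVec_transpose, ← conjTranspose_eq_transpose_of_trivial, hΛ.eq]

/-- Comparison of inverse norms: `Λ ≤ c Λ'` implies `‖u‖²_{Λ'⁻¹} ≤ c ‖u‖²_{Λ⁻¹}`. -/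
theorem wnorm_inv_le_of_le {Λ Λ' : Matrix (Fin d) (Fin d) ℝ} (hΛ : Λ.PosDef) (hΛ' : Λ'.PosDef)
    {c : ℝ} (hc : 0 < c) (hle : ∀ v, v ⬝ᵥ (Λ *ᵥ v) ≤ c * (v ⬝ᵥ (Λ' *ᵥ v))) (u : Fin d → ℝ) :
    wnorm Λ'⁻¹ u ^ 2 ≤ c * wnorm Λ⁻¹ u ^ 2 := by
  obtain ⟨h1, h2⟩ := inv_mulVec_spec hΛ u
  obtain ⟨h1', h2'⟩ := inv_mulVec_spec hΛ' u
  set a := Λ⁻¹ *ᵥ u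
  set a' := Λ'⁻¹ *ᵥ u
  -- Expanding the square gives 0 ≤ a' · Λ a' - 2 c (a' · u) + c² (a · u). Since a' · Λ a' ≤ c (a' ·
  -- u), what remains is a' · u ≤ c (a · u).
  have hpos := hΛ.posSemidef.dotProduct_mulVec_nonneg (a' - c • a)
  rw [star_trivial, mulVec_sub, mulVec_smul, dotProduct_sub, dotProduct_smul, sub_dotProduct,
    sub_dotProduct, smul_dotProduct, smul_dotProduct, dotProduct_symm_mulVec hΛ.isHermitian a a',
    h1] at hpos
  have h3 := hle a'
  rw [h1] at h2
  rw [h2'] at h3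
  rw [h1'] at h2'
  rw [h2, dotProduct_comm u a', h2'] at hpos
  simp only [smul_eq_mul] at hpos
  nlinarith

/-- Error of the (weighted) ridge regression estimate. -/
theorem RegressionGood.ridge_error {t : Fin K → Fin H → S × A} {T : Finset (Fin K)}
    {σ : S × A → ℝ} {V : S → ℝ} {h : Fin H} {κ B lam : ℝ}
    (hgood : RegressionGood M φ t T σ V h κ B) (hφ1 : ∀ z, φ z ⬝ᵥ φ z ≤ 1)
    (hσ : ∀ z, 1 ≤ σ z) (hlam : 0 < lam) (hκ : 0 < κ) (hT : 0 < T.card) (hB : 0 ≤ B)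
    {f : S × A → ℝ} {w : Fin d → ℝ} (hw : ∀ z, f z + ∫ y, V y ∂(M.P h z) = φ z ⬝ᵥ w)
    (y : Fin K → ℝ) (hy : ∀ τ, y τ = f (t τ h) + nextVal V h (t τ)) (z : S × A) :
    |φ z ⬝ᵥ ridge φ lam (observe M t) T σ h y - φ z ⬝ᵥ w|
      ≤ (√B + lam * √(w ⬝ᵥ w) * √(2 / (T.card * κ))) *
        wnorm (ridgeMatrix φ lam (observe M t) T σ h)⁻¹ (φ z) ∧
    wnorm (ridgeMatrix φ lam (observe M t) T σ h)⁻¹ (φ z) ≤ √(2 / (T.card * κ)) := by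
  have hn : (0 : ℝ) < T.card := by exact_mod_cast hT
  set Λ := ridgeMatrix φ lam (observe M t) T σ h with hΛdef
  have hΛ : Λ.PosDef := ridgeMatrix_posDef hlam _ _ hσ h
  obtain ⟨h1, h2⟩ := inv_mulVec_spec hΛ (φ z)
  set a := Λ⁻¹ *ᵥ φ z with ha
  set q := wnorm Λ⁻¹ (φ z) with hq
  have hq0 : 0 ≤ q := wnorm_nonneg _ _
  obtain ⟨g1, g2⟩ := hgood a
  set Q := ∑ τ ∈ T, (σ (t τ h))⁻¹ * (a ⬝ᵥ φ (t τ h)) ^ 2 with hQ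
  have hquad : a ⬝ᵥ (Λ *ᵥ a) = Q + lam * (a ⬝ᵥ a) := by
    rw [hΛdef, dotProduct_ridgeMatrix]
    congr 1
    exact Finset.sum_congr rfl fun τ _ => by simp only [observe]; ring
  have haa : 0 ≤ a ⬝ᵥ a := dotProduct_self_nonneg' a
  have hQq : Q ≤ q ^ 2 := by rw [← h2, hquad]; nlinarith
  -- The lower bound on the empirical covariance converts the length of a into the width q.
  have haq : a ⬝ᵥ a ≤ 2 / (T.card * κ) * q ^ 2 := by
    rw [div_mul_eq_mul_div, le_div_iff₀ (by positivity)]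
    nlinarith
  have hasq : √(a ⬝ᵥ a) ≤ √(2 / (T.card * κ)) * q := by
    rw [← Real.sqrt_sq hq0, ← Real.sqrt_mul (by positivity)]
    exact Real.sqrt_le_sqrt haq
  constructor
  · have herr : φ z ⬝ᵥ ridge φ lam (observe M t) T σ h y - φ z ⬝ᵥ w
        = ∑ τ ∈ T, (σ (t τ h))⁻¹ * (a ⬝ᵥ φ (t τ h)) *
          (nextVal V h (t τ) - ∫ y, V y ∂(M.P h (t τ h))) - lam * (a ⬝ᵥ w) := by
      have e1 : φ z ⬝ᵥ ridge φ lam (observe M t) T σ h y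
          = ∑ τ ∈ T, (σ (t τ h))⁻¹ * (a ⬝ᵥ φ (t τ h)) * y τ := by
        rw [ridge, ← hΛdef, dotProduct_symm_mulVec hΛ.inv.isHermitian, ← ha, dotProduct_sum]
        refine Finset.sum_congr rfl fun τ _ => ?_
        rw [dotProduct_smul, smul_eq_mul]
        simp only [observe]; ring
      have e2 : φ z ⬝ᵥ w
          = ∑ τ ∈ T, (σ (t τ h))⁻¹ * (a ⬝ᵥ φ (t τ h)) * (φ (t τ h) ⬝ᵥ w) + lam * (a ⬝ᵥ w) := by
        conv_lhs => rw [← h1, ← dotProduct_symm_mulVec hΛ.isHermitian, hΛdef,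
          dotProduct_ridgeMatrix]
        congr 1
        refine Finset.sum_congr rfl fun τ _ => ?_
        rw [dotProduct_comm w]; rfl
      rw [e1, e2, ← sub_sub, ← Finset.sum_sub_distrib]
      congr 1
      refine Finset.sum_congr rfl fun τ _ => ?_
      rw [hy, ← hw]; ring
    rw [herr]
    refine (abs_sub _ _).trans ?_
    rw [add_mul]
    refine add_le_add ?_ ?_
    · refine (Real.abs_le_sqrt g2).trans ?_
      rw [Real.sqrt_mul hB]
      refine mul_le_mul_of_nonneg_left ?_ (Real.sqrt_nonneg _)
      rw [← Real.sqrt_sq hq0]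
      exact Real.sqrt_le_sqrt hQq
    · rw [abs_mul, abs_of_pos hlam, mul_assoc, mul_assoc]
      refine mul_le_mul_of_nonneg_left ?_ hlam.le
      refine (Real.abs_le_sqrt (dotProduct_sq_le a w)).trans ?_
      rw [Real.sqrt_mul haa, mul_comm]
      exact mul_le_mul_of_nonneg_left hasq (Real.sqrt_nonneg _)
  · have h3 : q ^ 2 ≤ √(2 / (T.card * κ)) * q := by
      rw [← h2, h1]
      refine (le_abs_self _).trans ((Real.abs_le_sqrt (dotProduct_sq_le a (φ z))).trans ?_)
      refine (Real.sqrt_le_sqrt ?_).trans hasq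
      exact mul_le_of_le_one_right haa (hφ1 z)
    rcases hq0.eq_or_lt with h0 | h0
    · rw [← h0]; positivity
    · rw [sq] at h3
      exact le_of_mul_le_mul_right h3 h0

end Deterministic

/-! ### Failure probability for fixed weights and a fixed target. -/

section Probability

theorem measurable_nextVal {α : Type*} [MeasurableSpace α] {V : α → S → ℝ}
    (hV : Measurable (Function.uncurry V)) (h : Fin H) {g : α → Fin H → S × A}
    (hg : Measurable g) : Measurable fun p => nextVal (V p) h (g p) := by
  unfold nextVal
  split_ifs with hh
  · exact hV.comp (measurable_id.prodMk
      (measurable_fst.comp ((measurable_pi_apply _).comp hg)))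
  · exact measurable_const

theorem measurable_integral_next {α : Type*} [MeasurableSpace α] {V : α → S → ℝ}
    (hV : Measurable (Function.uncurry V)) (h : ℕ) :
    Measurable fun p : α × (S × A) => ∫ y, V p.1 y ∂(M.P h p.2) :=
  measurable_integral_kernel (Kernel.prodMkLeft α (M.P h)) (f := fun p y => V p.1 y)
    (hV.comp ((measurable_fst.comp measurable_fst).prodMk measurable_snd))

theorem stepVar_eq {h : ℕ} {V : S → ℝ} (hV : Measurable V) {B : ℝ} (hB : ∀ x, |V x| ≤ B)
    (z : S × A) :
    ∫ y, (V y - ∫ y', V y' ∂(M.P h z)) ^ 2 ∂(M.P h z) = stepVar M h V z := by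
  have hi : Integrable V (M.P h z) := integrable_of_measurable_of_abs_le hV hB
  have hi2 : Integrable (fun y => V y ^ 2) (M.P h z) :=
    integrable_of_measurable_of_abs_le (hV.pow_const 2) (b := B ^ 2) fun y => by
      rw [abs_pow]; exact pow_le_pow_left₀ (abs_nonneg _) (hB y) 2
  set m := ∫ y', V y' ∂(M.P h z) with hm
  have e : ∀ y, (V y - m) ^ 2 = V y ^ 2 - 2 * m * V y + m ^ 2 := fun y => by ring
  simp_rw [e]
  have hi3 : Integrable (fun y => V y ^ 2 - 2 * m * V y) (M.P h z) := hi2.sub (hi.const_mul _)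
  rw [integral_add hi3 (integrable_const _), integral_sub hi2 (hi.const_mul _),
    integral_const_mul, stepVar, ← hm]
  simp; ring

variable {M φ} (hlin : IsLinear M H φ) (b : Policy S A) (ρ : Measure S) [IsProbabilityMeasure ρ]

include hlin in
-- The weights 1/σ ≥ 1/m reduce the coverage to κ / m. The noise is centred given the current pair
-- by the Markov property. Its second moment is measured against the weighted form itself, so only
-- the ratio v of the conditional variance to σ enters the bound.
theorem pi_regression_failure_le_of_fixed {ι : Type*} [Fintype ι] (J : Finset ι)
    {σ : S × A → ℝ} {V : S → ℝ} {h : Fin H} {κ m B v L : ℝ} (hκ : κ = coverage M H φ b ρ)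
    (hκ0 : 0 < κ)
    (hσm : Measurable σ) (hVm : Measurable V) (hσ1 : ∀ z, 1 ≤ σ z) (hσ2 : ∀ z, σ z ≤ m)
    (hVB : ∀ x, |V x| ≤ B) (hvar : ∀ z, stepVar M h V z ≤ v * σ z)
    (hlast : (h : ℕ) + 1 = H → ∀ x, V x = 0)
    (hv : 0 < v) (hL : 0 < L) (hLB : L * (2 * B) ^ 2 ≤ J.card * v * (κ / m))
    (hLd : 64 * d ^ 2 * L ≤ J.card * (κ / m) ^ 2) :
    (Measure.pi fun _ : ι => trajLaw M H b ρ).real {ω | ¬ ∀ u : Fin d → ℝ,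
      J.card * (κ / m * (u ⬝ᵥ u)) / 2 ≤ ∑ τ ∈ J, (σ (ω τ h))⁻¹ * (u ⬝ᵥ φ (ω τ h)) ^ 2 ∧
      (∑ τ ∈ J, (σ (ω τ h))⁻¹ * (u ⬝ᵥ φ (ω τ h)) *
          (nextVal V h (ω τ) - ∫ y, V y ∂(M.P h (ω τ h)))) ^ 2
        ≤ 8 * d * (v * L) * ∑ τ ∈ J, (σ (ω τ h))⁻¹ * (u ⬝ᵥ φ (ω τ h)) ^ 2}
      ≤ 4 * d ^ 2 * Real.exp (-L) := by
  have hφ := hlin.measurable_feature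
  have hH : 0 < H := h.pos
  have hd : 0 < d := dim_pos_of_coverage_pos (hκ ▸ hκ0)
  obtain ⟨z0⟩ : Nonempty (Fin H → S × A) := by
    by_contra hne
    rw [not_nonempty_iff] at hne
    have := measure_univ (μ := trajLaw M H b ρ)
    simp [Set.univ_eq_empty_iff.2 hne] at this
  have hm1 : 1 ≤ m := (hσ1 (z0 h)).trans (hσ2 _)
  have hκ1 : κ ≤ 1 := by
    have h1 := coverage_mul_dim_le hlin (b := b) (ρ := ρ) hH
    rw [← hκ] at h1
    have h2 : (1 : ℝ) ≤ d := by exact_mod_cast hd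
    nlinarith
  have hPV : Measurable fun z => ∫ y, V y ∂(M.P h z) :=
    measurable_integral_kernel (M.P h) (f := fun _ y => V y) (hVm.comp measurable_snd)
  have hPVb : ∀ z, |∫ y, V y ∂(M.P h z)| ≤ B := fun z => abs_integral_le_of_abs_le hVB
  have hnm : Measurable fun t : Fin H → S × A => nextVal V h t :=
    measurable_nextVal (V := fun _ : Fin H → S × A => V) (hVm.comp measurable_snd) h measurable_id
  have hB0 : 0 ≤ B := (abs_nonneg _).trans (hVB (z0 h).1)
  have hinv0 : ∀ z, 0 ≤ (σ z)⁻¹ := fun z => by have := hσ1 z; positivity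
  have hinv1 : ∀ z, (σ z)⁻¹ ≤ 1 := fun z => inv_le_one_of_one_le₀ (hσ1 z)
  have hdot : ∀ (u : Fin d → ℝ), Measurable fun z => u ⬝ᵥ φ z := fun u =>
    measurable_dotProduct_left hφ u
  have hdotb : ∀ (u : Fin d → ℝ) z, |u ⬝ᵥ φ z| ≤ √(u ⬝ᵥ u) := fun u z =>
    abs_dotProduct_le_sqrt hlin.feature_dot_le u z
  have hfb : ∀ (u : Fin d → ℝ) z y,
      |(σ z)⁻¹ * (u ⬝ᵥ φ z) * (V y - ∫ y', V y' ∂(M.P h z))| ≤ 1 * √(u ⬝ᵥ u) * (B + B) := by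
    intro u z y
    rw [abs_mul, abs_mul]
    gcongr
    · rw [abs_of_nonneg (hinv0 z)]; exact hinv1 z
    · exact hdotb u z
    · exact (abs_sub _ _).trans (add_le_add (hVB y) (hPVb z))
  have hfm : ∀ u : Fin d → ℝ, Measurable fun p : (S × A) × S =>
      (σ p.1)⁻¹ * (u ⬝ᵥ φ p.1) * (V p.2 - ∫ y', V y' ∂(M.P h p.1)) := fun u =>
    (((hσm.inv).mul (hdot u)).comp measurable_fst).mul
      ((hVm.comp measurable_snd).sub (hPV.comp measurable_fst))
  -- At the last step no next state is recorded. The target then vanishes, and so does the noise.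
  have hzero : ¬ (h : ℕ) + 1 < H → V = fun _ => 0 := fun hh =>
    funext (hlast (by have := h.2; omega))
  refine pi_real_regression_failure_le (trajLaw M H b ρ) hd J (ψ := fun t => φ (t h))
    (s := fun t => (σ (t h))⁻¹) (ε := fun t => nextVal V h t - ∫ y, V y ∂(M.P h (t h)))
    (κ := κ / m) (B := 2 * B) (hφ.comp (measurable_pi_apply h))
    ((hσm.comp (measurable_pi_apply h)).inv) (hnm.sub (hPV.comp (measurable_pi_apply h)))
    (fun t => hlin.feature_dot_le _) (fun t => hinv0 _) (fun t => hinv1 _) ?_ (by positivity)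
    ((div_le_one (by positivity)).2 (hκ1.trans hm1)) ?_ ?_ ?_ hv hL hLB hLd
  · intro t
    have hnb : |nextVal V h t| ≤ B := by
      unfold nextVal
      split_ifs
      · exact hVB _
      · simpa using hB0
    linarith [(abs_sub (nextVal V h t) (∫ y, V y ∂(M.P h (t h)))), hPVb (t h)]
  · intro u
    have hcov := coverage_mul_le hlin b ρ h u
    rw [← hκ] at hcov
    have hi : Integrable (fun t : Fin H → S × A => (u ⬝ᵥ φ (t h)) ^ 2) (trajLaw M H b ρ) := by
      refine integrable_of_measurable_of_abs_le (b := (√(u ⬝ᵥ u)) ^ 2)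
        (((hdot u).comp (measurable_pi_apply h)).pow_const 2) fun t => ?_
      rw [abs_pow]; exact pow_le_pow_left₀ (abs_nonneg _) (hdotb u _) 2
    calc κ / m * (u ⬝ᵥ u) = m⁻¹ * (κ * (u ⬝ᵥ u)) := by ring
      _ ≤ m⁻¹ * ∫ t, (u ⬝ᵥ φ (t h)) ^ 2 ∂(trajLaw M H b ρ) := by gcongr
      _ = ∫ t, m⁻¹ * (u ⬝ᵥ φ (t h)) ^ 2 ∂(trajLaw M H b ρ) := by rw [integral_const_mul]
      _ ≤ _ := by
        refine integral_mono (hi.const_mul _) ?_ fun t => ?_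
        · refine integrable_of_measurable_of_abs_le (b := 1 * (√(u ⬝ᵥ u)) ^ 2)
            (((hσm.inv).mul ((hdot u).pow_const 2)).comp (measurable_pi_apply h)) fun t => ?_
          rw [abs_mul, abs_pow]
          gcongr
          · rw [abs_of_nonneg (hinv0 _)]; exact hinv1 _
          · exact hdotb u _
        · exact mul_le_mul_of_nonneg_right (inv_anti₀ (by have := hσ1 (t h); linarith) (hσ2 _))
            (sq_nonneg _)
  · intro u
    by_cases hh : (h : ℕ) + 1 < H
    · have := integral_trajLaw_next M b ρ (hfm u) (fun p => hfb u p.1 p.2) h hh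
      simp only [nextVal, dif_pos hh]
      refine this.trans ?_
      have e : ∀ z, ∫ y, (σ z)⁻¹ * (u ⬝ᵥ φ z) * (V y - ∫ y', V y' ∂(M.P h z)) ∂(M.P h z) = 0 :=
        fun z => by
          rw [integral_const_mul, integral_sub (integrable_of_measurable_of_abs_le hVm hVB)
            (integrable_const _)]
          simp
      simp [e]
    · simp [hzero hh, nextVal]
  · intro u
    by_cases hh : (h : ℕ) + 1 < H
    · have := integral_trajLaw_next M b ρ ((hfm u).pow_const 2)
        (c := (1 * √(u ⬝ᵥ u) * (B + B)) ^ 2) (fun p => by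
          rw [abs_pow]; exact pow_le_pow_left₀ (abs_nonneg _) (hfb u p.1 p.2) 2) h hh
      simp only [nextVal, dif_pos hh]
      refine le_of_eq_of_le this ?_
      rw [← integral_const_mul]
      have e : ∀ z, ∫ y, ((σ z)⁻¹ * (u ⬝ᵥ φ z) * (V y - ∫ y', V y' ∂(M.P h z))) ^ 2 ∂(M.P h z)
          = ((σ z)⁻¹ * (u ⬝ᵥ φ z)) ^ 2 * stepVar M h V z := fun z => by
        simp_rw [mul_pow _ (V _ - _)]
        rw [integral_const_mul, stepVar_eq M hVm hVB]
      simp_rw [e]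
      -- One of the two weights 1/σ cancels the variance, up to the factor v; the other remains as
      -- the weight of the form.
      have hle : ∀ z, ((σ z)⁻¹ * (u ⬝ᵥ φ z)) ^ 2 * stepVar M h V z
          ≤ v * ((σ z)⁻¹ * (u ⬝ᵥ φ z) ^ 2) := fun z => by
        have h0 := hσ1 z
        calc _ ≤ ((σ z)⁻¹ * (u ⬝ᵥ φ z)) ^ 2 * (v * σ z) :=
              mul_le_mul_of_nonneg_left (hvar z) (sq_nonneg _)
          _ = _ := by field_simp
      have h0 : ∀ z, 0 ≤ ((σ z)⁻¹ * (u ⬝ᵥ φ z)) ^ 2 * stepVar M h V z := fun z => by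
        rw [← stepVar_eq M hVm hVB]
        exact mul_nonneg (sq_nonneg _) (integral_nonneg fun _ => sq_nonneg _)
      refine integral_mono_of_nonneg (Filter.Eventually.of_forall fun t => h0 _) ?_
        (Filter.Eventually.of_forall fun t => hle _)
      refine Integrable.const_mul ?_ _
      refine integrable_of_measurable_of_abs_le (b := 1 * (√(u ⬝ᵥ u)) ^ 2)
        (((hσm.inv).mul ((hdot u).pow_const 2)).comp (measurable_pi_apply h)) fun t => ?_
      rw [abs_mul, abs_pow]
      gcongr
      · rw [abs_of_nonneg (hinv0 _)]; exact hinv1 _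
      · exact hdotb u _
    · simp only [hzero hh, nextVal]
      simp only [integral_zero, sub_zero, dite_eq_ite, ite_self, mul_zero]
      simp only [ne_eq, OfNat.ofNat_ne_zero, not_false_eq_true, zero_pow, integral_zero]
      exact mul_nonneg hv.le (integral_nonneg fun t => mul_nonneg (hinv0 _) (sq_nonneg _))

end Probability
end RidgeEvent
end OfflineRL

namespace OfflineRL

/-! ### Failure probability when weights and target depend on other trajectories. -/

section FailureEvent

variable {S : Type u} {A : Type v} {H K d : ℕ} [MeasurableSpace S] [MeasurableSpace A]
  {M : MDP S A} {φ : S × A → Fin d → ℝ}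

/-- The trajectories of dataset `i` with index in `T`, among all `4 K` trajectories. -/
def fresh (i : Fin 4) (T : Finset (Fin K)) : Finset (Fin 4 × Fin K) :=
  T.map ⟨fun τ => (i, τ), fun _ _ h => (Prod.mk.inj h).2⟩

theorem mem_fresh {i : Fin 4} {T : Finset (Fin K)} {p : Fin 4 × Fin K} :
    p ∈ fresh i T ↔ p.1 = i ∧ p.2 ∈ T := by
  simp only [fresh, Finset.mem_map, Prod.ext_iff]
  constructor
  · rintro ⟨τ, hτ, rfl, rfl⟩; exact ⟨rfl, hτ⟩
  · rintro ⟨rfl, h⟩; exact ⟨p.2, h, rfl, rfl⟩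

theorem regressionGood_congr {t t' : Fin K → Fin H → S × A} {T : Finset (Fin K)}
    (ht : ∀ τ ∈ T, t τ = t' τ) {σ : S × A → ℝ} {V : S → ℝ} {h : Fin H} {κ B : ℝ} :
    RegressionGood M φ t T σ V h κ B ↔ RegressionGood M φ t' T σ V h κ B := by
  refine forall_congr' fun u => ?_
  have e1 : ∑ τ ∈ T, (σ (t τ h))⁻¹ * (u ⬝ᵥ φ (t τ h)) ^ 2
      = ∑ τ ∈ T, (σ (t' τ h))⁻¹ * (u ⬝ᵥ φ (t' τ h)) ^ 2 :=
    Finset.sum_congr rfl fun τ hτ => by rw [ht τ hτ]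
  have e2 : ∑ τ ∈ T, (σ (t τ h))⁻¹ * (u ⬝ᵥ φ (t τ h)) *
        (nextVal V h (t τ) - ∫ y, V y ∂(M.P h (t τ h)))
      = ∑ τ ∈ T, (σ (t' τ h))⁻¹ * (u ⬝ᵥ φ (t' τ h)) *
        (nextVal V h (t' τ) - ∫ y, V y ∂(M.P h (t' τ h))) :=
    Finset.sum_congr rfl fun τ hτ => by rw [ht τ hτ]
  rw [e1, e2]

/-- Both inequalities are closed conditions on u, so countably many directions suffice. This makes
the event measurable. -/
theorem regressionGood_iff_dense (t : Fin K → Fin H → S × A) (T : Finset (Fin K))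
    (σ : S × A → ℝ) (V : S → ℝ) (h : Fin H) (κ B : ℝ) :
    RegressionGood M φ t T σ V h κ B ↔ ∀ n : ℕ,
      (fun u : Fin d → ℝ =>
        T.card * (κ * (u ⬝ᵥ u)) / 2 ≤ ∑ τ ∈ T, (σ (t τ h))⁻¹ * (u ⬝ᵥ φ (t τ h)) ^ 2 ∧
        (∑ τ ∈ T, (σ (t τ h))⁻¹ * (u ⬝ᵥ φ (t τ h)) *
            (nextVal V h (t τ) - ∫ y, V y ∂(M.P h (t τ h)))) ^ 2
          ≤ B * ∑ τ ∈ T, (σ (t τ h))⁻¹ * (u ⬝ᵥ φ (t τ h)) ^ 2)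
        (TopologicalSpace.denseSeq (Fin d → ℝ) n) := by
  refine ⟨fun hg n => hg _, fun hn u => ?_⟩
  refine (TopologicalSpace.denseRange_denseSeq (Fin d → ℝ)).induction_on u ?_ hn
  unfold dotProduct
  refine IsClosed.and (isClosed_le ?_ ?_) (isClosed_le ?_ ?_)
  all_goals fun_prop

theorem measurableSet_regressionGood {α : Type*} [MeasurableSpace α] (hφ : Measurable φ)
    {σ : α → S × A → ℝ} {V : α → S → ℝ} {t : α → Fin K → Fin H → S × A}
    (hσ : Measurable (Function.uncurry σ)) (hV : Measurable (Function.uncurry V))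
    (ht : Measurable t) (T : Finset (Fin K)) (h : Fin H) (κ B : ℝ) :
    MeasurableSet {p | RegressionGood M φ (t p) T (σ p) (V p) h κ B} := by
  simp_rw [regressionGood_iff_dense]
  have hz : ∀ τ, Measurable fun p => t p τ h := fun τ =>
    (measurable_pi_apply h).comp ((measurable_pi_apply τ).comp ht)
  have hσz : ∀ τ, Measurable fun p => (σ p (t p τ h))⁻¹ := fun τ =>
    (hσ.comp (measurable_id.prodMk (hz τ))).inv
  have hdot : ∀ (u : Fin d → ℝ) τ, Measurable fun p => u ⬝ᵥ φ (t p τ h) := fun u τ =>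
    (measurable_dotProduct_left hφ u).comp (hz τ)
  have hnoise : ∀ τ, Measurable fun p =>
      nextVal (V p) h (t p τ) - ∫ y, V p y ∂(M.P h (t p τ h)) := fun τ =>
    (measurable_nextVal hV h ((measurable_pi_apply τ).comp ht)).sub
      ((measurable_integral_next M hV h).comp (measurable_id.prodMk (hz τ)))
  have hq : ∀ u : Fin d → ℝ, Measurable fun p =>
      ∑ τ ∈ T, (σ p (t p τ h))⁻¹ * (u ⬝ᵥ φ (t p τ h)) ^ 2 := fun u =>
    Finset.measurable_sum _ fun τ _ => (hσz τ).mul ((hdot u τ).pow_const 2)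
  rw [Set.ofPred_forall]
  refine MeasurableSet.iInter fun n => ?_
  rw [Set.ofPred_and]
  refine MeasurableSet.inter (measurableSet_le measurable_const (hq _)) (measurableSet_le ?_ ?_)
  · exact (Finset.measurable_sum _ fun τ _ => ((hσz τ).mul (hdot _ τ)).mul (hnoise τ)).pow_const 2
  · exact (hq _).const_mul B

/-- The regression of dataset `i` over the trajectories in `T` fails with small probability when
its weights and its target depend on the other trajectories only. -/
theorem regression_failure_le (hlin : IsLinear M H φ) (b : Policy S A) (ρ : Measure S)
    [IsProbabilityMeasure ρ] (i : Fin 4) (T : Finset (Fin K))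
    {σ : (Fin 4 × Fin K → Fin H → S × A) → S × A → ℝ}
    {V : (Fin 4 × Fin K → Fin H → S × A) → S → ℝ}
    {h : Fin H} {κ m B v L : ℝ} (hκ : κ = coverage M H φ b ρ) (hκ0 : 0 < κ)
    (hσm : Measurable (Function.uncurry σ)) (hVm : Measurable (Function.uncurry V))
    (hσi : ∀ ω ω', σ ((fresh i T).piecewise ω' ω) = σ ω)
    (hVi : ∀ ω ω', V ((fresh i T).piecewise ω' ω) = V ω)
    (hlast : (h : ℕ) + 1 = H → ∀ ω x, V ω x = 0)
    (hv : 0 < v) (hL : 0 < L) (hLB : L * (2 * B) ^ 2 ≤ T.card * v * (κ / m))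
    (hLd : 64 * d ^ 2 * L ≤ T.card * (κ / m) ^ 2) :
    (Measure.pi fun _ : Fin 4 × Fin K => trajLaw M H b ρ)
      {ω | ((∀ z, 1 ≤ σ ω z) ∧ (∀ z, σ ω z ≤ m) ∧ (∀ x, |V ω x| ≤ B) ∧
          ∀ z, stepVar M h (V ω) z ≤ v * σ ω z) ∧
        ¬ RegressionGood M φ (fun τ => ω (i, τ)) T (σ ω) (V ω) h (κ / m) (8 * d * (v * L))}
      ≤ ENNReal.ofReal (4 * d ^ 2 * Real.exp (-L)) := by
  set bad : Set ((Fin 4 × Fin K → Fin H → S × A) × (Fin 4 × Fin K → Fin H → S × A)) :=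
    {p | ¬ RegressionGood M φ (fun τ => p.2 (i, τ)) T (σ p.1) (V p.1) h (κ / m)
      (8 * d * (v * L))} with hbad
  have hbadm : MeasurableSet bad := by
    refine MeasurableSet.compl (measurableSet_regressionGood hlin.measurable_feature
      (α := (Fin 4 × Fin K → Fin H → S × A) × (Fin 4 × Fin K → Fin H → S × A))
      (σ := fun p => σ p.1) (V := fun p => V p.1) (t := fun p τ => p.2 (i, τ)) ?_ ?_ ?_ _ _ _ _)
    · exact hσm.comp ((measurable_fst.comp measurable_fst).prodMk measurable_snd)
    · exact hVm.comp ((measurable_fst.comp measurable_fst).prodMk measurable_snd)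
    · exact measurable_pi_lambda _ fun τ => (measurable_pi_apply _).comp measurable_snd
  refine pi_failure_le_of_resampling (trajLaw M H b ρ) (fresh i T) bad hbadm _ ?_ ?_ ?_
  · intro ω ω₁ ω'
    simp only [hbad, Set.mem_ofPred_eq, hσi, hVi]
  · intro ω ω₁ ω'
    have e : ∀ τ ∈ T, (fresh i T).piecewise ω' ω₁ (i, τ) = ω' (i, τ) := fun τ hτ =>
      Finset.piecewise_eq_of_mem _ _ _ (mem_fresh.2 ⟨rfl, hτ⟩)
    exact not_congr (regressionGood_congr e)
  · rintro ω ⟨h1, h2, h3, h4⟩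
    have hc : (fresh i T).card = T.card := Finset.card_map _
    have := pi_regression_failure_le_of_fixed hlin b ρ (fresh i T) (σ := σ ω) (V := V ω) (h := h)
      hκ hκ0 (hσm.comp (measurable_const.prodMk measurable_id))
      (hVm.comp (measurable_const.prodMk measurable_id)) h1 h2 h3 h4 (fun hh => hlast hh ω) hv hL
      (by rwa [hc]) (by rwa [hc])
    rw [hc] at this
    simp only [fresh, Finset.sum_map] at this
    rw [← ofReal_measureReal]
    exact ENNReal.ofReal_le_ofReal this

end FailureEvent
end OfflineRL

namespace OfflineRL

/-! ### Backward value iteration -/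

section Backward

variable {S : Type u} {A : Type v} {H : ℕ}

theorem backward_of_lt (F : Fin H → (S → ℝ) → S × A → ℝ) {h : ℕ} (hh : h < H) (x : S) :
    backward F h x = ⨆ a, F ⟨h, hh⟩ (backward F (h + 1)) (x, a) := by
  rw [backward, dif_pos hh]

theorem backward_of_le (F : Fin H → (S → ℝ) → S × A → ℝ) {h : ℕ} (hh : H ≤ h) :
    backward F h = fun _ => 0 := by
  rw [backward, dif_neg (not_lt.2 hh)]

theorem backward_congr {F F' : Fin H → (S → ℝ) → S × A → ℝ} (n : ℕ) :
    ∀ h, H - h = n → (∀ k : Fin H, h ≤ k → ∀ V, F k V = F' k V) →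
      backward F h = backward F' h := by
  induction n with
  | zero =>
    intro h hn _
    rw [backward_of_le F (by omega), backward_of_le F' (by omega)]
  | succ n ih =>
    intro h hn hF
    have hh : h < H := by omega
    ext x
    rw [backward_of_lt F hh, backward_of_lt F' hh,
      ih (h + 1) (by omega) fun k hk => hF k (by omega), hF ⟨h, hh⟩ le_rfl]

theorem clip_nonneg (m y : ℝ) : 0 ≤ clip m y := le_max_left _ _

theorem clip_le {m : ℝ} (hm : 0 ≤ m) (y : ℝ) : clip m y ≤ m := max_le hm (min_le_left _ _)

theorem measurable_clip (m : ℝ) : Measurable (clip m) := by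
  unfold clip; fun_prop

theorem backward_mem [Nonempty A] {F : Fin H → (S → ℝ) → S × A → ℝ}
    (hF : ∀ (h : Fin H) V z, F h V z ∈ Set.Icc (0 : ℝ) ((H : ℝ) - (h : ℕ))) (h : ℕ) (x : S) :
    backward F h x ∈ Set.Icc (0 : ℝ) ((H - h : ℕ) : ℝ) := by
  by_cases hh : h < H
  · rw [backward_of_lt F hh, Nat.cast_sub hh.le]
    exact ⟨Real.iSup_nonneg fun a => (hF _ _ _).1, ciSup_le fun a => (hF _ _ _).2⟩
  · rw [backward_of_le F (not_lt.1 hh)]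
    exact ⟨le_rfl, by positivity⟩

theorem bddAbove_backward {F : Fin H → (S → ℝ) → S × A → ℝ}
    (hF : ∀ (h : Fin H) V z, F h V z ∈ Set.Icc (0 : ℝ) ((H : ℝ) - (h : ℕ))) (h : Fin H) (V : S → ℝ) (x : S) :
    BddAbove (Set.range fun a => F h V (x, a)) :=
  ⟨(H : ℝ) - (h : ℕ), by rintro _ ⟨a, rfl⟩; exact (hF _ _ _).2⟩

/-- Countability of A keeps the supremum over actions measurable, jointly in the data and the state.
-/
theorem measurable_backward [MeasurableSpace S] [MeasurableSpace A] [Countable A]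
    {α : Type*} [MeasurableSpace α] {F : α → Fin H → (S → ℝ) → S × A → ℝ}
    (hF : ∀ (h : Fin H) (V : α → S → ℝ), Measurable (Function.uncurry V) →
      Measurable fun p : α × (S × A) => F p.1 h (V p.1) p.2) (n : ℕ) :
    ∀ h, H - h = n → Measurable (Function.uncurry fun p => backward (F p) h) := by
  induction n with
  | zero =>
    intro h hn
    simp only [backward_of_le _ (show H ≤ h by omega)]
    exact measurable_const
  | succ n ih =>
    intro h hn
    have hh : h < H := by omega
    have e : (Function.uncurry fun p => backward (F p) h)
        = fun q : α × S => ⨆ a, F q.1 ⟨h, hh⟩ (backward (F q.1) (h + 1)) (q.2, a) := by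
      ext ⟨p, x⟩
      exact backward_of_lt _ hh x
    rw [e]
    refine Measurable.iSup fun a => ?_
    exact (hF ⟨h, hh⟩ _ (ih (h + 1) (by omega))).comp
      (measurable_fst.prodMk (measurable_snd.prodMk measurable_const))

end Backward

/-! ### Measurability of the estimates in the data -/

section Measurability

variable {S : Type u} {A : Type v} {H K d : ℕ} [MeasurableSpace S] [MeasurableSpace A]
  {M : MDP S A} {φ : S × A → Fin d → ℝ} {α : Type*} [MeasurableSpace α]

theorem measurable_det {f : α → Matrix (Fin d) (Fin d) ℝ}
    (hf : ∀ i j, Measurable fun p => f p i j) : Measurable fun p => (f p).det := by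
  simp_rw [det_apply]
  exact Finset.measurable_sum _ fun σ _ =>
    (Finset.measurable_prod _ fun i _ => hf _ _).const_smul (Equiv.Perm.sign σ)

/-- The entries of the inverse are cofactors divided by the determinant. With the convention 0⁻¹ = 0
this holds at singular matrices too, so no case distinction arises. -/
theorem measurable_inv_apply {f : α → Matrix (Fin d) (Fin d) ℝ}
    (hf : ∀ i j, Measurable fun p => f p i j) (i j : Fin d) :
    Measurable fun p => (f p)⁻¹ i j := by
  simp_rw [inv_def, Ring.inverse_eq_inv', Matrix.smul_apply, adjugate_apply, smul_eq_mul]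
  refine (measurable_det hf).inv.mul (measurable_det fun k l => ?_)
  by_cases hk : k = j
  · subst hk; simp only [updateRow_self]; exact measurable_const
  · simp only [updateRow_ne hk]; exact hf k l

variable {t : α → Fin K → Fin H → S × A} {σ : α → S × A → ℝ} {y : α → Fin K → ℝ}

theorem measurable_ridgeMatrix_apply (hφ : Measurable φ) (ht : Measurable t)
    (hσ : Measurable (Function.uncurry σ)) (lam : ℝ) (T : Finset (Fin K)) (h : Fin H)
    (i j : Fin d) :
    Measurable fun p => ridgeMatrix φ lam (observe M (t p)) T (σ p) h i j := by
  have hz : ∀ τ, Measurable fun p => t p τ h := fun τ =>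
    (measurable_pi_apply h).comp ((measurable_pi_apply τ).comp ht)
  have hc : ∀ τ i, Measurable fun p => φ (t p τ h) i := fun τ i =>
    (measurable_pi_apply i).comp (hφ.comp (hz τ))
  simp only [ridgeMatrix, Matrix.add_apply, Matrix.sum_apply, Matrix.smul_apply, vecMulVec_apply,
    smul_eq_mul, observe]
  refine Measurable.add (Finset.measurable_sum _ fun τ _ => ?_) measurable_const
  exact (hσ.comp (measurable_id.prodMk (hz τ))).inv.mul ((hc τ i).mul (hc τ j))

theorem measurable_dot_ridge (hφ : Measurable φ) (ht : Measurable t)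
    (hσ : Measurable (Function.uncurry σ)) (hy : ∀ τ, Measurable fun p => y p τ)
    (lam : ℝ) (T : Finset (Fin K)) (h : Fin H) :
    Measurable fun p : α × (S × A) =>
      φ p.2 ⬝ᵥ ridge φ lam (observe M (t p.1)) T (σ p.1) h (y p.1) := by
  have hz : ∀ τ, Measurable fun p => t p τ h := fun τ =>
    (measurable_pi_apply h).comp ((measurable_pi_apply τ).comp ht)
  have hr : ∀ i, Measurable fun p => ridge φ lam (observe M (t p)) T (σ p) h (y p) i := fun i => by
    simp only [ridge, mulVec, dotProduct, Finset.sum_apply, Pi.smul_apply, smul_eq_mul, observe]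
    refine Finset.measurable_sum _ fun j _ => Measurable.mul ?_
      (Finset.measurable_sum _ fun τ _ => ?_)
    · exact measurable_inv_apply (measurable_ridgeMatrix_apply hφ ht hσ lam T h) i j
    · exact ((hy τ).div (hσ.comp (measurable_id.prodMk (hz τ)))).mul
        ((measurable_pi_apply j).comp (hφ.comp (hz τ)))
  unfold dotProduct
  exact Finset.measurable_sum _ fun i _ =>
    ((measurable_pi_apply i).comp (hφ.comp measurable_snd)).mul ((hr i).comp measurable_fst)

theorem measurable_wnorm_ridge (hφ : Measurable φ) (ht : Measurable t)
    (hσ : Measurable (Function.uncurry σ)) (lam : ℝ) (T : Finset (Fin K)) (h : Fin H) :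
    Measurable fun p : α × (S × A) =>
      wnorm (ridgeMatrix φ lam (observe M (t p.1)) T (σ p.1) h)⁻¹ (φ p.2) := by
  have hc : ∀ i, Measurable fun p : α × (S × A) => φ p.2 i := fun i =>
    (measurable_pi_apply i).comp (hφ.comp measurable_snd)
  simp only [wnorm, dotProduct, mulVec]
  refine Measurable.sqrt (Finset.measurable_sum _ fun i _ => (hc i).mul
    (Finset.measurable_sum _ fun j _ => Measurable.mul ?_ (hc j)))
  exact (measurable_inv_apply (measurable_ridgeMatrix_apply hφ ht hσ lam T h) i j).comp
    measurable_fst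

theorem measurable_wnorm_inv_feature (hφ : Measurable φ) (Λ : Matrix (Fin d) (Fin d) ℝ) :
    Measurable fun z => wnorm Λ (φ z) := by
  simp only [wnorm, dotProduct, mulVec]
  fun_prop

variable (hφ : Measurable φ) (ht : Measurable t)
include hφ ht

theorem measurable_speviV [Countable A] (lam β : ℝ) (s : Fin K → Fin H) (h : ℕ) :
    Measurable (Function.uncurry fun p => speviV φ lam β (observe M (t p)) s h) := by
  unfold speviV
  refine measurable_backward (fun k V hV => ?_) _ h rfl
  have hy : ∀ τ, Measurable fun p =>
      (observe M (t p)).rew τ k + (observe M (t p)).next (V p) k τ := fun τ => by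
    refine Measurable.add ?_ ?_
    · exact (M.measurable_r k).comp
        ((measurable_pi_apply k).comp ((measurable_pi_apply τ).comp ht))
    · exact measurable_nextVal hV k ((measurable_pi_apply τ).comp ht)
  have hr := measurable_dot_ridge (M := M) (t := t) (σ := fun _ _ => 1) hφ ht measurable_const hy
    lam (Finset.univ.filter fun τ => s τ = k) k
  have hw := measurable_wnorm_ridge (M := M) (t := t) (σ := fun _ _ => 1) hφ ht measurable_const
    lam (Finset.univ.filter fun τ => s τ = k) k
  exact (measurable_clip _).comp (hr.sub (hw.const_mul β))

theorem measurable_varEst {V : α → S → ℝ} (hV : Measurable (Function.uncurry V)) (lam : ℝ)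
    (h : Fin H) :
    Measurable (Function.uncurry fun p => varEst φ lam (observe M (t p)) h (V p)) := by
  have hn : ∀ τ, Measurable fun p => nextVal (V p) h (t p τ) := fun τ =>
    measurable_nextVal hV h ((measurable_pi_apply τ).comp ht)
  unfold varEst
  refine measurable_const.max (Measurable.sub ?_ (Measurable.pow_const ?_ 2))
  · exact (measurable_clip _).comp (measurable_dot_ridge
      (y := fun p τ => (observe M (t p)).next (V p) h τ ^ 2) (σ := fun _ _ => 1) hφ ht
      measurable_const (fun τ => (hn τ).pow_const 2) _ _ _)
  · exact (measurable_clip _).comp (measurable_dot_ridge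
      (y := fun p τ => (observe M (t p)).next (V p) h τ) (σ := fun _ _ => 1) hφ ht
      measurable_const hn _ _ _)

end Measurability

/-! ### SPEVI+ as a function of the trajectories. -/

section SpeviPlus

variable {S : Type u} {A : Type v} {H K d : ℕ} [MeasurableSpace S] [MeasurableSpace A]
  (M : MDP S A) (φ : S × A → Fin d → ℝ) (sref s1 : Fin K → Fin H) (lam κ βref β0 b1 : ℝ)

/-- SPEVI+ as a function of all `4 K` trajectories. -/
noncomputable def runInput (ω : Fin 4 × Fin K → Fin H → S × A) : Input S A H K :=
  mkInput M (fun i τ => ω (i, τ)) sref s1 lam κ βref β0 b1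

variable {φ}

theorem measurable_dataset (i : Fin 4) :
    Measurable fun (ω : Fin 4 × Fin K → Fin H → S × A) τ => ω (i, τ) :=
  measurable_pi_lambda _ fun _ => measurable_pi_apply _

theorem measurable_Vref [Countable A] (hφ : Measurable φ) (h : ℕ) :
    Measurable (Function.uncurry fun ω =>
      (runInput M sref s1 lam κ βref β0 b1 ω).Vref φ h) :=
  measurable_speviV hφ (measurable_dataset 0) lam βref sref h

theorem measurable_var [Countable A] (hφ : Measurable φ) (h : Fin H) :
    Measurable (Function.uncurry fun ω =>
      (runInput M sref s1 lam κ βref β0 b1 ω).var φ h) :=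
  measurable_varEst hφ (measurable_dataset 2)
    (measurable_Vref M sref s1 lam κ βref β0 b1 hφ (h + 1)) lam h

theorem measurable_Vhat [Countable A] (hφ : Measurable φ) (h : ℕ) :
    Measurable (Function.uncurry fun ω =>
      (runInput M sref s1 lam κ βref β0 b1 ω).Vhat φ h) := by
  unfold Input.Vhat
  refine measurable_backward (fun k V hV => ?_) _ h rfl
  have hVref := measurable_Vref M sref s1 lam κ βref β0 b1 hφ (k + 1)
  have hvar := measurable_var M sref s1 lam κ βref β0 b1 hφ k
  have ht := fun i => measurable_dataset (S := S) (A := A) (H := H) (K := K) i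
  have hy : ∀ τ, Measurable fun ω : Fin 4 × Fin K → Fin H → S × A =>
      (observe M fun τ => ω (1, τ)).rew τ k + (observe M fun τ => ω (1, τ)).next
        ((runInput M sref s1 lam κ βref β0 b1 ω).Vref φ (k + 1)) k τ := fun τ => by
    refine Measurable.add ?_ ?_
    · exact (M.measurable_r k).comp
        ((measurable_pi_apply k).comp ((measurable_pi_apply τ).comp (ht 1)))
    · exact measurable_nextVal hVref k ((measurable_pi_apply τ).comp (ht 1))
  have hy1 : ∀ τ, Measurable fun ω : Fin 4 × Fin K → Fin H → S × A =>
      (observe M fun τ => ω (3, τ)).next (fun x => V ω x -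
        (runInput M sref s1 lam κ βref β0 b1 ω).Vref φ (k + 1) x) k τ := fun τ =>
    measurable_nextVal (V := fun ω x => V ω x -
      (runInput M sref s1 lam κ βref β0 b1 ω).Vref φ (k + 1) x) (hV.sub hVref) k
      ((measurable_pi_apply τ).comp (ht 3))
  have hr0 := measurable_dot_ridge (M := M) hφ (ht 1) hvar hy lam Finset.univ k
  have hw0 := measurable_wnorm_ridge (M := M) hφ (ht 1) hvar lam Finset.univ k
  have hr1 := measurable_dot_ridge (M := M) (σ := fun _ _ => 1) hφ (ht 3) measurable_const hy1 lam
    (Finset.univ.filter fun τ => s1 τ = k) k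
  exact (measurable_clip _).comp (((hr0.sub ((hw0.const_mul β0).add_const
    (4 * lam * (H : ℝ) ^ 3 * √(d : ℝ) / (K * κ)))).add hr1).sub_const b1)

/-! ### Which trajectories the estimates depend on -/

theorem ridgeMatrix_congr {S A : Type*} {φ : S × A → Fin d → ℝ} {D D' : Dataset S A H K}
    {T : Finset (Fin K)} {h : Fin H} (hD : ∀ τ ∈ T, D.pair τ h = D'.pair τ h) (lam : ℝ)
    (σ : S × A → ℝ) : ridgeMatrix φ lam D T σ h = ridgeMatrix φ lam D' T σ h := by
  unfold ridgeMatrix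
  rw [Finset.sum_congr rfl fun τ hτ => by rw [hD τ hτ]]

theorem ridge_congr {S A : Type*} {φ : S × A → Fin d → ℝ} {D D' : Dataset S A H K}
    {T : Finset (Fin K)} {h : Fin H} (hD : ∀ τ ∈ T, D.pair τ h = D'.pair τ h) (lam : ℝ)
    (σ : S × A → ℝ) {y y' : Fin K → ℝ} (hy : ∀ τ ∈ T, y τ = y' τ) :
    ridge φ lam D T σ h y = ridge φ lam D' T σ h y' := by
  unfold ridge
  rw [ridgeMatrix_congr hD]
  congr 1
  exact Finset.sum_congr rfl fun τ hτ => by rw [hD τ hτ, hy τ hτ]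

/-- The value at step h is built from steps h, …, H - 1, hence from the parts with these indices
only. Part h is therefore fresh for the regression that targets the value at step h + 1. -/
theorem speviV_congr {t t' : Fin K → Fin H → S × A} {s : Fin K → Fin H} (h : ℕ)
    (ht : ∀ τ, h ≤ s τ → t τ = t' τ) (lam β : ℝ) :
    speviV φ lam β (observe M t) s h = speviV φ lam β (observe M t') s h := by
  unfold speviV
  refine backward_congr _ h rfl fun k hk V => funext fun z => ?_
  have hT : ∀ τ ∈ Finset.univ.filter (fun τ => s τ = k), t τ = t' τ := fun τ hτ =>
    ht τ (by rw [(Finset.mem_filter.1 hτ).2]; exact hk)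
  have hp : ∀ τ ∈ Finset.univ.filter (fun τ => s τ = k),
      (observe M t).pair τ k = (observe M t').pair τ k := fun τ hτ => congrFun (hT τ hτ) k
  unfold speviQ
  rw [ridgeMatrix_congr hp, ridge_congr hp]
  intro τ hτ
  simp only [observe, Dataset.next, hT τ hτ]

theorem Vref_congr {ω ω' : Fin 4 × Fin K → Fin H → S × A} (h : ℕ)
    (hω : ∀ τ, h ≤ sref τ → ω (0, τ) = ω' (0, τ)) :
    (runInput M sref s1 lam κ βref β0 b1 ω).Vref φ h
      = (runInput M sref s1 lam κ βref β0 b1 ω').Vref φ h :=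
  speviV_congr M h hω lam βref

theorem var_congr {ω ω' : Fin 4 × Fin K → Fin H → S × A} (h : Fin H)
    (h0 : ∀ τ, ω (0, τ) = ω' (0, τ)) (h2 : ∀ τ, ω (2, τ) = ω' (2, τ)) :
    (runInput M sref s1 lam κ βref β0 b1 ω).var φ h
      = (runInput M sref s1 lam κ βref β0 b1 ω').var φ h := by
  unfold Input.var
  rw [Vref_congr M sref s1 lam κ βref β0 b1 (h + 1) fun τ _ => h0 τ]
  simp only [runInput, mkInput, h2]

/-- The analogous freshness for the division of `D1`: the other three datasets are fixed, and part h
is untouched by the value at step h + 1. -/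
theorem Vhat_congr {ω ω' : Fin 4 × Fin K → Fin H → S × A} (h : ℕ)
    (h0 : ∀ τ, ω (0, τ) = ω' (0, τ)) (h1 : ∀ τ, ω (1, τ) = ω' (1, τ))
    (h2 : ∀ τ, ω (2, τ) = ω' (2, τ)) (h3 : ∀ τ, h ≤ s1 τ → ω (3, τ) = ω' (3, τ)) :
    (runInput M sref s1 lam κ βref β0 b1 ω).Vhat φ h
      = (runInput M sref s1 lam κ βref β0 b1 ω').Vhat φ h := by
  unfold Input.Vhat
  refine backward_congr _ h rfl fun k hk V => funext fun z => ?_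
  have hVref := Vref_congr M (φ := φ) sref s1 lam κ βref β0 b1 (k + 1) fun τ _ => h0 τ
  have hvar := var_congr M (φ := φ) sref s1 lam κ βref β0 b1 k h0 h2
  have hT : ∀ τ ∈ Finset.univ.filter (fun τ => s1 τ = k), ω (3, τ) = ω' (3, τ) := fun τ hτ =>
    h3 τ (by rw [(Finset.mem_filter.1 hτ).2]; exact hk)
  have e0 : (runInput M sref s1 lam κ βref β0 b1 ω).w0 φ k
      = (runInput M sref s1 lam κ βref β0 b1 ω').w0 φ k := by
    unfold Input.w0
    rw [hVref, hvar]
    simp only [runInput, mkInput, h1]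
  have eb : (runInput M sref s1 lam κ βref β0 b1 ω).b0 φ k z
      = (runInput M sref s1 lam κ βref β0 b1 ω').b0 φ k z := by
    unfold Input.b0 Input.Zhat
    rw [hvar]
    simp only [runInput, mkInput, h1]
  have e1 : (runInput M sref s1 lam κ βref β0 b1 ω).w1 φ k V
      = (runInput M sref s1 lam κ βref β0 b1 ω').w1 φ k V := by
    unfold Input.w1
    rw [hVref]
    simp only [runInput, mkInput]
    refine ridge_congr (fun τ hτ => congrFun (hT τ hτ) k) _ _ fun τ hτ => ?_
    simp only [observe, Dataset.next, hT τ hτ]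
  unfold Input.stepQ
  rw [e0, eb, e1]
  rfl

end SpeviPlus
end OfflineRL

namespace OfflineRL

/-! ### Regression errors in terms of the coverage -/

section Errors

variable {S : Type u} {A : Type v} {H K d : ℕ} [MeasurableSpace S] [MeasurableSpace A]
  {M : MDP S A} {φ : S × A → Fin d → ℝ}

/-- Replaces the bias lam |w| by a sample quantity: lam ≤ √κ √κ, √κ |w| ≤ Bw by coverage, and the
remaining √κ cancels against the width, leaving Bw √(2 m / n). -/
theorem RegressionGood.error_le (hlin : IsLinear M H φ) {b : Policy S A} {ρ : Measure S}
    [IsProbabilityMeasure ρ] {κ : ℝ} (hκ : κ = coverage M H φ b ρ) (hκ0 : 0 < κ)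
    {t : Fin K → Fin H → S × A} {T : Finset (Fin K)}
    {σ : S × A → ℝ} {V : S → ℝ} {h : Fin H} {B lam m Bw c : ℝ} (hm : 0 < m)
    (hgood : RegressionGood M φ t T σ V h (κ / m) B)
    (hσ : ∀ z, 1 ≤ σ z) (hlam : 0 < lam) (hlamκ : lam < κ) (hT : 0 < T.card) (hB : 0 ≤ B)
    (hVm : Measurable V) (hVb : ∀ x, |V x| ≤ c)
    {f : S × A → ℝ} (hf : ∃ θ : Fin d → ℝ, ∀ z, f z = φ z ⬝ᵥ θ)
    (hBw : ∀ z, |f z + ∫ y, V y ∂(M.P h z)| ≤ Bw)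
    (y : Fin K → ℝ) (hy : ∀ τ, y τ = f (t τ h) + nextVal V h (t τ)) (z : S × A) :
    |φ z ⬝ᵥ ridge φ lam (observe M t) T σ h y - (f z + ∫ y, V y ∂(M.P h z))|
      ≤ (√B + Bw * √(2 * m / T.card)) *
        wnorm (ridgeMatrix φ lam (observe M t) T σ h)⁻¹ (φ z) ∧
    wnorm (ridgeMatrix φ lam (observe M t) T σ h)⁻¹ (φ z) ≤ √(2 * m / (T.card * κ)) := by
  obtain ⟨θ, hθ⟩ := hf
  obtain ⟨w₀, hw₀⟩ := hlin.exists_coeff h.2 hVm hVb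
  have hw : ∀ z, f z + ∫ y, V y ∂(M.P h z) = φ z ⬝ᵥ (θ + w₀) := fun z => by
    rw [dotProduct_add, hθ, hw₀]
  have hn : (0 : ℝ) < T.card := by exact_mod_cast hT
  have hBw0 : 0 ≤ Bw := (abs_nonneg _).trans (hBw z)
  obtain ⟨h1, h2⟩ := hgood.ridge_error hlin.feature_dot_le hσ hlam (by positivity) hT hB hw y hy z
  have hww : κ * ((θ + w₀) ⬝ᵥ (θ + w₀)) ≤ Bw ^ 2 := by
    rw [hκ]
    exact coverage_mul_coeff_le hlin b ρ h.pos fun z => by rw [← hw]; exact hBw z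
  have e : 2 / (T.card * (κ / m)) = 2 * m / (T.card * κ) := by field_simp
  rw [e] at h1 h2
  rw [hw]
  refine ⟨h1.trans ?_, h2⟩
  refine mul_le_mul_of_nonneg_right (add_le_add le_rfl ?_) (wnorm_nonneg _ _)
  have hsq : √(2 * m / (T.card * κ)) * √κ = √(2 * m / T.card) := by
    rw [← Real.sqrt_mul (by positivity)]; congr 1; field_simp
  have hw1 : √κ * √((θ + w₀) ⬝ᵥ (θ + w₀)) ≤ Bw := by
    rw [← Real.sqrt_mul hκ0.le]
    exact Real.sqrt_le_iff.2 ⟨hBw0, hww⟩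
  calc lam * √((θ + w₀) ⬝ᵥ (θ + w₀)) * √(2 * m / (T.card * κ))
      ≤ (√κ * √κ) * √((θ + w₀) ⬝ᵥ (θ + w₀)) * √(2 * m / (T.card * κ)) := by
        rw [Real.mul_self_sqrt hκ0.le]
        gcongr
    _ = (√κ * √((θ + w₀) ⬝ᵥ (θ + w₀))) * √(2 * m / T.card) := by rw [← hsq]; ring
    _ ≤ _ := by gcongr

theorem abs_clip_sub_le {m y x : ℝ} (hx : x ∈ Set.Icc 0 m) : |clip m y - x| ≤ |y - x| := by
  obtain ⟨h0, h1⟩ := hx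
  unfold clip
  rcases le_total y 0 with h | h
  · rw [max_eq_left ((min_le_right _ _).trans h)]
    rw [abs_of_nonpos (by linarith), abs_of_nonpos (by linarith)]; linarith
  · rcases le_total m y with h' | h'
    · rw [min_eq_left h', max_eq_right (by linarith), abs_of_nonneg (by linarith),
        abs_of_nonneg (by linarith)]
      linarith
    · rw [min_eq_right h', max_eq_right h]

/-- A pessimistic estimate of a number in `[0, m]` stays pessimistic when it is truncated. -/
theorem clip_pessimistic {m x y g : ℝ} (hx : x ∈ Set.Icc 0 m) (h1 : y ≤ x) (h2 : x - g ≤ y) :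
    clip m y ≤ x ∧ x - g ≤ clip m y := by
  obtain ⟨h0, hm⟩ := hx
  unfold clip
  refine ⟨max_le h0 ((min_le_right _ _).trans h1), ?_⟩
  rw [min_eq_right (h1.trans hm)]
  exact h2.trans (le_max_right _ _)

/-- One step of pessimistic value iteration. -/
theorem pessimistic_step [Nonempty A] {π : Policy S A} (hopt : IsOptimal M H π) (h : Fin H)
    {U W : S → ℝ} {Q : S × A → ℝ} {e g : ℝ} (hU : Measurable U) {c : ℝ} (hUc : ∀ x, |U x| ≤ c)
    (hU1 : ∀ x, U x ≤ optValue M H (h + 1) x) (hU2 : ∀ x, optValue M H (h + 1) x - U x ≤ e)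
    (hQ1 : ∀ z, Q z ≤ M.r h z + ∫ y, U y ∂(M.P h z))
    (hQ2 : ∀ z, M.r h z + ∫ y, U y ∂(M.P h z) - g ≤ Q z)
    (hbdd : ∀ x, BddAbove (Set.range fun a => Q (x, a))) (hW : ∀ x, W x = ⨆ a, Q (x, a)) (x : S) :
    W x ≤ optValue M H h x ∧ optValue M H h x - W x ≤ e + g := by
  have hVm : Measurable (optValue M H (h + 1)) := by
    rw [hopt.optValue_eq]; exact measurable_value M H π _
  have hVb : ∀ x, |optValue M H (h + 1) x| ≤ (H - (h + 1) : ℕ) := fun x => by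
    rw [hopt.optValue_eq, abs_of_nonneg (value_nonneg M H π _ _)]; exact value_le M H π _ _
  have hiU : ∀ z, Integrable U (M.P h z) := fun z => integrable_of_measurable_of_abs_le hU hUc
  have hiV : ∀ z, Integrable (optValue M H (h + 1)) (M.P h z) := fun z =>
    integrable_of_measurable_of_abs_le hVm hVb
  rw [hW]
  constructor
  -- Pessimism: monotonicity of the expectation, followed by the Bellman inequality for the optimal
  -- value.
  · refine ciSup_le fun a => (hQ1 _).trans (le_trans ?_ (hopt.bellman_le h.2 (x, a)))
    exact add_le_add le_rfl (integral_mono (hiU _) (hiV _) hU1)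
  · have hle : ∀ a, M.r h (x, a) + ∫ y, optValue M H (h + 1) y ∂(M.P h (x, a))
        ≤ (⨆ a, Q (x, a)) + (e + g) := fun a => by
      have h1 : ∫ y, optValue M H (h + 1) y ∂(M.P h (x, a)) ≤ ∫ y, (U y + e) ∂(M.P h (x, a)) :=
        integral_mono (hiV _) ((hiU _).add (integrable_const _)) fun y => by
          linarith [hU2 y]
      rw [integral_add (hiU _) (integrable_const _)] at h1
      simp only [integral_const, probReal_univ, one_smul] at h1
      have h2 := hQ2 (x, a)
      have h3 := le_ciSup (hbdd x) a
      linarith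
    -- Loss: the supremum over actions dominates each action, hence also the average over the
    -- actions of the optimal policy, which attains the optimal value.
    rw [hopt.step h.2 x]
    have hbell : Measurable fun a => M.r h (x, a) +
        ∫ y, optValue M H (h + 1) y ∂(M.P h (x, a)) :=
      ((M.measurable_r h).comp (by fun_prop)).add
        ((measurable_integral_kernel (M.P h) (f := fun _ y => optValue M H (h + 1) y)
          (hVm.comp measurable_snd)).comp (measurable_const.prodMk measurable_id))
    have h4 : ∫ a, (M.r h (x, a) + ∫ y, optValue M H (h + 1) y ∂(M.P h (x, a))) ∂(π.ker h x)
        ≤ ∫ _a, ((⨆ a, Q (x, a)) + (e + g)) ∂(π.ker h x) :=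
      integral_mono (integrable_of_measurable_of_abs_le hbell (b := 1 + (H - (h + 1) : ℕ))
        fun a => (abs_add_le _ _).trans (add_le_add (abs_reward_le M _ _)
          (abs_integral_le_of_abs_le hVb))) (integrable_const _) hle
    simp only [integral_const, probReal_univ, one_smul] at h4
    linarith

end Errors

/-! ### Numerical consequences of the sample size -/

section Numerics

/-- The relations between the parameters that the analysis uses. -/
structure LargeSample (H d K : ℕ) (κ lam ι : ℝ) : Prop where
  one_le_H : (1 : ℝ) ≤ H
  one_le_d : (1 : ℝ) ≤ d
  pos_κ : 0 < κ
  κ_mul_d : κ * d ≤ 1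
  pos_lam : 0 < lam
  lam_lt : lam < κ
  one_le_ι : 1 ≤ ι
  -- The powers d² and κ² are those of the covariance estimate, 64 d² L ≤ n κ². All other
  -- requirements on K are weaker consequences.
  large : 10 ^ 6 * ι ^ 2 * d ^ 2 * (H : ℝ) ^ 13 ≤ K * κ ^ 2

namespace LargeSample

variable {H d K : ℕ} {κ lam ι : ℝ} (N : LargeSample H d K κ lam ι)
include N

theorem κ_le_one : κ ≤ 1 := by
  have := N.κ_mul_d; have := N.one_le_d; have := N.pos_κ
  nlinarith

theorem pos_K : (0 : ℝ) < K := by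
  have h1 := N.one_le_H; have h2 := N.one_le_d; have h3 := N.one_le_ι
  have h4 : 0 < 10 ^ 6 * ι ^ 2 * d ^ 2 * (H : ℝ) ^ 13 := by positivity
  have h5 := h4.trans_le N.large
  have h6 : 0 < κ ^ 2 := by have := N.pos_κ; positivity
  exact (mul_pos_iff_of_pos_right h6).1 h5

theorem large_Kκ : 10 ^ 6 * ι ^ 2 * d ^ 2 * (H : ℝ) ^ 13 ≤ K * κ := by
  refine N.large.trans ?_
  have := N.pos_K; have := N.pos_κ; have := N.κ_le_one
  rw [sq, ← mul_assoc]
  exact mul_le_of_le_one_right (by positivity) N.κ_le_one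

theorem large_K : 10 ^ 6 * ι ^ 2 * d ^ 2 * (H : ℝ) ^ 13 ≤ K := by
  refine N.large_Kκ.trans ?_
  exact mul_le_of_le_one_right N.pos_K.le N.κ_le_one

/-- The basic scale of the errors: `ι √d H² √(H / (K κ)) ≤ 1 / (1000 H)`. -/
theorem scale_le : ι * √(d : ℝ) * (H : ℝ) ^ 2 * √(H / (K * κ)) * (1000 * H) ≤ 1 := by
  have h1 := N.one_le_H; have h2 := N.one_le_d; have h3 := N.one_le_ι
  have hK := N.pos_K; have hκ := N.pos_κ
  rw [← sq_le_one_iff₀ (by positivity)]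
  have e : (ι * √(d : ℝ) * (H : ℝ) ^ 2 * √(H / (K * κ)) * (1000 * H)) ^ 2
      = 10 ^ 6 * ι ^ 2 * d * (H : ℝ) ^ 7 / (K * κ) := by
    rw [mul_pow, mul_pow, mul_pow, mul_pow, Real.sq_sqrt (by positivity),
      Real.sq_sqrt (by positivity)]
    ring
  rw [e, div_le_one (by positivity)]
  refine le_trans ?_ N.large_Kκ
  have hd : (d : ℝ) ≤ d ^ 2 := by nlinarith
  have hH : (H : ℝ) ^ 7 ≤ (H : ℝ) ^ 13 := pow_le_pow_right₀ h1 (by norm_num)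
  gcongr

theorem sqrt_noise_le {B : ℝ} (hB : 0 ≤ B) :
    √(8 * d * (B ^ 2 * (3 * ι))) ≤ 5 * ι * √(d : ℝ) * B := by
  have h2 := N.one_le_d; have h3 := N.one_le_ι
  refine Real.sqrt_le_iff.2 ⟨by positivity, ?_⟩
  rw [mul_pow, mul_pow, Real.sq_sqrt (by positivity)]
  have : ι ≤ ι ^ 2 := by nlinarith
  have h5 : 0 ≤ d * B ^ 2 := by positivity
  nlinarith [mul_le_mul_of_nonneg_left this h5]

/-- 8 · 3 = 24 ≤ 5², and ι ≤ ι² allows ι in place of √ι. -/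
theorem sqrt_noise_le_two : √(8 * d * (2 * (3 * ι))) ≤ 7 * ι * √(d : ℝ) := by
  have h2 := N.one_le_d; have h3 := N.one_le_ι
  refine Real.sqrt_le_iff.2 ⟨by positivity, ?_⟩
  rw [mul_pow, Real.sq_sqrt (by positivity)]
  have : ι ≤ ι ^ 2 := by nlinarith
  nlinarith [mul_le_mul_of_nonneg_left this (show (0 : ℝ) ≤ d by linarith)]

theorem one_le_ι_mul_sqrt : 1 ≤ ι * √(d : ℝ) := by
  have : 1 ≤ √(d : ℝ) := Real.one_le_sqrt.2 N.one_le_d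
  have := N.one_le_ι
  nlinarith

theorem unweighted_coeff_le {B : ℝ} (hB : 0 ≤ B) {n : ℝ} (hn : 2 ≤ n) :
    √(8 * d * (B ^ 2 * (3 * ι))) + B * √(2 * 1 / n) ≤ 6 * ι * √(d : ℝ) * B := by
  have h1 := N.sqrt_noise_le hB
  have h2 : √(2 * 1 / n) ≤ 1 := by
    rw [Real.sqrt_le_one, mul_one]
    exact (div_le_one (by linarith)).2 hn
  have h3 : B * √(2 * 1 / n) ≤ B * (ι * √(d : ℝ)) :=
    mul_le_mul_of_nonneg_left (h2.trans N.one_le_ι_mul_sqrt) hB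
  linarith

theorem width_le {n : ℝ} (hn : 0 < n) (hKn : K ≤ 2 * H * n) :
    √(2 * 1 / (n * κ)) ≤ 2 * √(H / (K * κ)) := by
  have hK := N.pos_K; have hκ := N.pos_κ
  rw [show (2 : ℝ) = √(2 ^ 2) by rw [Real.sqrt_sq (by norm_num)], ← Real.sqrt_mul (by norm_num),
    Real.sqrt_sq (by norm_num)]
  refine Real.sqrt_le_sqrt ?_
  rw [mul_div_assoc', div_le_div_iff₀ (by positivity) (by positivity)]
  nlinarith [mul_le_mul_of_nonneg_right hKn hκ.le]

theorem two_H_le : 2 * (H : ℝ) ≤ K := by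
  have h1 := N.one_le_H; have h2 := N.one_le_d; have h3 := N.one_le_ι
  refine le_trans ?_ N.large_K
  have a : (1 : ℝ) ≤ ι ^ 2 := one_le_pow₀ h3
  have b : (1 : ℝ) ≤ (d : ℝ) ^ 2 := one_le_pow₀ h2
  have c : (H : ℝ) ≤ (H : ℝ) ^ 13 := le_self_pow₀ h1 (by norm_num)
  calc 2 * (H : ℝ) ≤ 10 ^ 6 * 1 * 1 * (H : ℝ) := by nlinarith
    _ ≤ _ := by gcongr

theorem split_large {n : ℝ} (hKn : K ≤ 2 * H * n) : 2 ≤ n := by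
  have h1 := N.one_le_H; have h2 := N.one_le_d; have h3 := N.one_le_ι
  have a : (1 : ℝ) ≤ ι ^ 2 := one_le_pow₀ h3
  have b : (1 : ℝ) ≤ (d : ℝ) ^ 2 := one_le_pow₀ h2
  have c : (H : ℝ) ≤ (H : ℝ) ^ 13 := le_self_pow₀ h1 (by norm_num)
  have e : 4 * (H : ℝ) ≤ 2 * H * n := by
    refine le_trans ?_ (N.large_K.trans hKn)
    calc 4 * (H : ℝ) ≤ 10 ^ 6 * 1 * 1 * (H : ℝ) := by nlinarith
      _ ≤ _ := by gcongr
  nlinarith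

end LargeSample

/-- Equal division gives K ≤ H (n + 1), and the rounding term H is absorbed by half of K. -/
theorem IsUniformSplit.card_ge {H K : ℕ} {s : Fin K → Fin H} (hs : IsUniformSplit s)
    (hK : 2 * (H : ℝ) ≤ K) (h : Fin H) :
    (K : ℝ) ≤ 2 * H * (Finset.univ.filter fun τ => s τ = h).card := by
  have h1 : K ≤ H * ((Finset.univ.filter fun τ => s τ = h).card + 1) := by
    calc K = ∑ k : Fin H, (Finset.univ.filter fun τ => s τ = k).card := by
          rw [← Finset.card_eq_sum_card_fiberwise (fun _ _ => Finset.mem_coe.2 (Finset.mem_univ _))]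
          simp
      _ ≤ ∑ _k : Fin H, ((Finset.univ.filter fun τ => s τ = h).card + 1) :=
          Finset.sum_le_sum fun k _ => hs k h
      _ = _ := by simp
  have h2 : (K : ℝ) ≤ H * ((Finset.univ.filter fun τ => s τ = h).card + 1) := by exact_mod_cast h1
  nlinarith

end Numerics
end OfflineRL

namespace OfflineRL

/-! ### Analysis of SPEVI+ on good data -/

section GoodData

variable {S : Type u} {A : Type v} {H K d : ℕ} [MeasurableSpace S] [MeasurableSpace A]

variable {M : MDP S A} {φ : S × A → Fin d → ℝ}

theorem speviQ_mem {S A : Type*} {φ : S × A → Fin d → ℝ} (lam β : ℝ) (D : Dataset S A H K)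
    (s : Fin K → Fin H) (h : Fin H) (V : S → ℝ) (z : S × A) :
    speviQ φ lam β D s h V z ∈ Set.Icc (0 : ℝ) ((H : ℝ) - (h : ℕ)) :=
  ⟨clip_nonneg _ _, clip_le (sub_nonneg.2 (by exact_mod_cast h.2.le)) _⟩

theorem stepQ_mem {S A : Type*} {φ : S × A → Fin d → ℝ} (I : Input S A H K) (h : Fin H)
    (V : S → ℝ) (z : S × A) : I.stepQ φ h V z ∈ Set.Icc (0 : ℝ) ((H : ℝ) - (h : ℕ)) :=
  ⟨clip_nonneg _ _, clip_le (sub_nonneg.2 (by exact_mod_cast h.2.le)) _⟩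

theorem Vref_mem {S A : Type*} [Nonempty A] {φ : S × A → Fin d → ℝ} (I : Input S A H K) (h : ℕ)
    (x : S) : I.Vref φ h x ∈ Set.Icc (0 : ℝ) ((H - h : ℕ) : ℝ) :=
  backward_mem (speviQ_mem _ _ _ _) h x

theorem Vhat_mem {S A : Type*} [Nonempty A] {φ : S × A → Fin d → ℝ} (I : Input S A H K) (h : ℕ)
    (x : S) : I.Vhat φ h x ∈ Set.Icc (0 : ℝ) ((H - h : ℕ) : ℝ) :=
  backward_mem (stepQ_mem _) h x

theorem var_one_le {S A : Type*} {φ : S × A → Fin d → ℝ} (I : Input S A H K) (h : Fin H)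
    (z : S × A) : 1 ≤ I.var φ h z := le_max_left _ _

theorem var_le {S A : Type*} {φ : S × A → Fin d → ℝ} (I : Input S A H K) (h : Fin H)
    (z : S × A) : I.var φ h z ≤ (H : ℝ) ^ 2 := by
  have hH : (1 : ℝ) ≤ H := by exact_mod_cast h.pos
  refine max_le (one_le_pow₀ hH) ?_
  exact (sub_le_self _ (sq_nonneg _)).trans (clip_le (by positivity) _)

theorem integral_mem_Icc {α : Type*} [MeasurableSpace α] {μ : Measure α} [IsProbabilityMeasure μ]
    {f : α → ℝ} (hf : Measurable f) {a b : ℝ} (h : ∀ x, f x ∈ Set.Icc a b) :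
    ∫ x, f x ∂μ ∈ Set.Icc a b := by
  have hi : Integrable f μ := integrable_of_measurable_of_abs_le hf (b := max |a| |b|) fun x =>
    abs_le_max_abs_abs (h x).1 (h x).2
  constructor
  · have := integral_mono (integrable_const a) hi fun x => (h x).1
    simpa using this
  · have := integral_mono hi (integrable_const b) fun x => (h x).2
    simpa using this

theorem bellman_mem {h : Fin H} {U : S → ℝ} (hU : Measurable U)
    (hUb : ∀ x, U x ∈ Set.Icc (0 : ℝ) ((H - (h + 1) : ℕ) : ℝ)) (z : S × A) :
    M.r h z + ∫ y, U y ∂(M.P h z) ∈ Set.Icc (0 : ℝ) ((H : ℝ) - (h : ℕ)) := by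
  have h1 := integral_mem_Icc (μ := M.P h z) hU hUb
  have h2 := M.r_mem h z
  have h3 : ((H - (h + 1) : ℕ) : ℝ) = (H : ℝ) - (h : ℕ) - 1 := by
    rw [Nat.cast_sub (by have := h.2; omega)]; push_cast; ring
  rw [h3] at h1
  exact ⟨add_nonneg h2.1 h1.1, by linarith [h2.2, h1.2]⟩

theorem abs_le_of_mem_Icc {x : ℝ} {n : ℕ} (hn : n ≤ H) (hx : x ∈ Set.Icc (0 : ℝ) (n : ℝ)) :
    |x| ≤ H := by
  rw [abs_of_nonneg hx.1]
  exact hx.2.trans (by exact_mod_cast hn)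

theorem measurable_speviV_apply [Countable A] (hφ : Measurable φ) (lam β : ℝ)
    (t : Fin K → Fin H → S × A) (s : Fin K → Fin H) (h : ℕ) :
    Measurable (speviV φ lam β (observe M t) s h) :=
  (measurable_speviV (M := M) (α := Unit) (t := fun _ => t) hφ measurable_const lam β s h).of_uncurry_left
    (x := ())

theorem speviV_mem {S A : Type*} [Nonempty A] {φ : S × A → Fin d → ℝ} (lam β : ℝ)
    (D : Dataset S A H K) (s : Fin K → Fin H) (h : ℕ) (x : S) :
    speviV φ lam β D s h x ∈ Set.Icc (0 : ℝ) ((H - h : ℕ) : ℝ) :=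
  backward_mem (speviQ_mem _ _ _ _) h x

variable {b : Policy S A} {ρ : Measure S} [IsProbabilityMeasure ρ] {κ lam ι : ℝ}

/-- Accuracy of the unweighted regressions. -/
theorem unweighted_error_le (hlin : IsLinear M H φ) (hκ : κ = coverage M H φ b ρ)
    (N : LargeSample H d K κ lam ι) {t : Fin K → Fin H → S × A} {T : Finset (Fin K)}
    (hT : (K : ℝ) ≤ 2 * H * T.card) {h : Fin H} {V : S → ℝ} {B c : ℝ}
    (hV : Measurable V) (hVb : ∀ x, |V x| ≤ c) (hB : 0 ≤ B)
    (hgood : RegressionGood M φ t T (fun _ => 1) V h (κ / 1) (8 * d * (B ^ 2 * (3 * ι))))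
    {f : S × A → ℝ} (hf : ∃ θ : Fin d → ℝ, ∀ z, f z = φ z ⬝ᵥ θ)
    (hBw : ∀ z, |f z + ∫ y, V y ∂(M.P h z)| ≤ B)
    (y : Fin K → ℝ) (hy : ∀ τ, y τ = f (t τ h) + nextVal V h (t τ)) (z : S × A) :
    |φ z ⬝ᵥ ridge φ lam (observe M t) T (fun _ => 1) h y - (f z + ∫ y, V y ∂(M.P h z))|
      ≤ 6 * ι * √(d : ℝ) * B *
        wnorm (ridgeMatrix φ lam (observe M t) T (fun _ => 1) h)⁻¹ (φ z) ∧
    wnorm (ridgeMatrix φ lam (observe M t) T (fun _ => 1) h)⁻¹ (φ z) ≤ 2 * √(H / (K * κ)) := by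
  have hn2 := N.split_large hT
  have hT0 : 0 < T.card := by
    have : (0 : ℝ) < T.card := by linarith
    exact_mod_cast this
  have hι0 : 0 ≤ ι := zero_le_one.trans N.one_le_ι
  obtain ⟨e1, e2⟩ := RegressionGood.error_le hlin hκ N.pos_κ one_pos hgood (fun _ => le_rfl)
    N.pos_lam N.lam_lt hT0 (by positivity) hV hVb hf hBw y hy z
  exact ⟨e1.trans (mul_le_mul_of_nonneg_right (N.unweighted_coeff_le hB hn2) (wnorm_nonneg _ _)),
    e2.trans (N.width_le (by linarith) hT)⟩

/-- SPEVI is pessimistic, and loses at most `24 ι √d H √(H / (K κ))` per step. -/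
theorem speviV_bounds [Countable A] [Nonempty A] (hlin : IsLinear M H φ)
    (hκ : κ = coverage M H φ b ρ) (N : LargeSample H d K κ lam ι) {π : Policy S A}
    (hopt : IsOptimal M H π) {s : Fin K → Fin H} (hs : IsUniformSplit s)
    {t : Fin K → Fin H → S × A} {β : ℝ} (hβ : β = 6 * ι * √(d : ℝ) * H)
    (hgood : ∀ h : Fin H, RegressionGood M φ t (Finset.univ.filter fun τ => s τ = h) (fun _ => 1)
      (speviV φ lam β (observe M t) s (h + 1)) h (κ / 1) (8 * d * ((H : ℝ) ^ 2 * (3 * ι))))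
    (n : ℕ) : ∀ h, H - h = n → ∀ x,
    speviV φ lam β (observe M t) s h x ≤ optValue M H h x ∧
    optValue M H h x - speviV φ lam β (observe M t) s h x
      ≤ n * (24 * (ι * √(d : ℝ) * H * √(H / (K * κ)))) := by
  induction n with
  | zero =>
    intro h hn x
    have e : speviV φ lam β (observe M t) s h x = 0 := by
      unfold speviV
      rw [backward_of_le _ (by omega)]
    rw [e, hopt.optValue_eq, value_of_le M H π (by omega)]
    simp
  | succ n ih =>
    intro h hn x
    have hh : h < H := by omega
    have hUm := measurable_speviV_apply (M := M) hlin.measurable_feature lam β t s (h + 1)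
    have hUb := speviV_mem (φ := φ) lam β (observe M t) s (h + 1)
    have hUc : ∀ x, |speviV φ lam β (observe M t) s (h + 1) x| ≤ H := fun x =>
      abs_le_of_mem_Icc (by omega) (hUb x)
    have hbell := fun z => bellman_mem (M := M) (h := ⟨h, hh⟩) hUm hUb z
    have hcard := hs.card_ge N.two_H_le ⟨h, hh⟩
    have hι0 : 0 ≤ ι := zero_le_one.trans N.one_le_ι
    have hβ0 : 0 ≤ β := by rw [hβ]; positivity
    have hQ : ∀ z,
        speviQ φ lam β (observe M t) s ⟨h, hh⟩ (speviV φ lam β (observe M t) s (h + 1)) z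
          ≤ M.r h z + ∫ y, speviV φ lam β (observe M t) s (h + 1) y ∂(M.P h z) ∧
        M.r h z + ∫ y, speviV φ lam β (observe M t) s (h + 1) y ∂(M.P h z)
            - 24 * (ι * √(d : ℝ) * H * √(H / (K * κ)))
          ≤ speviQ φ lam β (observe M t) s ⟨h, hh⟩ (speviV φ lam β (observe M t) s (h + 1)) z := by
      intro z
      obtain ⟨e1, e2⟩ := unweighted_error_le hlin hκ N hcard hUm hUc (Nat.cast_nonneg _)
        (hgood ⟨h, hh⟩) (hlin.exists_reward_coeff hh) (fun z => by
          rw [abs_of_nonneg (hbell z).1]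
          exact (hbell z).2.trans (sub_le_self _ (by positivity)))
        (fun τ => (observe M t).rew τ ⟨h, hh⟩ +
          (observe M t).next (speviV φ lam β (observe M t) s (h + 1)) ⟨h, hh⟩ τ) (fun τ => rfl) z
      rw [← hβ] at e1
      have e5 := mul_le_mul_of_nonneg_left e2 hβ0
      have e6 : β * (2 * √(H / (K * κ))) = 12 * (ι * √(d : ℝ) * H * √(H / (K * κ))) := by
        rw [hβ]; ring
      rw [e6] at e5
      obtain ⟨e7, e8⟩ := abs_le.1 e1
      -- The regression error is at most the bonus, and the bonus at most 12 units; subtracting it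
      -- leaves the estimate between 24 units and 0 below the Bellman update.
      exact clip_pessimistic (hbell z) (by linarith) (by linarith)
    have hstep := pessimistic_step hopt ⟨h, hh⟩ hUm hUc (fun x => (ih (h + 1) (by omega) x).1)
      (fun x => (ih (h + 1) (by omega) x).2) (fun z => (hQ z).1) (fun z => (hQ z).2)
      (fun x => bddAbove_backward (speviQ_mem _ _ _ _) ⟨h, hh⟩ _ x)
      (W := speviV φ lam β (observe M t) s h) (fun x => backward_of_lt _ hh x) x
    refine ⟨hstep.1, hstep.2.trans_eq ?_⟩
    push_cast; ring

theorem speviV_close [Countable A] [Nonempty A] (hlin : IsLinear M H φ)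
    (hκ : κ = coverage M H φ b ρ) (N : LargeSample H d K κ lam ι) {π : Policy S A}
    (hopt : IsOptimal M H π) {s : Fin K → Fin H} (hs : IsUniformSplit s)
    {t : Fin K → Fin H → S × A} {β : ℝ} (hβ : β = 6 * ι * √(d : ℝ) * H)
    (hgood : ∀ h : Fin H, RegressionGood M φ t (Finset.univ.filter fun τ => s τ = h) (fun _ => 1)
      (speviV φ lam β (observe M t) s (h + 1)) h (κ / 1) (8 * d * ((H : ℝ) ^ 2 * (3 * ι))))
    (h : ℕ) (x : S) :
    speviV φ lam β (observe M t) s h x ≤ optValue M H h x ∧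
    optValue M H h x - speviV φ lam β (observe M t) s h x
      ≤ 24 * (ι * √(d : ℝ) * (H : ℝ) ^ 2 * √(H / (K * κ))) := by
  obtain ⟨h1, h2⟩ := speviV_bounds hlin hκ N hopt hs hβ hgood _ h rfl x
  refine ⟨h1, h2.trans ?_⟩
  have hι0 : 0 ≤ ι := zero_le_one.trans N.one_le_ι
  have : ((H - h : ℕ) : ℝ) ≤ H := by exact_mod_cast Nat.sub_le H h
  calc _ ≤ (H : ℝ) * (24 * (ι * √(d : ℝ) * H * √(H / (K * κ)))) := by gcongr
    _ = _ := by ring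

theorem abs_sq_sub_sq_le {x y c : ℝ} (hx : |x| ≤ c) (hy : |y| ≤ c) :
    |x ^ 2 - y ^ 2| ≤ 2 * c * |x - y| := by
  rw [sq_sub_sq, abs_mul]
  exact mul_le_mul_of_nonneg_right ((abs_add_le _ _).trans (by linarith)) (abs_nonneg _)

/-- Accuracy of the variance estimate. -/
theorem abs_varEst_sub_truncVar_le (hlin : IsLinear M H φ) (hκ : κ = coverage M H φ b ρ)
    (N : LargeSample H d K κ lam ι) {t : Fin K → Fin H → S × A} {h : Fin H} {V : S → ℝ}
    (hV : Measurable V) (hVb : ∀ x, V x ∈ Set.Icc (0 : ℝ) H)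
    (hgood2 : RegressionGood M φ t Finset.univ (fun _ => 1) (fun x => V x ^ 2) h (κ / 1)
      (8 * d * (((H : ℝ) ^ 2) ^ 2 * (3 * ι))))
    (hgood1 : RegressionGood M φ t Finset.univ (fun _ => 1) V h (κ / 1)
      (8 * d * ((H : ℝ) ^ 2 * (3 * ι)))) (z : S × A) :
    |varEst φ lam (observe M t) h V z - truncVar M h V z|
      ≤ 36 * (ι * √(d : ℝ) * (H : ℝ) ^ 2 * √(H / (K * κ))) := by
  have hVb2 : ∀ x, V x ^ 2 ∈ Set.Icc (0 : ℝ) ((H : ℝ) ^ 2) := fun x =>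
    ⟨sq_nonneg _, pow_le_pow_left₀ (hVb x).1 (hVb x).2 2⟩
  have hH1 := N.one_le_H
  have hι0 : 0 ≤ ι := zero_le_one.trans N.one_le_ι
  have hKn : (K : ℝ) ≤ 2 * H * ((Finset.univ : Finset (Fin K)).card : ℝ) := by
    rw [Finset.card_univ, Fintype.card_fin]; nlinarith [N.pos_K]
  have hm1 := integral_mem_Icc (μ := M.P h z) hV hVb
  have hm2 := integral_mem_Icc (μ := M.P h z) (hV.pow_const 2) hVb2
  have general : ∀ (U : S → ℝ) (B : ℝ), Measurable U → (∀ x, |U x| ≤ B) → 0 ≤ B →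
      RegressionGood M φ t Finset.univ (fun _ => 1) U h (κ / 1)
        (8 * d * (B ^ 2 * (3 * ι))) → ∀ y : Fin K → ℝ, (∀ τ, y τ = nextVal U h (t τ)) →
      |φ z ⬝ᵥ ridge φ lam (observe M t) Finset.univ (fun _ => 1) h y
        - ∫ x, U x ∂(M.P h z)| ≤ 6 * ι * √(d : ℝ) * B * (2 * √(H / (K * κ))) := by
    intro U B hU hUB hB hg y hy
    obtain ⟨e1, e2⟩ := unweighted_error_le hlin hκ N hKn hU hUB hB hg (f := fun _ => 0)
      ⟨0, fun z => by simp⟩ (fun z => by rw [zero_add]; exact abs_integral_le_of_abs_le hUB)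
      y (fun τ => by rw [hy, zero_add]) z
    rw [zero_add] at e1
    exact e1.trans (mul_le_mul_of_nonneg_left e2 (by positivity))
  have a1 := general V H hV (fun x => by rw [abs_of_nonneg (hVb x).1]; exact (hVb x).2)
    (by positivity) hgood1 (fun τ => (observe M t).next V h τ) (fun τ => rfl)
  have a2 := general _ ((H : ℝ) ^ 2) (hV.pow_const 2)
    (fun x => by rw [abs_of_nonneg (hVb2 x).1]; exact (hVb2 x).2) (by positivity) hgood2
    (fun τ => (observe M t).next V h τ ^ 2) (fun τ => by
      rw [observe_next]; unfold nextVal; split_ifs <;> simp)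
  have c1 := (abs_clip_sub_le hm1).trans a1
  have c2 := (abs_clip_sub_le hm2).trans a2
  have hp := clip_nonneg (H : ℝ) (φ z ⬝ᵥ ridge φ lam (observe M t) Finset.univ
    (fun _ => 1) h (fun τ => (observe M t).next V h τ))
  have hq := clip_le (m := (H : ℝ)) (by positivity) (φ z ⬝ᵥ ridge φ lam (observe M t) Finset.univ
    (fun _ => 1) h (fun τ => (observe M t).next V h τ))
  unfold varEst truncVar stepVar
  refine (abs_max_sub_max_le_max _ _ _ _).trans ?_
  rw [sub_self, abs_zero]
  refine max_le (by positivity) ?_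
  rw [sub_sub_sub_comm]
  refine (abs_sub _ _).trans ?_
  have c3 := abs_sq_sub_sq_le (c := H) (by rw [abs_of_nonneg hp]; exact hq)
    (by rw [abs_of_nonneg hm1.1]; exact hm1.2)
  -- The second moment contributes 6 · 2 = 12 units; the square of the mean contributes 2 H times an
  -- error of 12 units / H. Together these are the 36 units.
  have c4 := mul_le_mul_of_nonneg_left c1 (show (0 : ℝ) ≤ 2 * H by positivity)
  linarith

theorem abs_stepVar_sub_le (h : ℕ) {V U : S → ℝ} (hV : Measurable V) (hU : Measurable U) {c e : ℝ}
    (hVc : ∀ x, |V x| ≤ c) (hUc : ∀ x, |U x| ≤ c) (he : ∀ x, |V x - U x| ≤ e) (z : S × A) :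
    |stepVar M h V z - stepVar M h U z| ≤ 4 * c * e := by
  have hi := integrable_of_measurable_of_abs_le (μ := M.P h z) hV hVc
  have hi' := integrable_of_measurable_of_abs_le (μ := M.P h z) hU hUc
  have hc : ∀ x, 0 ≤ c := fun x => (abs_nonneg _).trans (hVc x)
  have sqb : ∀ (W : S → ℝ), (∀ x, |W x| ≤ c) → ∀ x, |W x ^ 2| ≤ c ^ 2 := fun W hW x => by
    rw [abs_pow]; exact pow_le_pow_left₀ (abs_nonneg _) (hW x) 2
  have hj := integrable_of_measurable_of_abs_le (μ := M.P h z) (hV.pow_const 2) (sqb V hVc)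
  have hj' := integrable_of_measurable_of_abs_le (μ := M.P h z) (hU.pow_const 2) (sqb U hUc)
  have d1 : |∫ y, V y ∂(M.P h z) - ∫ y, U y ∂(M.P h z)| ≤ e := by
    rw [← integral_sub hi hi']; exact abs_integral_le_of_abs_le he
  have d2 : |∫ y, V y ^ 2 ∂(M.P h z) - ∫ y, U y ^ 2 ∂(M.P h z)| ≤ 2 * c * e := by
    rw [← integral_sub hj hj']
    refine abs_integral_le_of_abs_le fun x => (abs_sq_sub_sq_le (hVc x) (hUc x)).trans ?_
    exact mul_le_mul_of_nonneg_left (he x) (by linarith [hc x])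
  have d3 := abs_sq_sub_sq_le (abs_integral_le_of_abs_le (μ := M.P h z) hVc)
    (abs_integral_le_of_abs_le (μ := M.P h z) hUc)
  have hc0 : 0 ≤ c := (abs_nonneg _).trans (abs_integral_le_of_abs_le (μ := M.P h z) hVc)
  have d4 := mul_le_mul_of_nonneg_left d1 (show 0 ≤ 2 * c by linarith)
  unfold stepVar
  rw [sub_sub_sub_comm]
  refine (abs_sub _ _).trans ?_
  linarith

end GoodData
end OfflineRL

namespace OfflineRL

/-! ### Numerical bounds for the weighted regression and the second-order terms. -/

namespace LargeSample

variable {H d K : ℕ} {κ lam ι : ℝ} (N : LargeSample H d K κ lam ι)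
include N

theorem scale_le_thousandth :
    ι * √(d : ℝ) * (H : ℝ) ^ 2 * √(H / (K * κ)) ≤ 1 / 1000 := by
  have h := N.scale_le
  have h1 := N.one_le_H
  have hι0 : 0 ≤ ι := zero_le_one.trans N.one_le_ι
  have h2 : 0 ≤ ι * √(d : ℝ) * (H : ℝ) ^ 2 * √(H / (K * κ)) := by positivity
  nlinarith [mul_le_mul_of_nonneg_left h1 h2]

/-- The noise accounts for 7 ι √d, since 8 · 2 · 3 = 48 ≤ 7². The bias is at most 1 because K
dominates 2 H⁴. -/
theorem weighted_coeff_le :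
    √(8 * d * (2 * (3 * ι))) + H * √(2 * (H : ℝ) ^ 2 / K) ≤ 8 * ι * √(d : ℝ) := by
  have h1 := N.sqrt_noise_le_two
  have hH := N.one_le_H; have hd := N.one_le_d; have hι := N.one_le_ι; have hK := N.pos_K
  have h2 : H * √(2 * (H : ℝ) ^ 2 / K) ≤ 1 := by
    rw [← sq_le_one_iff₀ (by positivity), mul_pow, Real.sq_sqrt (by positivity), mul_div_assoc',
      div_le_one hK]
    refine le_trans ?_ N.large_K
    calc (H : ℝ) ^ 2 * (2 * (H : ℝ) ^ 2) = 2 * 1 * 1 * (H : ℝ) ^ 4 := by ring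
      _ ≤ 10 ^ 6 * ι ^ 2 * d ^ 2 * (H : ℝ) ^ 13 := by
        gcongr
        · norm_num
        · exact one_le_pow₀ hι
        · exact one_le_pow₀ hd
        · norm_num
  linarith [N.one_le_ι_mul_sqrt]

theorem weighted_width_le : √(2 * (H : ℝ) ^ 2 / (K * κ)) ≤ 3 / 2 * (H * √(H / (K * κ))) := by
  have hH := N.one_le_H; have hK := N.pos_K; have hκ := N.pos_κ
  refine Real.sqrt_le_iff.2 ⟨by positivity, ?_⟩
  rw [mul_pow, mul_pow, Real.sq_sqrt (by positivity), mul_div_assoc', mul_div_assoc',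
    div_le_div_iff_of_pos_right (by positivity)]
  have := mul_le_mul_of_nonneg_left hH (show (0 : ℝ) ≤ (H : ℝ) ^ 2 by positivity)
  nlinarith

theorem bonus_offset_le :
    8 * lam * (H : ℝ) ^ 3 * √(d : ℝ) / (K * κ) ≤ 8 * ι ^ 2 * (d * (H : ℝ) ^ 3 / (K * κ)) := by
  have hH := N.one_le_H; have hd := N.one_le_d; have hι := N.one_le_ι; have hK := N.pos_K
  have hκ := N.pos_κ
  rw [mul_div_assoc']
  refine div_le_div_of_nonneg_right ?_ (by positivity)
  have h1 : lam ≤ ι ^ 2 := (N.lam_lt.le.trans N.κ_le_one).trans (one_le_pow₀ hι)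
  have h2 : √(d : ℝ) ≤ d := Real.sqrt_le_iff.2 ⟨by positivity, by nlinarith⟩
  calc 8 * lam * (H : ℝ) ^ 3 * √(d : ℝ) ≤ 8 * ι ^ 2 * (H : ℝ) ^ 3 * d := by gcongr
    _ = _ := by ring

theorem quadratic_scale :
    ι ^ 2 * (d * (H : ℝ) ^ 3 / (K * κ)) = (ι * √(d : ℝ) * H * √(H / (K * κ))) ^ 2 := by
  have hK := N.pos_K; have hκ := N.pos_κ
  rw [mul_pow, mul_pow, mul_pow, Real.sq_sqrt (by positivity), Real.sq_sqrt (by positivity)]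
  ring

/-- With x the per-step scale on the right, the left side is 1000 x², and x ≤ 1 / 1000. -/
theorem quadratic_scale_le :
    1000 * (ι ^ 2 * (d * (H : ℝ) ^ 3 / (K * κ))) ≤ ι * √(d : ℝ) * H * √(H / (K * κ)) := by
  have hH := N.one_le_H
  have hι0 : 0 ≤ ι := zero_le_one.trans N.one_le_ι
  rw [N.quadratic_scale]
  have h0 : 0 ≤ ι * √(d : ℝ) * H * √(H / (K * κ)) := by positivity
  have h1 : ι * √(d : ℝ) * H * √(H / (K * κ)) ≤ 1 / 1000 :=
    le_trans (by
      have : (H : ℝ) ≤ (H : ℝ) ^ 2 := le_self_pow₀ hH (by norm_num)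
      gcongr) N.scale_le_thousandth
  nlinarith

end LargeSample

/-! ### Analysis of SPEVI+ on good data -/

section GoodData

variable {S : Type u} {A : Type v} {H K d : ℕ} [MeasurableSpace S] [MeasurableSpace A]

/-- The bound on the advantage, the difference of the value functions of SPEVI+ and SPEVI. -/
noncomputable def advantageBound (H K d : ℕ) (κ ι : ℝ) : ℝ :=
  30 * (ι * √(d : ℝ) * (H : ℝ) ^ 2 * √(H / (K * κ)))

/-- All regressions of SPEVI+ are accurate. -/
structure GoodData (M : MDP S A) (φ : S × A → Fin d → ℝ) (sref s1 : Fin K → Fin H) (κ ι : ℝ)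
    (ω : Fin 4 × Fin K → Fin H → S × A) (Vref Vhat : ℕ → S → ℝ) (var : Fin H → S × A → ℝ) :
    Prop where
  reference : ∀ h : Fin H, RegressionGood M φ (fun τ => ω (0, τ))
    (Finset.univ.filter fun τ => sref τ = h) (fun _ => 1) (Vref (h + 1)) h (κ / 1)
    (8 * d * ((H : ℝ) ^ 2 * (3 * ι)))
  secondMoment : ∀ h : Fin H, RegressionGood M φ (fun τ => ω (2, τ)) Finset.univ
    (fun _ => 1) (fun x => Vref (h + 1) x ^ 2) h (κ / 1) (8 * d * (((H : ℝ) ^ 2) ^ 2 * (3 * ι)))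
  firstMoment : ∀ h : Fin H, RegressionGood M φ (fun τ => ω (2, τ)) Finset.univ
    (fun _ => 1) (Vref (h + 1)) h (κ / 1) (8 * d * ((H : ℝ) ^ 2 * (3 * ι)))
  -- This field and the next are conditional: the hypothesis on the target is random and is
  -- established only afterwards, from the other fields. It involves no trajectory used by the
  -- regression itself, so conditioning on it is harmless.
  weighted : ∀ h : Fin H, (∀ z, stepVar M h (Vref (h + 1)) z ≤ 2 * var h z) →
    RegressionGood M φ (fun τ => ω (1, τ)) Finset.univ (var h) (Vref (h + 1)) h
      (κ / (H : ℝ) ^ 2) (8 * d * (2 * (3 * ι)))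
  advantage : ∀ h : Fin H,
    (∀ x, |Vhat (h + 1) x - Vref (h + 1) x| ≤ advantageBound H K d κ ι) →
    RegressionGood M φ (fun τ => ω (3, τ)) (Finset.univ.filter fun τ => s1 τ = h) (fun _ => 1)
      (fun x => Vhat (h + 1) x - Vref (h + 1) x) h (κ / 1)
      (8 * d * (advantageBound H K d κ ι ^ 2 * (3 * ι)))

theorem measurable_optValue {M : MDP S A} {π : Policy S A} (hopt : IsOptimal M H π) (h : ℕ) :
    Measurable (optValue M H h) := by
  rw [hopt.optValue_eq]; exact measurable_value M H π _

theorem optValue_mem {M : MDP S A} {π : Policy S A} (hopt : IsOptimal M H π) (h : ℕ) (x : S) :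
    optValue M H h x ∈ Set.Icc (0 : ℝ) ((H - h : ℕ) : ℝ) := by
  rw [hopt.optValue_eq]; exact ⟨value_nonneg M H π h x, value_le M H π h x⟩

/-- SPEVI+ run with the parameters of the theorem on data for which all regressions are
accurate. -/
structure GoodRun (M : MDP S A) (φ : S × A → Fin d → ℝ) (b : Policy S A) (ρ : Measure S)
    (π : Policy S A) (sref s1 : Fin K → Fin H) (lam κ βref β0 b1 ι : ℝ)
    (ω : Fin 4 × Fin K → Fin H → S × A) : Prop where
  linear : IsLinear M H φ
  coverage_eq : κ = coverage M H φ b ρ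
  largeSample : LargeSample H d K κ lam ι
  optimal : IsOptimal M H π
  split_ref : IsUniformSplit sref
  split_one : IsUniformSplit s1
  βref_eq : βref = 6 * ι * √(d : ℝ) * H
  β0_eq : β0 = 8 * ι * √(d : ℝ)
  b1_eq : b1 = 360 * ι ^ 2 * (d * (H : ℝ) ^ 3 / (K * κ))
  good : GoodData M φ sref s1 κ ι ω ((runInput M sref s1 lam κ βref β0 b1 ω).Vref φ)
    ((runInput M sref s1 lam κ βref β0 b1 ω).Vhat φ)
    ((runInput M sref s1 lam κ βref β0 b1 ω).var φ)

theorem measurable_Vref_apply [Countable A] {M : MDP S A} {φ : S × A → Fin d → ℝ}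
    (hφ : Measurable φ) (sref s1 : Fin K → Fin H) (lam κ βref β0 b1 : ℝ)
    (ω : Fin 4 × Fin K → Fin H → S × A) (h : ℕ) :
    Measurable ((runInput M sref s1 lam κ βref β0 b1 ω).Vref φ h) :=
  (measurable_Vref M sref s1 lam κ βref β0 b1 hφ h).of_uncurry_left

theorem measurable_Vhat_apply [Countable A] {M : MDP S A} {φ : S × A → Fin d → ℝ}
    (hφ : Measurable φ) (sref s1 : Fin K → Fin H) (lam κ βref β0 b1 : ℝ)
    (ω : Fin 4 × Fin K → Fin H → S × A) (h : ℕ) :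
    Measurable ((runInput M sref s1 lam κ βref β0 b1 ω).Vhat φ h) :=
  (measurable_Vhat M sref s1 lam κ βref β0 b1 hφ h).of_uncurry_left

namespace GoodRun

variable {M : MDP S A} {φ : S × A → Fin d → ℝ} [Countable A] [Nonempty A] {b : Policy S A}
  {ρ : Measure S} [IsProbabilityMeasure ρ] {π : Policy S A} {sref s1 : Fin K → Fin H}
  {lam κ βref β0 b1 ι : ℝ} {ω : Fin 4 × Fin K → Fin H → S × A}
  (R : GoodRun M φ b ρ π sref s1 lam κ βref β0 b1 ι ω)
include R

theorem Vref_close (h : ℕ) (x : S) :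
    (runInput M sref s1 lam κ βref β0 b1 ω).Vref φ h x ≤ optValue M H h x ∧
    optValue M H h x - (runInput M sref s1 lam κ βref β0 b1 ω).Vref φ h x
      ≤ 24 * (ι * √(d : ℝ) * (H : ℝ) ^ 2 * √(H / (K * κ))) :=
  speviV_close R.linear R.coverage_eq R.largeSample R.optimal R.split_ref R.βref_eq
    R.good.reference h x

theorem abs_var_sub_le (h : Fin H) (z : S × A) :
    |(runInput M sref s1 lam κ βref β0 b1 ω).var φ h z
      - truncVar M h ((runInput M sref s1 lam κ βref β0 b1 ω).Vref φ (h + 1)) z|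
      ≤ 36 * (ι * √(d : ℝ) * (H : ℝ) ^ 2 * √(H / (K * κ))) :=
  abs_varEst_sub_truncVar_le R.linear R.coverage_eq R.largeSample
    (measurable_Vref_apply R.linear.measurable_feature sref s1 lam κ βref β0 b1 ω (h + 1))
    (fun x => ⟨(Vref_mem _ _ x).1, (Vref_mem _ _ x).2.trans (by exact_mod_cast Nat.sub_le _ _)⟩)
    (R.good.secondMoment h) (R.good.firstMoment h) z

/-- The variance estimate errs by at most 36 / 1000, which is absorbed because `var` is at least 1.
This discharges the hypothesis of `GoodData.weighted`. -/
theorem stepVar_Vref_le (h : Fin H) (z : S × A) :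
    stepVar M h ((runInput M sref s1 lam κ βref β0 b1 ω).Vref φ (h + 1)) z
      ≤ 2 * (runInput M sref s1 lam κ βref β0 b1 ω).var φ h z := by
  have h1 := (abs_le.1 (R.abs_var_sub_le h z)).1
  have h2 := R.largeSample.scale_le_thousandth
  have h3 : _ ≤ truncVar M h ((runInput M sref s1 lam κ βref β0 b1 ω).Vref φ (h + 1)) z :=
    le_max_right _ _
  have h4 := var_one_le (φ := φ) (runInput M sref s1 lam κ βref β0 b1 ω) h z
  linarith

/-- Two errors add up: that of the variance estimate, and that of replacing the reference by the
optimal value, at most 4 H · 24 s with s as in `LargeSample.scale_le`. The latter is why s must be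
small against 1 / H. The sum is below 1, hence below the truncated variance. -/
theorem var_le_two_mul (h : Fin H) (z : S × A) :
    (runInput M sref s1 lam κ βref β0 b1 ω).var φ h z
      ≤ 2 * truncVar M h (optValue M H (h + 1)) z := by
  set I := runInput M sref s1 lam κ βref β0 b1 ω with hI
  have h1 := (abs_le.1 (R.abs_var_sub_le h z)).2
  have h2 := R.largeSample.scale_le_thousandth
  have h2' := R.largeSample.scale_le
  have hι0 : 0 ≤ ι := zero_le_one.trans R.largeSample.one_le_ι
  have h3 := abs_stepVar_sub_le (M := M) h
    (measurable_Vref_apply R.linear.measurable_feature sref s1 lam κ βref β0 b1 ω (h + 1))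
    (measurable_optValue R.optimal (h + 1)) (c := H)
    (e := 24 * (ι * √(d : ℝ) * (H : ℝ) ^ 2 * √(H / (K * κ))))
    (fun x => abs_le_of_mem_Icc (Nat.sub_le _ _) (Vref_mem _ _ x))
    (fun x => abs_le_of_mem_Icc (Nat.sub_le _ _) (optValue_mem R.optimal _ x))
    (fun x => by
      obtain ⟨e1, e2⟩ := R.Vref_close (h + 1) x
      rw [abs_sub_comm, abs_of_nonneg (sub_nonneg.2 e1)]
      exact e2) z
  have h4 : truncVar M h (I.Vref φ (h + 1)) z ≤ truncVar M h (optValue M H (h + 1)) z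
      + 4 * H * (24 * (ι * √(d : ℝ) * (H : ℝ) ^ 2 * √(H / (K * κ)))) := by
    unfold truncVar
    refine max_le ?_ ?_
    · refine (le_max_left _ _).trans (le_add_of_nonneg_right (by positivity))
    · have := (abs_le.1 h3).2
      have h5 := le_max_right 1 (stepVar M h (optValue M H (h + 1)) z)
      linarith
  have h5 : (1 : ℝ) ≤ truncVar M h (optValue M H (h + 1)) z := le_max_left _ _
  linarith

/-- The reference part of the update. -/
theorem w0_error_le (h : Fin H) (z : S × A) :
    |φ z ⬝ᵥ (runInput M sref s1 lam κ βref β0 b1 ω).w0 φ h - (M.r h z +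
        ∫ y, (runInput M sref s1 lam κ βref β0 b1 ω).Vref φ (h + 1) y ∂(M.P h z))|
      ≤ β0 * wnorm ((runInput M sref s1 lam κ βref β0 b1 ω).Zhat φ h)⁻¹ (φ z) ∧
    wnorm ((runInput M sref s1 lam κ βref β0 b1 ω).Zhat φ h)⁻¹ (φ z)
      ≤ 3 / 2 * (H * √(H / (K * κ))) := by
  have N := R.largeSample
  have hH := N.one_le_H
  have hι0 : 0 ≤ ι := zero_le_one.trans N.one_le_ι
  have hVm := measurable_Vref_apply (M := M) R.linear.measurable_feature sref s1 lam κ βref β0 b1 ω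
    (h + 1)
  have hbell := fun z => bellman_mem (M := M) (h := h) hVm (Vref_mem _ _) z
  have hcard : (Finset.univ : Finset (Fin K)).card = K := by simp
  obtain ⟨e1, e2⟩ := RegressionGood.error_le R.linear R.coverage_eq N.pos_κ (by positivity)
    (R.good.weighted h (R.stepVar_Vref_le h)) (var_one_le _ h) N.pos_lam N.lam_lt
    (by rw [hcard]; exact_mod_cast N.pos_K) (by positivity) hVm
    (fun x => abs_le_of_mem_Icc (Nat.sub_le _ _) (Vref_mem _ _ x))
    (R.linear.exists_reward_coeff h.2) (Bw := H) (fun z => by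
      rw [abs_of_nonneg (hbell z).1]
      exact (hbell z).2.trans (sub_le_self _ (by positivity)))
    (fun τ => (observe M fun τ => ω (1, τ)).rew τ h + (observe M fun τ => ω (1, τ)).next
      ((runInput M sref s1 lam κ βref β0 b1 ω).Vref φ (h + 1)) h τ) (fun τ => rfl) z
  rw [hcard] at e1 e2
  refine ⟨e1.trans ?_, e2.trans N.weighted_width_le⟩
  refine mul_le_mul_of_nonneg_right ?_ (wnorm_nonneg _ _)
  rw [R.β0_eq]
  exact N.weighted_coeff_le

/-- The advantage part of the update. -/
theorem w1_error_le (h : Fin H)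
    (hadv : ∀ x, |(runInput M sref s1 lam κ βref β0 b1 ω).Vhat φ (h + 1) x
      - (runInput M sref s1 lam κ βref β0 b1 ω).Vref φ (h + 1) x| ≤ advantageBound H K d κ ι)
    (z : S × A) :
    |φ z ⬝ᵥ (runInput M sref s1 lam κ βref β0 b1 ω).w1 φ h
        ((runInput M sref s1 lam κ βref β0 b1 ω).Vhat φ (h + 1)) -
        (∫ y, (runInput M sref s1 lam κ βref β0 b1 ω).Vhat φ (h + 1) y ∂(M.P h z) -
        ∫ y, (runInput M sref s1 lam κ βref β0 b1 ω).Vref φ (h + 1) y ∂(M.P h z))|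
      ≤ b1 := by
  have N := R.largeSample
  have hι0 : 0 ≤ ι := zero_le_one.trans N.one_le_ι
  have hB : 0 ≤ advantageBound H K d κ ι := by unfold advantageBound; positivity
  have hVm := measurable_Vref_apply (M := M) R.linear.measurable_feature sref s1 lam κ βref β0 b1 ω
    (h + 1)
  have hVm' := measurable_Vhat_apply (M := M) R.linear.measurable_feature sref s1 lam κ βref β0 b1
    ω (h + 1)
  obtain ⟨e1, e2⟩ := unweighted_error_le R.linear R.coverage_eq N
    (R.split_one.card_ge N.two_H_le h) (hVm'.sub hVm) hadv hB (R.good.advantage h hadv)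
    (f := fun _ => 0) ⟨0, fun z => by simp⟩
    (fun z => by rw [zero_add]; exact abs_integral_le_of_abs_le hadv)
    (fun τ => (observe M fun τ => ω (3, τ)).next (fun x =>
      (runInput M sref s1 lam κ βref β0 b1 ω).Vhat φ (h + 1) x
        - (runInput M sref s1 lam κ βref β0 b1 ω).Vref φ (h + 1) x) h τ)
    (fun τ => by rw [zero_add, observe_next]; rfl) z
  have hi : Integrable ((runInput M sref s1 lam κ βref β0 b1 ω).Vref φ (h + 1)) (M.P h z) :=
    integrable_of_measurable_of_abs_le hVm
      (fun x => abs_le_of_mem_Icc (Nat.sub_le H _) (Vref_mem _ _ x))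
  have hi' : Integrable ((runInput M sref s1 lam κ βref β0 b1 ω).Vhat φ (h + 1)) (M.P h z) :=
    integrable_of_measurable_of_abs_le hVm'
      (fun x => abs_le_of_mem_Icc (Nat.sub_le H _) (Vhat_mem _ _ x))
  rw [zero_add, Pi.sub_def, integral_sub hi' hi] at e1
  refine (e1.trans (mul_le_mul_of_nonneg_left e2 (by positivity))).trans_eq ?_
  -- 360 = 6 · 30 · 2: regression coefficient, advantage bound, width.
  rw [R.b1_eq, mul_assoc 360, N.quadratic_scale, advantageBound]
  ring

/-- The one-step loss of SPEVI+ against the Bellman update of its own value function. -/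
theorem Qhat_bounds (h : Fin H)
    (hadv : ∀ x, |(runInput M sref s1 lam κ βref β0 b1 ω).Vhat φ (h + 1) x
      - (runInput M sref s1 lam κ βref β0 b1 ω).Vref φ (h + 1) x| ≤ advantageBound H K d κ ι)
    (z : S × A) :
    (runInput M sref s1 lam κ βref β0 b1 ω).Qhat φ h z ≤ M.r h z +
      ∫ y, (runInput M sref s1 lam κ βref β0 b1 ω).Vhat φ (h + 1) y ∂(M.P h z) ∧
    M.r h z + ∫ y, (runInput M sref s1 lam κ βref β0 b1 ω).Vhat φ (h + 1) y ∂(M.P h z) -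
      (2 * β0 * wnorm ((runInput M sref s1 lam κ βref β0 b1 ω).Zhat φ h)⁻¹ (φ z)
        + 728 * (ι ^ 2 * (d * (H : ℝ) ^ 3 / (K * κ))))
      ≤ (runInput M sref s1 lam κ βref β0 b1 ω).Qhat φ h z := by
  have N := R.largeSample
  have hVm' := measurable_Vhat_apply (M := M) R.linear.measurable_feature sref s1 lam κ βref β0 b1
    ω (h + 1)
  have hbell := bellman_mem (M := M) (h := h) hVm' (Vhat_mem _ _) z
  have e0 := abs_le.1 (R.w0_error_le h z).1
  have e1 := abs_le.1 (R.w1_error_le h hadv z)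
  have e2 := N.bonus_offset_le
  have e3 := R.b1_eq
  have hp : 0 ≤ 4 * lam * (H : ℝ) ^ 3 * √(d : ℝ) / (K * κ) := by
    have := N.pos_lam; have := N.pos_κ; positivity
  have e4 : 8 * lam * (H : ℝ) ^ 3 * √(d : ℝ) / (K * κ)
    = 2 * (4 * lam * (H : ℝ) ^ 3 * √(d : ℝ) / (K * κ)) := by ring
  have hb0 : (runInput M sref s1 lam κ βref β0 b1 ω).b0 φ h z
      = β0 * wnorm ((runInput M sref s1 lam κ βref β0 b1 ω).Zhat φ h)⁻¹ (φ z)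
        + 4 * lam * (H : ℝ) ^ 3 * √(d : ℝ) / (K * κ) := rfl
  have hb1 : (runInput M sref s1 lam κ βref β0 b1 ω).b1 = b1 := rfl
  unfold Input.Qhat Input.stepQ
  rw [hb0, hb1]
  -- Each bonus covers its own error, so the total loss is at most twice the bonuses; 728 = 8 + 2 ·
  -- 360.
  exact clip_pessimistic hbell (by linarith) (by linarith)

/-- Both value functions lie in the same interval of length `advantageBound` below the optimal
value. -/
theorem advantage_le_of_close (h : ℕ) (x : S) {n : ℝ} (hn : n ≤ H)
    (hV : (runInput M sref s1 lam κ βref β0 b1 ω).Vhat φ h x ≤ optValue M H h x ∧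
      optValue M H h x - (runInput M sref s1 lam κ βref β0 b1 ω).Vhat φ h x
        ≤ n * (30 * (ι * √(d : ℝ) * H * √(H / (K * κ))))) :
    |(runInput M sref s1 lam κ βref β0 b1 ω).Vhat φ h x
      - (runInput M sref s1 lam κ βref β0 b1 ω).Vref φ h x| ≤ advantageBound H K d κ ι := by
  have hι0 : 0 ≤ ι := zero_le_one.trans R.largeSample.one_le_ι
  obtain ⟨a1, a2⟩ := hV
  obtain ⟨a3, a4⟩ := R.Vref_close h x
  have a5 : n * (30 * (ι * √(d : ℝ) * H * √(H / (K * κ)))) ≤ advantageBound H K d κ ι :=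
    calc _ ≤ (H : ℝ) * (30 * (ι * √(d : ℝ) * H * √(H / (K * κ)))) := by gcongr
      _ = _ := by unfold advantageBound; ring
  have a6 : 24 * (ι * √(d : ℝ) * (H : ℝ) ^ 2 * √(H / (K * κ))) ≤ advantageBound H K d κ ι := by
    unfold advantageBound
    have : 0 ≤ ι * √(d : ℝ) * (H : ℝ) ^ 2 * √(H / (K * κ)) := by positivity
    linarith
  exact abs_le.2 ⟨by linarith, by linarith⟩

/-- Closeness at step h + 1 bounds the advantage there, which makes the advantage regression at step
h accurate, which gives closeness at step h. No accuracy of the advantage regression is assumed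
before it has been earned. -/
theorem Vhat_bounds (n : ℕ) : ∀ h, H - h = n → ∀ x,
    (runInput M sref s1 lam κ βref β0 b1 ω).Vhat φ h x ≤ optValue M H h x ∧
    optValue M H h x - (runInput M sref s1 lam κ βref β0 b1 ω).Vhat φ h x
      ≤ n * (30 * (ι * √(d : ℝ) * H * √(H / (K * κ)))) := by
  have N := R.largeSample
  have hι0 : 0 ≤ ι := zero_le_one.trans N.one_le_ι
  induction n with
  | zero =>
    intro h hn x
    have e : (runInput M sref s1 lam κ βref β0 b1 ω).Vhat φ h x = 0 := by
      unfold Input.Vhat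
      rw [backward_of_le _ (by omega)]
    rw [e, R.optimal.optValue_eq, value_of_le M H π (by omega)]
    simp
  | succ n ih =>
    intro h hn x
    have hh : h < H := by omega
    have hnH : (n : ℝ) ≤ H := by exact_mod_cast (show n ≤ H by omega)
    have hadv : ∀ x, |(runInput M sref s1 lam κ βref β0 b1 ω).Vhat φ (h + 1) x
        - (runInput M sref s1 lam κ βref β0 b1 ω).Vref φ (h + 1) x|
          ≤ advantageBound H K d κ ι := fun x =>
      R.advantage_le_of_close (h + 1) x hnH (ih (h + 1) (by omega) x)
    have hQ := R.Qhat_bounds ⟨h, hh⟩ hadv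
    -- The reference bonus contributes 2 · 8 · 3/2 = 24 units and the second-order terms at most 728
    -- / 1000, so 30 leaves room.
    have hgap : ∀ z, 2 * β0 *
        wnorm ((runInput M sref s1 lam κ βref β0 b1 ω).Zhat φ ⟨h, hh⟩)⁻¹ (φ z)
        + 728 * (ι ^ 2 * (d * (H : ℝ) ^ 3 / (K * κ)))
        ≤ 30 * (ι * √(d : ℝ) * H * √(H / (K * κ))) := fun z => by
      have g1 := (R.w0_error_le ⟨h, hh⟩ z).2
      have g2 := mul_le_mul_of_nonneg_left g1
        (show 0 ≤ 2 * β0 by rw [R.β0_eq]; positivity)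
      have g3 : 2 * β0 * (3 / 2 * (H * √(H / (K * κ)))) =
          24 * (ι * √(d : ℝ) * H * √(H / (K * κ))) := by rw [R.β0_eq]; ring
      have g4 := N.quadratic_scale_le
      have g5 : 0 ≤ ι ^ 2 * (d * (H : ℝ) ^ 3 / (K * κ)) := by
        rw [N.quadratic_scale]; positivity
      linarith
    have hstep := pessimistic_step R.optimal ⟨h, hh⟩
      (measurable_Vhat_apply R.linear.measurable_feature sref s1 lam κ βref β0 b1 ω (h + 1))
      (fun x => abs_le_of_mem_Icc (Nat.sub_le H _) (Vhat_mem _ (h + 1) x))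
      (fun x => (ih (h + 1) (by omega) x).1)
      (fun x => (ih (h + 1) (by omega) x).2) (fun z => (hQ z).1)
      (fun z => (sub_le_sub_left (hgap z) _).trans (hQ z).2)
      (fun x => bddAbove_backward (stepQ_mem _) ⟨h, hh⟩ _ x)
      (W := (runInput M sref s1 lam κ βref β0 b1 ω).Vhat φ h)
      (fun x => backward_of_lt _ hh x) x
    refine ⟨hstep.1, hstep.2.trans_eq ?_⟩
    push_cast; ring

theorem advantage_le (h : ℕ) (x : S) :
    |(runInput M sref s1 lam κ βref β0 b1 ω).Vhat φ h x
      - (runInput M sref s1 lam κ βref β0 b1 ω).Vref φ h x| ≤ advantageBound H K d κ ι :=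
  R.advantage_le_of_close h x (by exact_mod_cast Nat.sub_le H h) (R.Vhat_bounds _ h rfl x)

end GoodRun
end GoodData
end OfflineRL

namespace OfflineRL

/-! ### Suboptimality of the greedy policy on good data -/

section Suboptimality

variable {S : Type u} {A : Type v} {H K d : ℕ}

/-- Comparison of two weighted regressions on the same data. -/
theorem wnorm_ridgeMatrix_inv_le (φ : S × A → Fin d → ℝ) {lam : ℝ} (hlam : 0 < lam)
    (D : Dataset S A H K) (T : Finset (Fin K)) {σ σ' : S × A → ℝ} (hσ : ∀ z, 1 ≤ σ z)
    (hσ' : ∀ z, 1 ≤ σ' z) {c : ℝ} (hc : 1 ≤ c) (hle : ∀ z, σ z ≤ c * σ' z) (h : Fin H)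
    (u : Fin d → ℝ) :
    wnorm (ridgeMatrix φ lam D T σ h)⁻¹ u ^ 2 ≤ c * wnorm (ridgeMatrix φ lam D T σ' h)⁻¹ u ^ 2 := by
  refine wnorm_inv_le_of_le (ridgeMatrix_posDef hlam D T hσ' h) (ridgeMatrix_posDef hlam D T hσ h)
    (by linarith) (fun v => ?_) u
  rw [dotProduct_ridgeMatrix, dotProduct_ridgeMatrix, mul_add, Finset.mul_sum]
  refine add_le_add (Finset.sum_le_sum fun τ _ => ?_) ?_
  · have h1 : (σ' (D.pair τ h))⁻¹ ≤ c * (σ (D.pair τ h))⁻¹ := by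
      have p := hσ (D.pair τ h); have p' := hσ' (D.pair τ h)
      rw [← div_eq_mul_inv, le_div_iff₀ (by linarith), inv_mul_le_iff₀ (by linarith)]
      linarith [hle (D.pair τ h)]
    have h2 := mul_le_mul_of_nonneg_right h1 (mul_self_nonneg (v ⬝ᵥ φ (D.pair τ h)))
    linarith
  · exact le_mul_of_one_le_left (mul_nonneg hlam.le (dotProduct_self_nonneg' v)) hc

variable [MeasurableSpace S] [MeasurableSpace A]

theorem stepVar_le_sq (M : MDP S A) (h : ℕ) {V : S → ℝ} {B : ℝ} (hB : ∀ x, |V x| ≤ B)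
    (z : S × A) : stepVar M h V z ≤ B ^ 2 := by
  refine (sub_le_self _ (sq_nonneg _)).trans ((le_abs_self _).trans
    (abs_integral_le_of_abs_le fun x => ?_))
  rw [abs_pow]
  exact pow_le_pow_left₀ (abs_nonneg _) (hB x) 2

theorem truncVar_optValue_le {M : MDP S A} {π : Policy S A} (hopt : IsOptimal M H π) (h : Fin H)
    (z : S × A) : truncVar M h (optValue M H (h + 1)) z ≤ (H : ℝ) ^ 2 := by
  have hH : (1 : ℝ) ≤ H := by exact_mod_cast h.pos
  exact max_le (one_le_pow₀ hH) (stepVar_le_sq M h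
    (fun x => abs_le_of_mem_Icc (Nat.sub_le _ _) (optValue_mem hopt _ x)) z)

namespace GoodRun

variable {M : MDP S A} {φ : S × A → Fin d → ℝ} [Countable A] [Nonempty A] {b : Policy S A}
  {ρ : Measure S} [IsProbabilityMeasure ρ] {π : Policy S A} {sref s1 : Fin K → Fin H}
  {lam κ βref β0 b1 ι : ℝ} {ω : Fin 4 × Fin K → Fin H → S × A}
  (R : GoodRun M φ b ρ π sref s1 lam κ βref β0 b1 ι ω)
include R

/-- `var_le_two_mul` makes the starred matrix at most twice the estimated one, so the norms compare
with factor √2, and 16² · 2 = 512 ≤ 529 = 23². -/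
theorem wnorm_Zhat_le (h : Fin H) (z : S × A) :
    16 * wnorm ((runInput M sref s1 lam κ βref β0 b1 ω).Zhat φ h)⁻¹ (φ z)
      ≤ 23 * wnorm (Zstar M φ lam (observe M fun τ => ω (1, τ)) h)⁻¹ (φ z) := by
  have h1 := wnorm_ridgeMatrix_inv_le φ R.largeSample.pos_lam (observe M fun τ => ω (1, τ))
    Finset.univ (var_one_le (φ := φ) (runInput M sref s1 lam κ βref β0 b1 ω) h)
    (fun z => le_max_left 1 (stepVar M h (optValue M H (h + 1)) z)) one_le_two
    (R.var_le_two_mul h) h (φ z)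
  refine (sq_le_sq₀ (mul_nonneg (by norm_num) (wnorm_nonneg _ _))
    (mul_nonneg (by norm_num) (wnorm_nonneg _ _))).1 ?_
  rw [mul_pow, mul_pow]
  have h2 := sq_nonneg (wnorm (Zstar M φ lam (observe M fun τ => ω (1, τ)) h)⁻¹ (φ z))
  calc _ ≤ (16 : ℝ) ^ 2 * (2 * wnorm (Zstar M φ lam (observe M fun τ => ω (1, τ)) h)⁻¹ (φ z) ^ 2) :=
        mul_le_mul_of_nonneg_left h1 (by norm_num)
    _ ≤ _ := by linarith

/-- A crude uniform bound that serves only to make the expectations of this norm along trajectories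
finite. -/
theorem wnorm_Zstar_le (h : Fin H) (z : S × A) :
    wnorm (Zstar M φ lam (observe M fun τ => ω (1, τ)) h)⁻¹ (φ z)
      ≤ H * (3 / 2 * (H * √(H / (K * κ)))) := by
  have hH := R.largeSample.one_le_H
  have h1 := wnorm_ridgeMatrix_inv_le φ R.largeSample.pos_lam (observe M fun τ => ω (1, τ))
    Finset.univ (fun z => le_max_left 1 (stepVar M h (optValue M H (h + 1)) z))
    (var_one_le (φ := φ) (runInput M sref s1 lam κ βref β0 b1 ω) h) (one_le_pow₀ hH (n := 2))
    (fun z => (truncVar_optValue_le R.optimal h z).trans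
      (le_mul_of_one_le_right (by positivity) (var_one_le _ h z))) h (φ z)
  refine (sq_le_sq₀ (wnorm_nonneg _ _) (by positivity)).1 (h1.trans ?_)
  rw [mul_pow]
  exact mul_le_mul_of_nonneg_left
    (pow_le_pow_left₀ (wnorm_nonneg _ _) (R.w0_error_le h z).2 2) (by positivity)

variable [DiscreteMeasurableSpace A]

/-- The greedy policy is at least as good as its pessimistic estimate. -/
theorem Vhat_le_value {πhat : Policy S A}
    (hgreedy : IsGreedy ((runInput M sref s1 lam κ βref β0 b1 ω).Qhat φ) πhat) (x : S) :
    (runInput M sref s1 lam κ βref β0 b1 ω).Vhat φ 0 x ≤ value M H πhat 0 x := by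
  set I := runInput M sref s1 lam κ βref β0 b1 ω with hI
  have hm : ∀ k, Measurable (I.Vhat φ k) := fun k =>
    measurable_Vhat_apply R.linear.measurable_feature sref s1 lam κ βref β0 b1 ω k
  have hb : ∀ k x, |I.Vhat φ k x| ≤ H := fun k x =>
    abs_le_of_mem_Icc (Nat.sub_le H k) (Vhat_mem I k x)
  have hb' : ∀ k x, |value M H πhat k x| ≤ H := fun k x =>
    abs_le_of_mem_Icc (Nat.sub_le H k) ⟨value_nonneg M H πhat k x, value_le M H πhat k x⟩
  -- With vanishing one-step terms, the comparison says that a function lying below its own Bellman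
  -- update under the greedy policy lies below the value of that policy.
  have key := le_cumulative_of_step_le M πhat (H := H) (g := fun _ _ => 0) (c := 0)
    (fun _ => measurable_const) (fun _ _ => by simp)
    (D := fun k x => I.Vhat φ k x - value M H πhat k x) (e := H + H)
    (fun k => (hm k).sub (measurable_value M H πhat k))
    (fun k x => (abs_sub _ _).trans (add_le_add (hb k x) (hb' k x)))
    (fun x => by
      have e : I.Vhat φ H x = 0 := by
        unfold Input.Vhat
        rw [backward_of_le _ le_rfl]
      rw [e, value_of_le M H πhat le_rfl, sub_zero])
    (fun k hk x => by
      have hQ := R.Qhat_bounds ⟨k, hk⟩ (R.advantage_le (k + 1))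
      have h1 : I.Vhat φ k x ≤ ∫ a, I.Qhat φ ⟨k, hk⟩ (x, a) ∂(πhat.ker k x) := by
        have e : I.Vhat φ k x = ⨆ a, I.Qhat φ ⟨k, hk⟩ (x, a) := backward_of_lt _ hk x
        rw [e]
        refine ciSup_le fun a => ?_
        -- Testing greediness against point masses shows that the average under the greedy policy
        -- dominates every single action.
        have := hgreedy ⟨k, hk⟩ x (Measure.dirac a) inferInstance
        rwa [integral_dirac] at this
      have hi : ∀ {U : S → ℝ} {c : ℝ}, (∀ x, |U x| ≤ c) →
          Integrable (fun a => ∫ y, U y ∂(M.P k (x, a))) (πhat.ker k x) := fun hU =>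
        integrable_of_measurable_of_abs_le (Measurable.of_discrete)
          fun a => abs_integral_le_of_abs_le hU
      have hr : Integrable (fun a => M.r k (x, a)) (πhat.ker k x) :=
        integrable_of_measurable_of_abs_le (Measurable.of_discrete) fun a => abs_reward_le M k _
      have hq : Integrable (fun a => I.Qhat φ ⟨k, hk⟩ (x, a)) (πhat.ker k x) :=
        integrable_of_measurable_of_abs_le (b := (H : ℝ) - k) (Measurable.of_discrete) fun a => by
          have := stepQ_mem (φ := φ) I ⟨k, hk⟩ (I.Vhat φ (k + 1)) (x, a)
          rw [abs_of_nonneg]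
          exacts [this.2, this.1]
      have h2 := integral_mono hq (hr.add (hi (hb (k + 1)))) fun a => (hQ (x, a)).1
      rw [value_step M H πhat hk x]
      simp only [zero_add]
      have h3 : ∀ a, ∫ y, (I.Vhat φ (k + 1) y - value M H πhat (k + 1) y) ∂(M.P k (x, a))
          = ∫ y, I.Vhat φ (k + 1) y ∂(M.P k (x, a))
            - ∫ y, value M H πhat (k + 1) y ∂(M.P k (x, a)) := fun a =>
        integral_sub (integrable_of_measurable_of_abs_le (hm _) (hb _))
          (integrable_of_measurable_of_abs_le (measurable_value M H πhat _) (hb' _))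
      simp_rw [h3]
      rw [integral_sub (hi (hb (k + 1))) (hi (hb' (k + 1))), integral_add hr (hi (hb' (k + 1)))]
      have h4 : ∫ a, ((fun a => M.r k (x, a)) +
          fun a => ∫ y, I.Vhat φ (k + 1) y ∂(M.P k (x, a))) a ∂(πhat.ker k x)
          = ∫ a, M.r k (x, a) ∂(πhat.ker k x) +
            ∫ a, ∫ y, I.Vhat φ (k + 1) y ∂(M.P k (x, a)) ∂(πhat.ker k x) :=
        integral_add hr (hi (hb (k + 1)))
      linarith) H 0 (zero_add H) x
  simp only [cumulative, Finset.sum_const_zero, integral_zero] at key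
  linarith

/-- The pessimistic estimate loses the accumulated one-step losses along an optimal policy. -/
theorem optValue_sub_Vhat_le (x : S) :
    optValue M H 0 x - (runInput M sref s1 lam κ βref β0 b1 ω).Vhat φ 0 x ≤
      23 * ι * √(d : ℝ) * ∑ h : Fin H,
        ∫ t, wnorm (Zstar M φ lam (observe M fun τ => ω (1, τ)) h)⁻¹ (φ (t h))
          ∂(rollout M π H 0 x)
        + 728 * (ι ^ 2 * (d * (H : ℝ) ^ 4 / (K * κ))) := by
  set I := runInput M sref s1 lam κ βref β0 b1 ω with hI
  have N := R.largeSample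
  have hH := N.one_le_H; have hκ := N.pos_κ
  have hι0 : 0 ≤ ι := zero_le_one.trans N.one_le_ι
  have hm : ∀ k, Measurable (I.Vhat φ k) := fun k =>
    measurable_Vhat_apply R.linear.measurable_feature sref s1 lam κ βref β0 b1 ω k
  have hm' : ∀ k, Measurable (optValue M H k) := measurable_optValue R.optimal
  have hb : ∀ k x, |I.Vhat φ k x| ≤ H := fun k x =>
    abs_le_of_mem_Icc (Nat.sub_le H k) (Vhat_mem I k x)
  have hb' : ∀ k x, |optValue M H k x| ≤ H := fun k x =>
    abs_le_of_mem_Icc (Nat.sub_le H k) (optValue_mem R.optimal k x)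
  set Z : Fin H → S × A → ℝ := fun h z =>
    wnorm (Zstar M φ lam (observe M fun τ => ω (1, τ)) h)⁻¹ (φ z) with hZ
  set E : ℝ := 728 * (ι ^ 2 * (d * (H : ℝ) ^ 3 / (K * κ))) with hE
  have hE0 : 0 ≤ E := by positivity
  set cZ : ℝ := H * (3 / 2 * (H * √(H / (K * κ)))) with hcZ
  have hcZ0 : 0 ≤ cZ := by positivity
  have hZm : ∀ h, Measurable (Z h) := fun h =>
    measurable_wnorm_inv_feature R.linear.measurable_feature _
  have hZ0 : ∀ h z, 0 ≤ Z h z := fun h z => wnorm_nonneg _ _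
  have hZb : ∀ h z, |Z h z| ≤ cZ := fun h z => by
    rw [abs_of_nonneg (hZ0 h z)]; exact R.wnorm_Zstar_le h z
  -- The accumulated terms are indexed by all of ℕ, whereas the matrices exist only for steps below
  -- H; the value beyond H is immaterial.
  set g : ℕ → S × A → ℝ := fun k z =>
    if hk : k < H then 23 * ι * √(d : ℝ) * Z ⟨k, hk⟩ z + E else 0 with hg
  have hgm : ∀ k, Measurable (g k) := fun k => by
    by_cases hk : k < H
    · simp only [hg, hk, dif_pos]; exact ((hZm _).const_mul _).add_const _
    · simp only [hg, hk, dif_neg, not_false_eq_true]; exact measurable_const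
  have hgb : ∀ k z, |g k z| ≤ 23 * ι * √(d : ℝ) * cZ + E := fun k z => by
    by_cases hk : k < H
    · simp only [hg, hk, dif_pos]
      rw [abs_of_nonneg (add_nonneg (mul_nonneg (by positivity) (hZ0 _ _)) hE0)]
      have := mul_le_mul_of_nonneg_left ((le_abs_self _).trans (hZb ⟨k, hk⟩ z))
        (show 0 ≤ 23 * ι * √(d : ℝ) by positivity)
      linarith
    · simp only [hg, hk, dif_neg, not_false_eq_true, abs_zero]; positivity
  have key := le_cumulative_of_step_le M π (H := H) hgm hgb
    (D := fun k x => optValue M H k x - I.Vhat φ k x) (e := H + H)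
    (fun k => (hm' k).sub (hm k))
    (fun k x => (abs_sub _ _).trans (add_le_add (hb' k x) (hb k x)))
    (fun x => by
      have e : I.Vhat φ H x = 0 := by
        unfold Input.Vhat
        rw [backward_of_le _ le_rfl]
      rw [e, R.optimal.optValue_eq, value_of_le M H π le_rfl, sub_zero])
    (fun k hk x => by
      have hQ := R.Qhat_bounds ⟨k, hk⟩ (R.advantage_le (k + 1))
      have hi : ∀ {U : S → ℝ} {c : ℝ}, (∀ x, |U x| ≤ c) →
          Integrable (fun a => ∫ y, U y ∂(M.P k (x, a))) (π.ker k x) := fun hU =>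
        integrable_of_measurable_of_abs_le (Measurable.of_discrete)
          fun a => abs_integral_le_of_abs_le hU
      have hr : Integrable (fun a => M.r k (x, a)) (π.ker k x) :=
        integrable_of_measurable_of_abs_le (Measurable.of_discrete) fun a => abs_reward_le M k _
      have hgi : Integrable (fun a => g k (x, a)) (π.ker k x) :=
        integrable_of_measurable_of_abs_le (Measurable.of_discrete) fun a => hgb k _
      have hD : ∀ y, |optValue M H (k + 1) y - I.Vhat φ (k + 1) y| ≤ (H : ℝ) + H := fun y =>
        (abs_sub _ _).trans (add_le_add (hb' _ y) (hb _ y))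
      have hstep : ∀ a, M.r k (x, a) + ∫ y, optValue M H (k + 1) y ∂(M.P k (x, a)) ≤
          I.Vhat φ k x + (g k (x, a) +
            ∫ y, (optValue M H (k + 1) y - I.Vhat φ (k + 1) y) ∂(M.P k (x, a))) := fun a => by
        have h1 : I.Qhat φ ⟨k, hk⟩ (x, a) ≤ I.Vhat φ k x := by
          have e : I.Vhat φ k x = ⨆ a, I.Qhat φ ⟨k, hk⟩ (x, a) := backward_of_lt _ hk x
          rw [e]
          exact le_ciSup (bddAbove_backward (stepQ_mem I) ⟨k, hk⟩ _ x) a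
        have h2 := (hQ (x, a)).2
        have h3 : 2 * β0 * wnorm (I.Zhat φ ⟨k, hk⟩)⁻¹ (φ (x, a))
            ≤ 23 * ι * √(d : ℝ) * Z ⟨k, hk⟩ (x, a) := by
          have := mul_le_mul_of_nonneg_left (R.wnorm_Zhat_le ⟨k, hk⟩ (x, a))
            (show 0 ≤ ι * √(d : ℝ) by positivity)
          rw [R.β0_eq]
          linarith
        have h4 : g k (x, a) = 23 * ι * √(d : ℝ) * Z ⟨k, hk⟩ (x, a) + E := dif_pos hk
        rw [h4, integral_sub (integrable_of_measurable_of_abs_le (hm' _) (hb' _))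
          (integrable_of_measurable_of_abs_le (hm _) (hb _))]
        linarith
      have h5 := integral_mono (hr.add (hi (hb' (k + 1))))
        ((integrable_const (I.Vhat φ k x)).add (hgi.add (hi hD))) hstep
      have h6 : ∫ a, (I.Vhat φ k x + (g k (x, a) +
            ∫ y, (optValue M H (k + 1) y - I.Vhat φ (k + 1) y) ∂(M.P k (x, a)))) ∂(π.ker k x)
          = I.Vhat φ k x + ∫ a, (g k (x, a) +
            ∫ y, (optValue M H (k + 1) y - I.Vhat φ (k + 1) y) ∂(M.P k (x, a))) ∂(π.ker k x) :=
        (integral_add (integrable_const _) (hgi.add (hi hD))).trans (by simp)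
      rw [R.optimal.step hk x, sub_le_iff_le_add']
      exact h5.trans_eq h6) H 0 (zero_add H) x
  refine key.trans_eq ?_
  have hinteg : ∀ h : Fin H, Integrable (fun t : Fin H → S × A => Z h (t h)) (rollout M π H 0 x) :=
    fun h => integrable_of_measurable_of_abs_le ((hZm h).comp (measurable_pi_apply h))
      fun t => hZb h _
  have e1 : ∀ t : Fin H → S × A, ∑ i : Fin H, g (0 + i) (t i)
      = 23 * ι * √(d : ℝ) * ∑ h, Z h (t h) + H * E := fun t => by
    have : ∀ i : Fin H, g (0 + i) (t i) = 23 * ι * √(d : ℝ) * Z i (t i) + E := fun i => by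
      simp [hg]
    simp_rw [this, Finset.sum_add_distrib, ← Finset.mul_sum]
    simp
  unfold cumulative
  simp_rw [e1]
  rw [integral_add ((integrable_finsetSum _ fun h _ => hinteg h).const_mul _) (integrable_const _),
    integral_const_mul, integral_finsetSum _ fun h _ => hinteg h]
  simp only [integral_const, probReal_univ, one_smul, hE]
  ring

theorem suboptimality_le {πhat : Policy S A}
    (hgreedy : IsGreedy ((runInput M sref s1 lam κ βref β0 b1 ω).Qhat φ) πhat) (x : S) :
    optValue M H 0 x - value M H πhat 0 x ≤
      728 * ι ^ 2 * √(d : ℝ) * ∑ h : Fin H,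
        ∫ t, wnorm (Zstar M φ lam (observe M fun τ => ω (1, τ)) h)⁻¹ (φ (t h))
          ∂(rollout M π H 0 x)
        + 728 * ι ^ 2 * (d * (H : ℝ) ^ 4 / (K * κ)) := by
  have h1 := R.Vhat_le_value hgreedy x
  have h2 := R.optValue_sub_Vhat_le x
  have hι := R.largeSample.one_le_ι
  have h3 : 23 * ι * √(d : ℝ) ≤ 728 * ι ^ 2 * √(d : ℝ) :=
    mul_le_mul_of_nonneg_right (by nlinarith) (Real.sqrt_nonneg _)
  have h4 := mul_le_mul_of_nonneg_right h3 (show 0 ≤ ∑ h : Fin H,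
        ∫ t, wnorm (Zstar M φ lam (observe M fun τ => ω (1, τ)) h)⁻¹ (φ (t h))
          ∂(rollout M π H 0 x) from
    Finset.sum_nonneg fun h _ => integral_nonneg fun t => wnorm_nonneg _ _)
  linarith

end GoodRun
end Suboptimality
end OfflineRL

namespace OfflineRL

/-! ### Sample-size conditions required by Bernstein's inequality. -/

namespace LargeSample

variable {H d K : ℕ} {κ lam ι : ℝ} (N : LargeSample H d K κ lam ι)
include N

theorem mul_coverage_sq_ge (k : ℕ) (hk : k ≤ 13) {c : ℝ} (hc : c ≤ 10 ^ 6) :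
    c * ι * d ^ 2 * (H : ℝ) ^ k ≤ K * κ ^ 2 := by
  have hH := N.one_le_H; have hι := N.one_le_ι
  refine le_trans ?_ N.large
  have h1 : ι ≤ ι ^ 2 := le_self_pow₀ hι (by norm_num)
  have h2 : (H : ℝ) ^ k ≤ (H : ℝ) ^ 13 := pow_le_pow_right₀ hH hk
  gcongr

theorem mul_coverage_ge (k : ℕ) (hk : k ≤ 13) {c : ℝ} (hc0 : 0 ≤ c) (hc : c ≤ 10 ^ 6) :
    c * ι * (H : ℝ) ^ k ≤ K * κ := by
  have hH := N.one_le_H; have hι := N.one_le_ι; have hd := N.one_le_d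
  have h1 : (1 : ℝ) ≤ (d : ℝ) ^ 2 := one_le_pow₀ hd
  calc c * ι * (H : ℝ) ^ k = c * ι * 1 * (H : ℝ) ^ k := by ring
    _ ≤ c * ι * d ^ 2 * (H : ℝ) ^ k := by gcongr
    _ ≤ K * κ ^ 2 := N.mul_coverage_sq_ge k hk hc
    _ ≤ K * κ := by
      refine mul_le_mul_of_nonneg_left ?_ N.pos_K.le
      nlinarith [N.κ_le_one, N.pos_κ]

theorem unweighted_noise {n : ℝ} (hn : K ≤ 2 * H * n) (B : ℝ) :
    3 * ι * (2 * B) ^ 2 ≤ n * B ^ 2 * (κ / 1) := by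
  have h1 := N.mul_coverage_ge 1 (by norm_num) (c := 24) (by norm_num) (by norm_num)
  have hH := N.one_le_H
  have h2 := mul_le_mul_of_nonneg_right hn N.pos_κ.le
  have h3 : 12 * ι ≤ n * κ := by
    refine le_of_mul_le_mul_left ?_ (show (0 : ℝ) < 2 * H by linarith)
    rw [pow_one] at h1
    linarith
  nlinarith [mul_le_mul_of_nonneg_right h3 (sq_nonneg B)]

theorem unweighted_covariance {n : ℝ} (hn : K ≤ 2 * H * n) :
    64 * d ^ 2 * (3 * ι) ≤ n * (κ / 1) ^ 2 := by
  have h1 := N.mul_coverage_sq_ge 1 (by norm_num) (c := 384) (by norm_num)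
  have hH := N.one_le_H
  have h2 := mul_le_mul_of_nonneg_right hn (sq_nonneg κ)
  refine le_of_mul_le_mul_left ?_ (show (0 : ℝ) < 2 * H by linarith)
  rw [pow_one] at h1
  rw [div_one]
  linarith

theorem weighted_noise : 3 * ι * (2 * (H : ℝ)) ^ 2 ≤ K * 2 * (κ / (H : ℝ) ^ 2) := by
  have h1 := N.mul_coverage_ge 4 (by norm_num) (c := 6) (by norm_num) (by norm_num)
  have hH := N.one_le_H
  rw [mul_div_assoc', le_div_iff₀ (by positivity)]
  linarith

theorem weighted_covariance : 64 * d ^ 2 * (3 * ι) ≤ K * (κ / (H : ℝ) ^ 2) ^ 2 := by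
  have h1 := N.mul_coverage_sq_ge 4 (by norm_num) (c := 192) (by norm_num)
  have hH := N.one_le_H
  rw [div_pow, mul_div_assoc', le_div_iff₀ (by positivity)]
  linarith

theorem advantageBound_pos : 0 < advantageBound H K d κ ι := by
  have hH := N.one_le_H; have hι := N.one_le_ι; have hd := N.one_le_d
  have hK := N.pos_K; have hκ := N.pos_κ
  unfold advantageBound
  positivity

end LargeSample

/-! ### The probability of good data -/

section Probability

variable {S : Type u} {A : Type v} {H K d : ℕ} [MeasurableSpace S] [MeasurableSpace A]

theorem measure_union₅_le {α ι : Type*} [MeasurableSpace α] [Fintype ι] (μ : Measure α)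
    (E₁ E₂ E₃ E₄ E₅ : ι → Set α) {p : ℝ} (hp : 0 ≤ p) (h₁ : ∀ i, μ (E₁ i) ≤ ENNReal.ofReal p)
    (h₂ : ∀ i, μ (E₂ i) ≤ ENNReal.ofReal p) (h₃ : ∀ i, μ (E₃ i) ≤ ENNReal.ofReal p)
    (h₄ : ∀ i, μ (E₄ i) ≤ ENNReal.ofReal p) (h₅ : ∀ i, μ (E₅ i) ≤ ENNReal.ofReal p) :
    μ (⋃ i, E₁ i ∪ E₂ i ∪ E₃ i ∪ E₄ i ∪ E₅ i) ≤ ENNReal.ofReal (Fintype.card ι * (5 * p)) := by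
  have h : ∀ i, μ (E₁ i ∪ E₂ i ∪ E₃ i ∪ E₄ i ∪ E₅ i) ≤ ENNReal.ofReal (5 * p) := fun i => by
    have e : ENNReal.ofReal (5 * p) = ENNReal.ofReal p + ENNReal.ofReal p + ENNReal.ofReal p
        + ENNReal.ofReal p + ENNReal.ofReal p := by
      rw [← ENNReal.ofReal_add, ← ENNReal.ofReal_add, ← ENNReal.ofReal_add, ← ENNReal.ofReal_add]
      · congr 1; ring
      all_goals positivity
    rw [e]
    refine (measure_union_le _ _).trans (add_le_add ?_ (h₅ i))
    refine (measure_union_le _ _).trans (add_le_add ?_ (h₄ i))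
    refine (measure_union_le _ _).trans (add_le_add ?_ (h₃ i))
    exact (measure_union_le _ _).trans (add_le_add (h₁ i) (h₂ i))
  refine (measure_iUnion_fintype_le μ _).trans ((Finset.sum_le_sum fun i _ => h i).trans_eq ?_)
  rw [Finset.sum_const, Finset.card_univ, nsmul_eq_mul, ENNReal.ofReal_mul (Nat.cast_nonneg (Fintype.card ι)),
    ENNReal.ofReal_natCast]

theorem piecewise_fresh_of_ne {X : Type*} {i j : Fin 4} (hij : j ≠ i) (T : Finset (Fin K))
    (ω ω' : Fin 4 × Fin K → X) (τ : Fin K) : (fresh i T).piecewise ω' ω (j, τ) = ω (j, τ) :=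
  Finset.piecewise_eq_of_notMem _ _ _ fun h => hij (mem_fresh.1 h).1

theorem piecewise_fresh_of_notMem {X : Type*} (i : Fin 4) {T : Finset (Fin K)}
    (ω ω' : Fin 4 × Fin K → X) {τ : Fin K} (hτ : τ ∉ T) :
    (fresh i T).piecewise ω' ω (i, τ) = ω (i, τ) :=
  Finset.piecewise_eq_of_notMem _ _ _ fun h => hτ (mem_fresh.1 h).2

variable {M : MDP S A} {φ : S × A → Fin d → ℝ} [Countable A] [Nonempty A]

/-- The data are good with high probability. -/
theorem goodData_failure_le (hlin : IsLinear M H φ) (b : Policy S A) (ρ : Measure S)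
    [IsProbabilityMeasure ρ] {sref s1 : Fin K → Fin H} (hsref : IsUniformSplit sref)
    (hs1 : IsUniformSplit s1) {lam κ ι δ : ℝ} (βref β0 b1 : ℝ) (hκ : κ = coverage M H φ b ρ)
    (N : LargeSample H d K κ lam ι) (hδ : 20 * H * d ^ 2 * Real.exp (-(3 * ι)) ≤ δ) :
    (Measure.pi fun _ : Fin 4 × Fin K => trajLaw M H b ρ)
      {ω | ¬ GoodData M φ sref s1 κ ι ω ((runInput M sref s1 lam κ βref β0 b1 ω).Vref φ)
        ((runInput M sref s1 lam κ βref β0 b1 ω).Vhat φ)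
        ((runInput M sref s1 lam κ βref β0 b1 ω).var φ)} ≤ ENNReal.ofReal δ := by
  have hH := N.one_le_H
  have hL : 0 < 3 * ι := by linarith [N.one_le_ι]
  have hHpos : (0 : ℝ) < H := by linarith
  have hφ := hlin.measurable_feature
  have hcard : ((Finset.univ : Finset (Fin K)).card : ℝ) = K := by simp
  have hKn : (K : ℝ) ≤ 2 * H * ((Finset.univ : Finset (Fin K)).card : ℝ) := by
    rw [hcard]; nlinarith [N.pos_K]
  have hR := N.advantageBound_pos
  have mVref := measurable_Vref M sref s1 lam κ βref β0 b1 hφ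
  have mVhat := measurable_Vhat M sref s1 lam κ βref β0 b1 hφ
  have mvar := measurable_var M sref s1 lam κ βref β0 b1 hφ
  have bVref : ∀ ω h x, |(runInput M sref s1 lam κ βref β0 b1 ω).Vref φ h x| ≤ H := fun ω h x =>
    abs_le_of_mem_Icc (Nat.sub_le H h) (Vref_mem _ h x)
  have bVref2 : ∀ ω h x, |(runInput M sref s1 lam κ βref β0 b1 ω).Vref φ h x ^ 2| ≤ (H : ℝ) ^ 2 :=
    fun ω h x => by rw [abs_pow]; exact pow_le_pow_left₀ (abs_nonneg _) (bVref ω h x) 2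
  have zVref : ∀ {h : ℕ}, h + 1 = H → ∀ ω x,
      (runInput M sref s1 lam κ βref β0 b1 ω).Vref φ (h + 1) x = 0 := fun hh ω x => by
    unfold Input.Vref speviV
    rw [backward_of_le _ hh.ge]
  have zVhat : ∀ {h : ℕ}, h + 1 = H → ∀ ω x,
      (runInput M sref s1 lam κ βref β0 b1 ω).Vhat φ (h + 1) x = 0 := fun hh ω x => by
    unfold Input.Vhat
    rw [backward_of_le _ hh.ge]
  have iVref : ∀ (i : Fin 4) (_ : (0 : Fin 4) ≠ i) (T : Finset (Fin K)) (h : ℕ) ω ω',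
      (runInput M sref s1 lam κ βref β0 b1 ((fresh i T).piecewise ω' ω)).Vref φ h
        = (runInput M sref s1 lam κ βref β0 b1 ω).Vref φ h := fun i hi T h ω ω' =>
    Vref_congr M sref s1 lam κ βref β0 b1 h fun τ _ => piecewise_fresh_of_ne hi T ω ω' τ
  -- A trajectory relevant to the value at step h + 1 lies in a part with index at least h + 1, so
  -- it is outside part h, the one being regressed.
  have f1 := fun h : Fin H => regression_failure_le hlin b ρ 0
    (Finset.univ.filter fun τ => sref τ = h) (σ := fun _ _ => 1)
    (V := fun ω => (runInput M sref s1 lam κ βref β0 b1 ω).Vref φ (h + 1)) (h := h) (m := 1)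
    (B := H) (v := (H : ℝ) ^ 2) hκ N.pos_κ measurable_const (mVref _) (fun _ _ => rfl)
    (fun ω ω' => Vref_congr M sref s1 lam κ βref β0 b1 _ fun τ hτ =>
      piecewise_fresh_of_notMem 0 ω ω' (by
        rw [Finset.mem_filter]; rintro ⟨-, e⟩; rw [e] at hτ; omega))
    zVref (by positivity) hL (N.unweighted_noise (hsref.card_ge N.two_H_le h) _)
    (N.unweighted_covariance (hsref.card_ge N.two_H_le h))
  have f2 := fun h : Fin H => regression_failure_le hlin b ρ 2
    Finset.univ (σ := fun _ _ => 1)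
    (V := fun ω x => (runInput M sref s1 lam κ βref β0 b1 ω).Vref φ (h + 1) x ^ 2) (h := h)
    (m := 1) (B := (H : ℝ) ^ 2) (v := ((H : ℝ) ^ 2) ^ 2) hκ N.pos_κ measurable_const
    ((mVref (h + 1)).pow_const 2) (fun _ _ => rfl)
    (fun ω ω' => by rw [iVref 2 (by decide)])
    (fun hh ω x => by rw [zVref hh, zero_pow two_ne_zero]) (by positivity) hL
    (N.unweighted_noise hKn _) (N.unweighted_covariance hKn)
  have f3 := fun h : Fin H => regression_failure_le hlin b ρ 2
    Finset.univ (σ := fun _ _ => 1)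
    (V := fun ω => (runInput M sref s1 lam κ βref β0 b1 ω).Vref φ (h + 1)) (h := h)
    (m := 1) (B := H) (v := (H : ℝ) ^ 2) hκ N.pos_κ measurable_const
    (mVref (h + 1)) (fun _ _ => rfl) (iVref 2 (by decide) _ _) zVref (by positivity) hL
    (N.unweighted_noise hKn _) (N.unweighted_covariance hKn)
  have f4 := fun h : Fin H => regression_failure_le hlin b ρ 1
    Finset.univ (σ := fun ω => (runInput M sref s1 lam κ βref β0 b1 ω).var φ h)
    (V := fun ω => (runInput M sref s1 lam κ βref β0 b1 ω).Vref φ (h + 1)) (h := h)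
    (m := (H : ℝ) ^ 2) (B := H) (v := 2) hκ N.pos_κ (mvar h) (mVref (h + 1))
    (fun ω ω' => var_congr M sref s1 lam κ βref β0 b1 h
      (piecewise_fresh_of_ne (by decide) _ ω ω') (piecewise_fresh_of_ne (by decide) _ ω ω'))
    (iVref 1 (by decide) _ _) zVref two_pos hL
    (by rw [hcard]; exact N.weighted_noise) (by rw [hcard]; exact N.weighted_covariance)
  -- The range and the variance proxy are those of a small advantage, not H. The target meets them
  -- only on part of the space, and the failure event is intersected with that part.
  have f5 := fun h : Fin H => regression_failure_le hlin b ρ 3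
    (Finset.univ.filter fun τ => s1 τ = h) (σ := fun _ _ => 1)
    (V := fun ω x => (runInput M sref s1 lam κ βref β0 b1 ω).Vhat φ (h + 1) x
      - (runInput M sref s1 lam κ βref β0 b1 ω).Vref φ (h + 1) x) (h := h) (m := 1)
    (B := advantageBound H K d κ ι) (v := advantageBound H K d κ ι ^ 2) hκ N.pos_κ
    measurable_const ((mVhat (h + 1)).sub (mVref (h + 1))) (fun _ _ => rfl)
    (fun ω ω' => by
      rw [iVref 3 (by decide), Vhat_congr M sref s1 lam κ βref β0 b1 _
        (piecewise_fresh_of_ne (by decide) _ ω ω') (piecewise_fresh_of_ne (by decide) _ ω ω')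
        (piecewise_fresh_of_ne (by decide) _ ω ω') fun τ hτ =>
          piecewise_fresh_of_notMem 3 ω ω' (by
            rw [Finset.mem_filter]; rintro ⟨-, e⟩; rw [e] at hτ; omega)])
    (fun hh ω x => by rw [zVref hh, zVhat hh, sub_zero])
    (by positivity) hL (N.unweighted_noise (hs1.card_ge N.two_H_le h) _)
    (N.unweighted_covariance (hs1.card_ge N.two_H_le h))
  -- Five regressions at each of H steps fail with probability at most 4 d² exp (-3 ι) each, which
  -- gives 20 H d² exp (-3 ι).
  refine le_trans (measure_mono ?_) ((measure_union₅_le _ _ _ _ _ _ (by positivity)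
    f1 f2 f3 f4 f5).trans (ENNReal.ofReal_le_ofReal ?_))
  · intro ω hω
    by_contra hcon
    refine hω ?_
    simp only [Set.mem_iUnion, Set.mem_union, Set.mem_ofPred_eq, not_exists, not_or, not_and,
      not_not] at hcon
    exact
      { reference := fun h => (hcon h).1.1.1.1 ⟨fun _ => le_rfl, fun _ => le_rfl, bVref ω _,
          fun z => by rw [mul_one]; exact stepVar_le_sq M h (bVref ω _) z⟩
        secondMoment := fun h => (hcon h).1.1.1.2 ⟨fun _ => le_rfl, fun _ => le_rfl, bVref2 ω _,
          fun z => by rw [mul_one]; exact stepVar_le_sq M h (bVref2 ω _) z⟩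
        firstMoment := fun h => (hcon h).1.1.2 ⟨fun _ => le_rfl, fun _ => le_rfl, bVref ω _,
          fun z => by rw [mul_one]; exact stepVar_le_sq M h (bVref ω _) z⟩
        weighted := fun h hv => (hcon h).1.2 ⟨var_one_le _ h, var_le _ h, bVref ω _, hv⟩
        advantage := fun h hB => (hcon h).2 ⟨fun _ => le_rfl, fun _ => le_rfl, hB,
          fun z => by rw [mul_one]; exact stepVar_le_sq M h hB z⟩ }
  · rw [Fintype.card_fin]
    linarith

end Probability
end OfflineRL

namespace OfflineRL

/-! ### From the stated sample size and the probability space to the analysis. -/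

section Parameters

variable {S : Type u} {A : Type v} [MeasurableSpace S] [MeasurableSpace A] {H K d : ℕ}

theorem one_le_log_four : 1 ≤ Real.log 4 := by
  rw [Real.le_log_iff_exp_le (by norm_num)]
  linarith [Real.exp_one_lt_three]

/-- κ d ≤ 1 and κ ≤ 1 give d κ² ≤ 1, which converts d / κ⁴ in the assumed sample size into d² / κ².
The argument of the logarithm is at least 4, so ι ≥ 1; the choice L = 3 ι makes exp (-L) the cube of
δ κ² / (4 H d), enough to beat 20 H d². -/
theorem largeSample_of_lt {κ lam δ : ℝ} (hH : 0 < H) (hd : 0 < d) (hκ0 : 0 < κ)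
    (hκd : κ * d ≤ 1) (hlam0 : 0 < lam) (hlam : lam < κ) (hδ0 : 0 < δ) (hδ1 : δ < 1)
    (hK : 10 ^ 6 * logFactor H d δ κ ^ 2 * (d * (H : ℝ) ^ 13 / κ ^ 4) < K) :
    LargeSample H d K κ lam (logFactor H d δ κ) ∧
      20 * H * d ^ 2 * Real.exp (-(3 * logFactor H d δ κ)) ≤ δ := by
  have hH1 : (1 : ℝ) ≤ H := by exact_mod_cast hH
  have hd1 : (1 : ℝ) ≤ d := by exact_mod_cast hd
  have hκ1 : κ ≤ 1 := by nlinarith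
  have hden : 0 < δ * κ ^ 2 := by positivity
  have hden1 : δ * κ ^ 2 ≤ 1 := mul_le_one₀ hδ1.le (by positivity) (pow_le_one₀ hκ0.le hκ1)
  have harg : 4 ≤ 4 * H * d / (δ * κ ^ 2) := by
    rw [le_div_iff₀ hden]
    nlinarith [mul_le_mul hH1 hd1 zero_le_one (by linarith)]
  have hι : 1 ≤ logFactor H d δ κ :=
    one_le_log_four.trans (Real.log_le_log (by norm_num) harg)
  refine ⟨⟨hH1, hd1, hκ0, hκd, hlam0, hlam, hι, ?_⟩, ?_⟩
  · have h1 : (d : ℝ) * κ ^ 2 ≤ 1 := by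
      calc (d : ℝ) * κ ^ 2 = (κ * d) * κ := by ring
        _ ≤ 1 := mul_le_one₀ hκd hκ0.le hκ1
    rw [mul_div_assoc', div_lt_iff₀ (by positivity)] at hK
    have h2 : 10 ^ 6 * logFactor H d δ κ ^ 2 * (d * (H : ℝ) ^ 13) * d
        ≤ K * κ ^ 2 * (d * κ ^ 2) := by
      calc _ ≤ K * κ ^ 4 * d := mul_le_mul_of_nonneg_right hK.le (by positivity)
        _ = _ := by ring
    calc _ = 10 ^ 6 * logFactor H d δ κ ^ 2 * (d * (H : ℝ) ^ 13) * d := by ring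
      _ ≤ K * κ ^ 2 * (d * κ ^ 2) := h2
      _ ≤ K * κ ^ 2 := mul_le_of_le_one_right (by positivity) h1
  · have he : Real.exp (-logFactor H d δ κ) = δ * κ ^ 2 / (4 * H * d) := by
      rw [logFactor, ← Real.log_inv, Real.exp_log (by positivity), inv_div]
    have he3 : Real.exp (-(3 * logFactor H d δ κ)) = (δ * κ ^ 2 / (4 * H * d)) ^ 3 := by
      rw [← he, ← Real.exp_nat_mul]; congr 1; push_cast; ring
    rw [he3, div_pow, mul_div_assoc', div_le_iff₀ (by positivity)]
    have h3 : (δ * κ ^ 2) ^ 3 ≤ δ := by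
      calc (δ * κ ^ 2) ^ 3 ≤ δ * κ ^ 2 := pow_le_of_le_one hden.le hden1 (by norm_num)
        _ ≤ δ := mul_le_of_le_one_right hδ0.le (pow_le_one₀ hκ0.le hκ1)
    have h4 : 20 * H * (d : ℝ) ^ 2 ≤ (4 * H * d) ^ 3 := by
      have a : (H : ℝ) ≤ (H : ℝ) ^ 3 := le_self_pow₀ hH1 (by norm_num)
      have b : (d : ℝ) ^ 2 ≤ (d : ℝ) ^ 3 := pow_le_pow_right₀ hd1 (by norm_num)
      calc 20 * H * (d : ℝ) ^ 2 ≤ 64 * (H : ℝ) ^ 3 * d ^ 3 := by gcongr; norm_num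
        _ = _ := by ring
    calc 20 * H * (d : ℝ) ^ 2 * (δ * κ ^ 2) ^ 3 ≤ (4 * H * d) ^ 3 * δ := by gcongr
      _ = _ := mul_comm _ _

theorem Policy.nonempty_action (b : Policy S A) (ρ : Measure S) [IsProbabilityMeasure ρ] :
    Nonempty A := by
  obtain ⟨x⟩ := nonempty_of_isProbabilityMeasure ρ
  exact nonempty_of_isProbabilityMeasure (b.ker 0 x)

/-- Events about independent trajectories with a common law are events of the product law. -/
theorem measure_preimage_le_pi {Ω X ι : Type*} [Fintype ι] [MeasurableSpace Ω] [MeasurableSpace X]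
    {Pr : Measure Ω} [IsProbabilityMeasure Pr] {μ : Measure X} {T : ι → Ω → X}
    (hindep : iIndepFun T Pr) (hlaw : ∀ i, HasLaw (T i) μ Pr) (E : Set (ι → X)) :
    Pr {ω | (fun i => T i ω) ∈ E} ≤ Measure.pi (fun _ => μ) E := by
  have hm : ∀ i, AEMeasurable (T i) Pr := fun i => (hlaw i).aemeasurable
  have h := (iIndepFun_iff_map_fun_eq_pi_map hm).1 hindep
  simp_rw [fun i => (hlaw i).map_eq] at h
  rw [← h]
  -- This inequality holds for arbitrary sets, so the failure event, which quantifies over policies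
  -- and states, need not be measurable.
  exact Measure.le_map_apply (aemeasurable_pi_lambda _ hm) E

end Parameters
end OfflineRL

theorem theorem2 :
    ∃ (cref c0 c1 cK C : ℝ) (pref p0 p1 pK p : ℕ),
      0 < cref ∧ 0 < c0 ∧ 0 < c1 ∧ 0 < cK ∧ 0 < C ∧
      ∀ (S : Type u) (A : Type v) (Ω : Type w) [MeasurableSpace S]
        [MeasurableSpace A] [DiscreteMeasurableSpace A] [Countable A] [MeasurableSpace Ω]
        (Pr : Measure Ω) [IsProbabilityMeasure Pr]
        (H K d : ℕ) (M : MDP S A) (φ : S × A → Fin d → ℝ) (_hlin : IsLinear M H φ)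
        (b : Policy S A) (ρ : Measure S) [IsProbabilityMeasure ρ]
        (πstar : Policy S A) (_hopt : IsOptimal M H πstar)
        (T : Fin 4 → Fin K → Ω → Fin H → S × A)
        (_hindep : iIndepFun (fun i : Fin 4 × Fin K => T i.1 i.2) Pr)
        (_hlaw : ∀ i τ, HasLaw (T i τ) (trajLaw M H b ρ) Pr)
        (sref s1 : Fin K → Fin H) (_hsref : IsUniformSplit sref) (_hs1 : IsUniformSplit s1)
        (κ lam δ : ℝ) (_hκ : κ = coverage M H φ b ρ) (_hκ0 : 0 < κ)
        (_hlam0 : 0 < lam) (_hlam : lam < κ) (_hδ0 : 0 < δ) (_hδ1 : δ < 1)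
        (_hK : max (512 * H * Real.log (4 * H * d / (δ * κ ^ 2)))
            (cK * logFactor H d δ κ ^ pK * (d * (H : ℝ) ^ 13 / κ ^ 4)) < K),
        Pr {ω | ¬ ∀ πhat : Policy S A,
            IsGreedy ((mkInput M (fun i τ => T i τ ω) sref s1 lam κ
              (cref * logFactor H d δ κ ^ pref * (√(d : ℝ) * H))
              (c0 * logFactor H d δ κ ^ p0 * √(d : ℝ))
              (c1 * logFactor H d δ κ ^ p1 * (d * (H : ℝ) ^ 3 / (K * κ)))).Qhat φ) πhat →
            ∀ x : S,
            optValue M H 0 x - value M H πhat 0 x ≤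
              C * logFactor H d δ κ ^ p * √(d : ℝ) *
                ∑ h : Fin H, ∫ t, wnorm (Zstar M φ lam (observe M fun τ => T 1 τ ω) h)⁻¹ (φ (t h))
                  ∂(rollout M πstar H 0 x) +
              C * logFactor H d δ κ ^ p * (d * (H : ℝ) ^ 4 / (K * κ))} ≤ ENNReal.ofReal δ := by
  -- 6 and 8 bound noise plus bias in the plain and weighted regressions, 360 is the advantage
  -- error, and 728 = 8 + 2 · 360 is the second-order loss, which also dominates the leading
  -- constant 23.
  refine ⟨6, 8, 360, 10 ^ 6, 728, 1, 1, 2, 2, 2, by norm_num, by norm_num, by norm_num,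
    by norm_num, by norm_num, ?_⟩
  intro S A Ω _ _ _ _ _ Pr _ H K d M φ hlin b ρ _ πstar hopt T hindep hlaw sref s1 hsref hs1
    κ lam δ hκ hκ0 hlam0 hlam hδ0 hδ1 hK
  have hA : Nonempty A := b.nonempty_action ρ
  have hcov : 0 < coverage M H φ b ρ := hκ ▸ hκ0
  have hH := horizon_pos_of_coverage_pos hcov
  have hd := dim_pos_of_coverage_pos hcov
  have hκd : κ * d ≤ 1 := by rw [hκ]; exact coverage_mul_dim_le hlin hH
  obtain ⟨N, hδ⟩ := largeSample_of_lt hH hd hκ0 hκd hlam0 hlam hδ0 hδ1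
    ((le_max_right _ _).trans_lt hK)
  have hfail := goodData_failure_le hlin b ρ hsref hs1
    (6 * logFactor H d δ κ ^ 1 * (√(d : ℝ) * H)) (8 * logFactor H d δ κ ^ 1 * √(d : ℝ))
    (360 * logFactor H d δ κ ^ 2 * (d * (H : ℝ) ^ 3 / (K * κ))) hκ N hδ
  -- The failure event lies in the preimage of bad data. On good data the bound holds for every
  -- greedy policy and every state at once, so no further union bound is needed.
  refine le_trans (measure_mono ?_)
    ((measure_preimage_le_pi hindep (fun i => hlaw i.1 i.2) _).trans hfail)
  intro ω hω hgood
  refine hω fun πhat hgreedy x => ?_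
  have R : GoodRun M φ b ρ πstar sref s1 lam κ _ _ _ _ (fun i => T i.1 i.2 ω) :=
    { linear := hlin
      coverage_eq := hκ
      largeSample := N
      optimal := hopt
      split_ref := hsref
      split_one := hs1
      βref_eq := by ring
      β0_eq := by ring
      b1_eq := rfl
      good := hgood }
  exact R.suboptimality_le hgreedy x
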